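/- Let $m,n\ge 0$ be integers and $s$ a real number with $m<s\le n$. Let $\mathcal H^s$ be the $s$-dimensional Hausdorff (outer) measure on $\mathbb R^n$, let $\dim$ denote Hausdorff dimension, let $G(n,n-m)$ be the Grassmannian of $(n-m)$-dimensional linear subspaces of $\mathbb R^n$, and let $\gamma_{n,n-m}$ be the unique Borel probability measure on $G(n,n-m)$ that is invariant under the orthogonal group $O(n)$; for a set that is not $\gamma_{n,n-m}$-measurable, $\gamma_{n,n-m}$ means the outer measure. Let $A\subset\mathbb R^n$ be $\mathcal H^s$-measurable with $0<\mathcal H^s(A)<\infty$. Then the set of points $x\in\mathbb R^n$ with $$\gamma_{n,n-m}\bigl(\{V\in G(n,n-m):\dim (A\cap (V+x))=s-m\}\bigr)=0$$ has Hausdorff dimension at most $m$. Moreover, there is a Borel set $B\subset\mathbb R^n$ with $\dim B\le m$ such that for every $x\in\mathbb R^n\setminus B$, $$\gamma_{n,n-m}\bigl(\{V\in G(n,n-m):\dim (A\cap (V+x))=s-m\}\bigr)>0.$$ -/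

import Mathlib

open MeasureTheory Set
open scoped ENNReal

noncomputable section

/-- Euclidean space `ℝⁿ`, with the Euclidean norm. -/
abbrev E (n : ℕ) : Type := EuclideanSpace ℝ (Fin n)

/-- The orthogonal group `O(n)`: the operators `g` on `ℝⁿ` with `g* g = g g* = 1`, with the topology
and the Borel σ-algebra coming from the operator norm. -/
abbrev O (n : ℕ) : Type := unitary (E n →L[ℝ] E n)

instance E.instContinuousStar (n : ℕ) : ContinuousStar (E n →L[ℝ] E n) :=
  ⟨(ContinuousLinearMap.adjoint (𝕜 := ℝ) (E := E n) (F := E n)).continuous⟩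

/-- `O(n)` is compact (closed and bounded in a finite-dimensional space). -/
instance O.instCompactSpace (n : ℕ) : CompactSpace (O n) := by
  have : ProperSpace (E n →L[ℝ] E n) := FiniteDimensional.proper ℝ _
  suffices h : IsCompact (unitary (E n →L[ℝ] E n) : Set (E n →L[ℝ] E n)) from
    isCompact_iff_compactSpace.mp h
  refine Metric.isCompact_of_isClosed_isBounded (isClosed_unitary (R := E n →L[ℝ] E n)) ?_
  refine (Metric.isBounded_closedBall (x := (0 : E n →L[ℝ] E n)) (r := 1)).subset ?_
  intro g hg
  rw [mem_closedBall_zero_iff]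
  refine ContinuousLinearMap.opNorm_le_bound _ zero_le_one fun x => ?_
  rw [one_mul]
  exact ((Unitary.linearIsometryEquiv (⟨g, hg⟩ : O n)).norm_map x).le

/-- The normalized Haar measure on `O(n)`, of total mass one. -/
def haarO (n : ℕ) : Measure (O n) := Measure.haarMeasure ⊤

/-- The Grassmannian `G(n,k)` of `k`-dimensional linear subspaces of `ℝⁿ`. -/
def G (n k : ℕ) : Type := {V : Submodule ℝ (E n) // Module.finrank ℝ V = k}

namespace G

/-- The orthogonal projection of `ℝⁿ` onto the plane `V`, as an operator on `ℝⁿ`. -/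
def proj {n k : ℕ} (V : G n k) : E n →L[ℝ] E n := V.1.starProjection

/-- The usual topology of `G(n,k)`: that of the metric `d(V, W) = ‖P_V - P_W‖`. -/
instance instTopologicalSpace (n k : ℕ) : TopologicalSpace (G n k) :=
  TopologicalSpace.induced proj inferInstance

instance instMeasurableSpace (n k : ℕ) : MeasurableSpace (G n k) := borel _

instance instBorelSpace (n k : ℕ) : BorelSpace (G n k) := ⟨rfl⟩

/-- The image `g V` of a plane `V ∈ G(n,k)` under `g ∈ O(n)`. -/
def rotate {n k : ℕ} (g : O n) (V : G n k) : G n k :=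
  ⟨V.1.map ((Unitary.linearIsometryEquiv g).toLinearEquiv : E n →ₗ[ℝ] E n),
    (LinearEquiv.finrank_map_eq _ V.1).trans V.2⟩

theorem continuous_rotate {n k : ℕ} (V : G n k) : Continuous fun g : O n => rotate g V := by
  rw [continuous_induced_rng]
  have h : (proj ∘ fun g : O n => rotate g V) =
      fun g : O n => (g : E n →L[ℝ] E n) * proj V * ((star g : O n) : E n →L[ℝ] E n) := by
    funext g
    ext1 x
    exact Submodule.starProjection_map_apply (Unitary.linearIsometryEquiv g) V.1 x
  rw [h]
  exact (continuous_subtype_val.mul continuous_const).mul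
    (continuous_subtype_val.comp continuous_star)

/-- The coordinate plane spanned by the first `k` standard basis vectors of `ℝⁿ`. -/
def coordPlane (n k : ℕ) (h : k ≤ n) : G n k :=
  ⟨Submodule.span ℝ (range fun i : Fin k => EuclideanSpace.single (Fin.castLE h i) (1 : ℝ)), by
    have hli : LinearIndependent ℝ
        (fun i : Fin k => (EuclideanSpace.single (Fin.castLE h i) (1 : ℝ) : E n)) :=
      ((EuclideanSpace.orthonormal_single (𝕜 := ℝ) (ι := Fin n)).comp _
        (Fin.castLE_injective h)).linearIndependent
    simpa using finrank_span_eq_card hli⟩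

end G

/-- The orthogonally invariant Borel probability measure `γ_{n,k}` on `G(n,k)`, for `k ≤ n`: the
law of `g V₀` for a Haar-distributed `g ∈ O(n)`, where `V₀` is a coordinate plane. (For `k > n` the
Grassmannian is empty and the measure is zero.) -/
def gammaG (n k : ℕ) : Measure (G n k) :=
  if h : k ≤ n then (haarO n).map fun g => G.rotate g (G.coordPlane n k h) else 0

theorem isProbabilityMeasure_gammaG {n k : ℕ} (h : k ≤ n) :
    IsProbabilityMeasure (gammaG n k) := by
  have : IsProbabilityMeasure (haarO n) := ⟨Measure.haarMeasure_self (K₀ := ⊤)⟩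
  rw [gammaG, dif_pos h]
  exact Measure.isProbabilityMeasure_map (G.continuous_rotate _).measurable.aemeasurable

theorem map_rotate_gammaG {n k : ℕ} (g : O n) :
    (gammaG n k).map (G.rotate g) = gammaG n k := by
  have hmul : ∀ (a b : O n) (V : G n k), G.rotate (a * b) V = G.rotate a (G.rotate b V) := by
    intro a b V
    refine Subtype.ext (SetLike.coe_injective ?_)
    simp [G.rotate, image_image]
  have hcont : Continuous (G.rotate g : G n k → G n k) := by
    rw [continuous_induced_rng]
    have h : (G.proj ∘ (G.rotate g : G n k → G n k)) =
        fun V => (g : E n →L[ℝ] E n) * G.proj V * ((star g : O n) : E n →L[ℝ] E n) := by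
      funext V
      ext1 x
      exact Submodule.starProjection_map_apply (Unitary.linearIsometryEquiv g) V.1 x
    rw [h]
    exact (continuous_const.mul continuous_induced_dom).mul continuous_const
  unfold gammaG
  split_ifs with h
  · rw [Measure.map_map hcont.measurable (G.continuous_rotate _).measurable]
    have hinv : (haarO n).map (fun a => g * a) = haarO n :=
      map_mul_left_eq_self (Measure.haarMeasure ⊤) g
    conv_rhs => rw [← hinv]
    rw [Measure.map_map (G.continuous_rotate _).measurable (measurable_const_mul g)]
    congr 1
    funext a
    exact (hmul g a _).symm
  · simp

/-- The translated plane `V + x`. -/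
def G.translate {n k : ℕ} (V : G n k) (x : E n) : Set (E n) := (fun v => v + x) '' (V.1 : Set (E n))

/-- The planes `V ∈ G(n, n-m)` with `dim (A ∩ (V + x)) = s - m`. -/
def sectionPlanes {n : ℕ} (m : ℕ) (s : ℝ) (A : Set (E n)) (x : E n) : Set (G n (n - m)) :=
  {V | dimH (A ∩ V.translate x) = ENNReal.ofReal (s - m)}

end

/-! The plane `V + x` is the zero set of `y ↦ transv m g (y - x)`, with `g` Haar distributed in
`O(n)` and `transv m g` the projection along the plane.

Upper bound, for every `x`: away from `x`, a set of diameter `d` is hit by a random plane through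
`x` with probability `O(d^m)` (`exists_haarO_norm_transv_le`). A cover with bounded `∑ d^s`
therefore induces, on average, covers of the sections with bounded `∑ d^(s-m)`, which gives
`ae_dimH_section_le`.

Lower bound: `exists_isCompact_growth` yields a compact `K ⊆ A` such that `μ = H^s|K` has growth
exponent `s`. Its projections are mollified by Gaussians (`smoothed`). The rotation average of the
Gaussian kernel is bounded by a multiple of `‖z‖⁻ᵐ` and converges to such a multiple
(`exists_avgKernel_asymptotics`), so `L²` pairings of smoothed projections approximate the
`m`-energy of `μ`, finite because `s > m`. Hence the smoothed projections are Cauchy in `L²`, and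
the pieces of `μ` in cubes of side `2⁻ᵏ` have total squared norm `O(2^(-k(s-m)))`.

These `L²` facts must be turned into facts about every `x` outside a set of dimension at most `m`.
The bridge is the capacitary estimate `exists_hContent_le`: by duality with measures of growth
exponent `τ > m`, whose projections are bounded in `L²`, a function with small `L²` norm has small
averages over the planes through `x`, except for `x` in a set of small `τ`-content. Applied to
`sliceControl`, with Borel–Cantelli, it gives one Borel set of dimension at most `m` outside which
the control is summable along almost every plane through `x`.

Along such a plane the densities converge. If the limit is positive, the weighted measures keep
their mass, concentrate on the section of `K`, and have dyadic square sums forcing dimension at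
least `s - m` (`le_dimH_slice`). The limit cannot vanish along almost every plane: the summable
control would then drive the averaged densities to zero, while by Fatou their liminf is at least a
positive multiple of `∫ ‖y - x‖⁻ᵐ dμ(y) > 0`. -/

noncomputable section

open Filter Topology

/-! ### Transversal coordinates of a plane -/

/-- The Euclidean space on the last `m` coordinates of `ℝⁿ`. -/
abbrev LastSpace (n m : ℕ) : Type := EuclideanSpace ℝ {i : Fin n // n - m ≤ (i : ℕ)}

theorem card_last_coords {n m : ℕ} (h : m ≤ n) :
    Fintype.card {i : Fin n // n - m ≤ (i : ℕ)} = m := by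
  have h1 : (Finset.univ.filter fun i : Fin n => (i : ℕ) < n - m).card = n - m := by
    rw [Fin.card_filter_val_lt]; omega
  have h2 := Finset.card_filter_add_card_filter_not (s := (Finset.univ : Finset (Fin n)))
    (fun i : Fin n => (i : ℕ) < n - m)
  rw [Fintype.card_subtype]
  simp only [not_lt, Finset.card_univ, Fintype.card_fin] at h2
  omega

theorem finrank_lastSpace {n m : ℕ} (h : m ≤ n) : Module.finrank ℝ (LastSpace n m) = m := by
  rw [finrank_euclideanSpace, card_last_coords h]

/-- The projection of `ℝⁿ` onto its last `m` coordinates. -/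
def lastProj (n m : ℕ) : E n →L[ℝ] LastSpace n m :=
  LinearMap.toContinuousLinearMap
    { toFun := fun z => WithLp.toLp 2 fun i => z i.1
      map_add' := fun _ _ => rfl
      map_smul' := fun _ _ => rfl }

theorem lastProj_apply {n m : ℕ} (z : E n) (i : {i : Fin n // n - m ≤ (i : ℕ)}) :
    lastProj n m z i = z i.1 := rfl

theorem norm_lastProj_sq {n m : ℕ} (z : E n) :
    ‖lastProj n m z‖ ^ 2 = ∑ i : Fin n, if n - m ≤ (i : ℕ) then z i ^ 2 else 0 := by
  rw [EuclideanSpace.norm_sq_eq, ← Finset.sum_filter]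
  simp only [lastProj_apply, Real.norm_eq_abs, sq_abs]
  exact (Finset.sum_subtype (Finset.univ.filter fun i : Fin n => n - m ≤ (i : ℕ)) (by simp)
    (fun i => z i ^ 2)).symm

theorem norm_lastProj_le {n m : ℕ} (z : E n) : ‖lastProj n m z‖ ≤ ‖z‖ := by
  refine le_of_sq_le_sq ?_ (norm_nonneg _)
  rw [norm_lastProj_sq, EuclideanSpace.norm_sq_eq]
  refine Finset.sum_le_sum fun i _ => ?_
  split_ifs
  · simp
  · positivity

theorem lastProj_eq_zero_iff {n m : ℕ} (z : E n) :
    lastProj n m z = 0 ↔ z ∈ (G.coordPlane n (n - m) (Nat.sub_le n m)).1 := by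
  constructor
  · intro h
    have hz : z = ∑ i : Fin n, z i • EuclideanSpace.single i (1 : ℝ) := by
      ext j
      simp [Finset.sum_apply, Pi.single_apply]
    rw [hz]
    refine Submodule.sum_mem _ fun i _ => ?_
    by_cases hi : n - m ≤ (i : ℕ)
    · have : z i = 0 := by
        have := congrArg (fun v : LastSpace n m => v ⟨i, hi⟩) h
        simpa [lastProj_apply] using this
      simp [this]
    · refine Submodule.smul_mem _ _ (Submodule.subset_span ⟨⟨i, by omega⟩, rfl⟩)
  · intro h
    have : (G.coordPlane n (n - m) (Nat.sub_le n m)).1 ≤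
        LinearMap.ker (lastProj n m : E n →ₗ[ℝ] LastSpace n m) := by
      refine Submodule.span_le.2 ?_
      rintro _ ⟨i, rfl⟩
      refine PiLp.ext fun j => ?_
      have hj := j.2
      have hne : j.1 ≠ Fin.castLE (Nat.sub_le n m) i := by
        intro e
        have := congrArg Fin.val e
        simp at this
        omega
      simp [lastProj_apply, hne]
    exact this h

/-- The coordinates of `x` transversal to the plane `g V₀`, where `V₀` is the coordinate plane. -/
def transv {n : ℕ} (m : ℕ) (g : O n) (x : E n) : LastSpace n m :=
  lastProj n m (((star g : O n) : E n →L[ℝ] E n) x)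

theorem star_apply_eq_symm {n : ℕ} (g : O n) (x : E n) :
    ((star g : O n) : E n →L[ℝ] E n) x = (Unitary.linearIsometryEquiv g).symm x := rfl

theorem transv_sub {n m : ℕ} (g : O n) (x y : E n) :
    transv m g (x - y) = transv m g x - transv m g y := by
  simp [transv]

theorem transv_smul {n m : ℕ} (g : O n) (c : ℝ) (x : E n) :
    transv m g (c • x) = c • transv m g x := by
  simp [transv]

theorem continuous_transv {n m : ℕ} :
    Continuous fun p : O n × E n => transv m p.1 p.2 := by
  unfold transv
  refine (lastProj n m).continuous.comp ?_
  have h : Continuous fun p : O n × E n => (((star p.1 : O n) : E n →L[ℝ] E n), p.2) :=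
    ((continuous_subtype_val.comp continuous_star).comp continuous_fst).prodMk continuous_snd
  exact isBoundedBilinearMap_apply.continuous.comp h

theorem measurable_transv_left {n m : ℕ} (x : E n) : Measurable fun g : O n => transv m g x :=
  (continuous_transv.comp (continuous_id.prodMk continuous_const)).measurable

theorem norm_transv_le {n m : ℕ} (g : O n) (x : E n) : ‖transv m g x‖ ≤ ‖x‖ := by
  refine (norm_lastProj_le _).trans ?_
  rw [star_apply_eq_symm, LinearIsometryEquiv.norm_map]

/-- Undoing the rotation carries the plane to the coordinate plane. From here on planes occur only
as zero sets of `transv`, and the measure on the Grassmannian only through Haar measure. -/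
theorem mem_translate_rotate_iff {n m : ℕ} (g : O n) (x y : E n) :
    y ∈ (G.rotate g (G.coordPlane n (n - m) (Nat.sub_le n m))).translate x ↔
      transv m g (y - x) = 0 := by
  rw [transv, lastProj_eq_zero_iff, star_apply_eq_symm]
  simp only [G.translate, G.rotate, mem_image, SetLike.mem_coe, Submodule.mem_map]
  constructor
  · rintro ⟨v, ⟨w, hw, rfl⟩, rfl⟩
    simpa using hw
  · intro h
    exact ⟨y - x, ⟨_, h, by simp⟩, by simp⟩

/-! ### Invariant averages over the orthogonal group -/

instance isProbabilityMeasure_haarO (n : ℕ) : IsProbabilityMeasure (haarO n) :=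
  ⟨Measure.haarMeasure_self (K₀ := ⊤)⟩

instance secondCountable_O (n : ℕ) : SecondCountableTopology (O n) := inferInstance

/-- `O(n)` acts transitively on spheres, so averages over `O(n)` depend only on the norm. -/
theorem lintegral_transv_eq_of_norm_eq {n m : ℕ} {f : LastSpace n m → ℝ≥0∞} {x y : E n}
    (h : ‖x‖ = ‖y‖) :
    ∫⁻ g, f (transv m g x) ∂haarO n = ∫⁻ g, f (transv m g y) ∂haarO n := by
  -- For `‖x‖ = ‖y‖` the reflection in the hyperplane orthogonal to `x - y` exchanges `x` and `y`;
  -- left invariance of Haar measure absorbs it.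
  set a : O n := Unitary.linearIsometryEquiv.symm (ℝ ∙ (x - y))ᗮ.reflection with ha
  have hax : Unitary.linearIsometryEquiv a x = y := by
    rw [ha, MulEquiv.apply_symm_apply]
    exact Submodule.reflection_sub h
  have key : ∀ g : O n, transv m g y = transv m (a⁻¹ * g) x := by
    intro g
    have h1 : (star (a⁻¹ * g) : O n) = star g * a := by
      have : a⁻¹ = star a := rfl
      rw [this, star_mul, star_star]
    simp only [transv, h1]
    congr 1
    rw [← hax]
    rfl
  simp only [key]
  have : (haarO n).IsMulLeftInvariant := by unfold haarO; infer_instance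
  exact (lintegral_mul_left_eq_self (fun g => f (transv m g x)) a⁻¹).symm

/-- A rotation average of a function of the direction, computed by integrating in polar form. -/
theorem lintegral_weight_mul_average {n m : ℕ} {f : LastSpace n m → ℝ≥0∞} (hf : Measurable f)
    {w : ℝ → ℝ≥0∞} (hw : Measurable w) {e : E n} (he : ‖e‖ = 1) :
    (∫⁻ z : E n, w ‖z‖) * ∫⁻ g, f (transv m g e) ∂haarO n =
      ∫⁻ z : E n, w ‖z‖ * f (‖z‖⁻¹ • lastProj n m z) := by
  have hmeas : Measurable fun p : O n × E n => w ‖p.2‖ * f (‖p.2‖⁻¹ • transv m p.1 p.2) :=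
    (hw.comp measurable_snd.norm).mul
      (hf.comp ((measurable_snd.norm.inv).smul continuous_transv.measurable))
  have h1 : ∀ g : O n, ∫⁻ z : E n, w ‖z‖ * f (‖z‖⁻¹ • transv m g z) =
      ∫⁻ z : E n, w ‖z‖ * f (‖z‖⁻¹ • lastProj n m z) := by
    intro g
    have hp := (Unitary.linearIsometryEquiv g).symm.measurePreserving
    rw [← hp.lintegral_comp (f := fun z : E n => w ‖z‖ * f (‖z‖⁻¹ • lastProj n m z))
      ((hw.comp measurable_norm).mul
        (hf.comp ((measurable_norm.inv).smul (lastProj n m).continuous.measurable)))]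
    simp only [LinearIsometryEquiv.norm_map, transv, star_apply_eq_symm]
  have h2 : ∫⁻ g, (∫⁻ z : E n, w ‖z‖ * f (‖z‖⁻¹ • transv m g z)) ∂haarO n =
      ∫⁻ z : E n, w ‖z‖ * f (‖z‖⁻¹ • lastProj n m z) := by
    simp only [h1, lintegral_const, measure_univ, mul_one]
  rw [← h2, lintegral_lintegral_swap hmeas.aemeasurable,
    ← lintegral_mul_const (f := fun z : E n => w ‖z‖) _ (hw.comp measurable_norm)]
  have : Nontrivial (E n) := ⟨⟨e, 0, fun h => by simp [h] at he⟩⟩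
  refine lintegral_congr_ae ?_
  -- For `z ≠ 0` the inner average is taken at the unit vector `‖z‖⁻¹ • z`, so it equals the average
  -- at `e`.
  filter_upwards [compl_mem_ae_iff.2 (measure_singleton (μ := (volume : Measure (E n))) 0)] with z hz
  rw [lintegral_const_mul (f := fun g => f (‖z‖⁻¹ • transv m g z)) _
    (hf.comp ((measurable_transv_left z).const_smul ‖z‖⁻¹))]
  have hz : z ≠ 0 := hz
  congr 1
  simp only [← transv_smul]
  refine lintegral_transv_eq_of_norm_eq ?_
  rw [he, norm_smul, norm_inv, norm_norm, inv_mul_cancel₀ (norm_ne_zero_iff.2 hz)]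

/-! ### Asymptotics of the averaged Gaussian kernel -/

/-- The `m`-dimensional Gaussian kernel of width `σ`, up to a constant factor. -/
def gaussK {F : Type*} [NormedAddCommGroup F] (m : ℕ) (σ : ℝ) (v : F) : ℝ :=
  (σ ^ m)⁻¹ * Real.exp (-(‖v‖ ^ 2 / σ ^ 2))

section gaussK

variable {F : Type*} [NormedAddCommGroup F] {m : ℕ}

theorem gaussK_nonneg {σ : ℝ} (hσ : 0 < σ) (v : F) : 0 ≤ gaussK m σ v := by
  unfold gaussK; positivity

theorem gaussK_le {σ : ℝ} (hσ : 0 < σ) (v : F) : gaussK m σ v ≤ (σ ^ m)⁻¹ := by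
  unfold gaussK
  refine mul_le_of_le_one_right (by positivity) ?_
  rw [Real.exp_le_one_iff, neg_nonpos]
  positivity

theorem continuous_gaussK (σ : ℝ) : Continuous (gaussK m σ : F → ℝ) := by
  unfold gaussK; fun_prop

theorem gaussK_smul [NormedSpace ℝ F] {σ r : ℝ} (hr : 0 < r) (v : F) :
    gaussK m σ (r • v) = (r ^ m)⁻¹ * gaussK m (σ / r) v := by
  unfold gaussK
  rw [norm_smul, Real.norm_of_nonneg hr.le, div_pow, div_pow, ← mul_assoc, ← mul_inv]
  congr 2
  · field_simp
  · field_simp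

end gaussK

/-- The linear map of `ℝⁿ` multiplying the last `m` coordinates by `σ`. -/
def lastScale (n m : ℕ) (σ : ℝ) : E n →ₗ[ℝ] E n :=
  Matrix.toLin (EuclideanSpace.basisFun (Fin n) ℝ).toBasis
    (EuclideanSpace.basisFun (Fin n) ℝ).toBasis
    (Matrix.diagonal fun i : Fin n => if n - m ≤ (i : ℕ) then σ else 1)

theorem lastScale_apply {n m : ℕ} (σ : ℝ) (z : E n) (i : Fin n) :
    lastScale n m σ z i = (if n - m ≤ (i : ℕ) then σ else 1) * z i := by
  rw [lastScale, Matrix.toLin_apply]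
  simp [Matrix.mulVec_diagonal, -ite_smul, Pi.single_apply]

theorem det_lastScale {n m : ℕ} (h : m ≤ n) (σ : ℝ) :
    LinearMap.det (lastScale n m σ) = σ ^ m := by
  rw [lastScale, LinearMap.det_toLin, Matrix.det_diagonal, Finset.prod_ite, Finset.prod_const,
    Finset.prod_const_one, mul_one, ← Fintype.card_subtype, card_last_coords h]

theorem lastProj_lastScale {n m : ℕ} (σ : ℝ) (z : E n) :
    lastProj n m (lastScale n m σ z) = σ • lastProj n m z := by
  refine PiLp.ext fun i => ?_
  rw [lastProj_apply, lastScale_apply, if_pos i.2]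
  rfl

theorem norm_lastScale_sq {n m : ℕ} (σ : ℝ) (z : E n) :
    ‖lastScale n m σ z‖ ^ 2 = ‖lastScale n m 0 z‖ ^ 2 + σ ^ 2 * ‖lastProj n m z‖ ^ 2 := by
  rw [norm_lastProj_sq, EuclideanSpace.norm_sq_eq, EuclideanSpace.norm_sq_eq, Finset.mul_sum,
    ← Finset.sum_add_distrib]
  refine Finset.sum_congr rfl fun i _ => ?_
  simp only [lastScale_apply, Real.norm_eq_abs, sq_abs]
  split_ifs <;> ring

theorem norm_sq_eq_lastScale {n m : ℕ} (z : E n) :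
    ‖z‖ ^ 2 = ‖lastScale n m 0 z‖ ^ 2 + ‖lastProj n m z‖ ^ 2 := by
  have h : lastScale n m 1 z = z := PiLp.ext fun i => by rw [lastScale_apply]; simp
  simpa [h] using norm_lastScale_sq (m := m) 1 z

theorem lintegral_comp_lastScale {n m : ℕ} (h : m ≤ n) {σ : ℝ} (hσ : 0 < σ) {f : E n → ℝ≥0∞}
    (hf : Measurable f) :
    ∫⁻ z, f (lastScale n m σ z) = ENNReal.ofReal (σ ^ m)⁻¹ * ∫⁻ z, f z := by
  have hd : LinearMap.det (lastScale n m σ) ≠ 0 := by rw [det_lastScale h]; positivity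
  have hc : Measurable (lastScale n m σ) :=
    (LinearMap.continuous_of_finiteDimensional _).measurable
  rw [← lintegral_map hf hc, Measure.map_linearMap_addHaar_eq_smul_addHaar _ hd,
    lintegral_smul_measure, det_lastScale h, abs_of_pos (by positivity), smul_eq_mul]

/-- The average of the Gaussian kernel at the transversal coordinates of `z`. -/
def avgKernel (n m : ℕ) (σ : ℝ) (z : E n) : ℝ≥0∞ :=
  ∫⁻ g, ENNReal.ofReal (gaussK m σ (transv m g z)) ∂haarO n

theorem avgKernel_le {n m : ℕ} {σ : ℝ} (hσ : 0 < σ) (z : E n) :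
    avgKernel n m σ z ≤ ENNReal.ofReal (σ ^ m)⁻¹ := by
  refine (lintegral_mono fun g => ENNReal.ofReal_le_ofReal (gaussK_le hσ _)).trans ?_
  simp

theorem measurable_avgKernel {n m : ℕ} (σ : ℝ) : Measurable (avgKernel n m σ) := by
  refine Measurable.lintegral_prod_left'
    (f := fun p : O n × E n => ENNReal.ofReal (gaussK m σ (transv m p.1 p.2))) ?_
  exact ((continuous_gaussK σ).comp continuous_transv).measurable.ennreal_ofReal

/-- Transitivity on spheres and the scaling of the Gaussian reduce all `z ≠ 0` to a single unit
vector, at width `σ / ‖z‖`; only one limit in the width is then needed. -/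
theorem avgKernel_eq_smul {n m : ℕ} {σ : ℝ} {z e : E n} (hz : z ≠ 0) (he : ‖e‖ = 1) :
    avgKernel n m σ z = ENNReal.ofReal (‖z‖ ^ m)⁻¹ * avgKernel n m (σ / ‖z‖) e := by
  have hz' : 0 < ‖z‖ := norm_pos_iff.2 hz
  rw [avgKernel, lintegral_transv_eq_of_norm_eq (y := ‖z‖ • e)
    (f := fun v => ENNReal.ofReal (gaussK m σ v)) (by simp [norm_smul, he]), avgKernel,
    ← lintegral_const_mul]
  · refine lintegral_congr fun g => ?_
    rw [transv_smul, gaussK_smul hz', ENNReal.ofReal_mul (by positivity)]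
  · exact ((continuous_gaussK _).measurable.comp (measurable_transv_left e)).ennreal_ofReal

/-- The integrand of `avgKernel` after rescaling the last coordinates. -/
def rescaledWeight (n m : ℕ) (σ : ℝ) (z : E n) : ℝ :=
  max 0 (1 - ‖lastScale n m σ z‖) *
    Real.exp (-(‖lastProj n m z‖ ^ 2 / ‖lastScale n m σ z‖ ^ 2))

theorem measurable_rescaledWeight {n m : ℕ} (σ : ℝ) : Measurable (rescaledWeight n m σ) := by
  have hc : Measurable (lastScale n m σ) :=
    (LinearMap.continuous_of_finiteDimensional _).measurable
  have hl : Measurable (lastProj n m) := (lastProj n m).continuous.measurable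
  unfold rescaledWeight
  fun_prop

/-- A radial weight of compact support turns the rotation average into a Lebesgue integral. Scaling
the last `m` coordinates by `σ` has Jacobian `σ ^ m`, which cancels the normalisation of the kernel
and leaves an integrand with a limit as `σ → 0`. -/
theorem lintegral_weight_mul_avgKernel {n m : ℕ} (h : m ≤ n) {σ : ℝ} (hσ : 0 < σ) {e : E n}
    (he : ‖e‖ = 1) :
    (∫⁻ z : E n, ENNReal.ofReal (max 0 (1 - ‖z‖))) * avgKernel n m σ e =
      ∫⁻ z : E n, ENNReal.ofReal (rescaledWeight n m σ z) := by
  rw [avgKernel, lintegral_weight_mul_average (w := fun r => ENNReal.ofReal (max 0 (1 - r)))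
    (continuous_gaussK σ).measurable.ennreal_ofReal (by fun_prop) he]
  have hF : Measurable fun z : E n => ENNReal.ofReal (max 0 (1 - ‖z‖) *
      Real.exp (-((‖z‖⁻¹ * ‖lastProj n m z‖) ^ 2 / σ ^ 2))) := by
    have hl : Measurable (lastProj n m) := (lastProj n m).continuous.measurable
    fun_prop
  have h1 := lintegral_comp_lastScale h hσ hF
  have h2 : ∀ z : E n, ENNReal.ofReal (rescaledWeight n m σ z) =
      ENNReal.ofReal (max 0 (1 - ‖lastScale n m σ z‖) *
      Real.exp (-((‖lastScale n m σ z‖⁻¹ * ‖lastProj n m (lastScale n m σ z)‖) ^ 2 / σ ^ 2))) := by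
    intro z
    rw [rescaledWeight, lastProj_lastScale, norm_smul, Real.norm_of_nonneg hσ.le]
    congr 4
    field_simp
  simp only [h2]
  rw [h1, ← lintegral_const_mul _ hF]
  refine lintegral_congr fun z => ?_
  rw [← ENNReal.ofReal_mul (by positivity), ← ENNReal.ofReal_mul (by positivity)]
  congr 1
  rw [gaussK, norm_smul, norm_inv, norm_norm]
  ring

/-- The weight vanishes unless `‖lastScale n m σ z‖ < 1`; there the first coordinates have norm at
most one and the exponent is at most `-‖lastProj n m z‖ ^ 2`. Uniformity in `σ` is what dominated
convergence needs. -/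
theorem rescaledWeight_le {n m : ℕ} {σ : ℝ} (hσ : 0 < σ) (z : E n) :
    rescaledWeight n m σ z ≤ Real.exp 1 * Real.exp (-‖z‖ ^ 2) := by
  by_cases h : ‖lastScale n m σ z‖ < 1
  · have h0 : 0 ≤ ‖lastScale n m σ z‖ := norm_nonneg _
    have h1 := norm_lastScale_sq (m := m) σ z
    have h2 := norm_sq_eq_lastScale (m := m) z
    have h3 : ‖lastScale n m 0 z‖ ^ 2 ≤ 1 := by
      have : 0 ≤ σ ^ 2 * ‖lastProj n m z‖ ^ 2 := by positivity
      nlinarith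
    unfold rescaledWeight
    have ha : max 0 (1 - ‖lastScale n m σ z‖) ≤ 1 := max_le zero_le_one (by linarith)
    rw [← Real.exp_add]
    refine (mul_le_of_le_one_left (Real.exp_pos _).le ha).trans (Real.exp_le_exp.2 ?_)
    -- When the rescaled vector is zero the quotient is `0` by convention, but `σ > 0` makes the
    -- last coordinates zero too.
    rcases h0.eq_or_lt with h4 | h4
    · rw [← h4] at h1 ⊢
      have h5 : 0 ≤ ‖lastProj n m z‖ ^ 2 := by positivity
      have h6 : ‖lastProj n m z‖ ^ 2 = 0 := by
        have : σ ^ 2 * ‖lastProj n m z‖ ^ 2 = 0 := by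
          have : 0 ≤ σ ^ 2 * ‖lastProj n m z‖ ^ 2 := by positivity
          nlinarith
        simpa [hσ.ne'] using this
      rw [h6]
      simp only [zero_div, neg_zero]
      nlinarith
    · have h5 : ‖lastProj n m z‖ ^ 2 ≤ ‖lastProj n m z‖ ^ 2 / ‖lastScale n m σ z‖ ^ 2 := by
        rw [le_div_iff₀ (by positivity)]
        exact mul_le_of_le_one_right (by positivity) (by nlinarith)
      linarith
  · rw [rescaledWeight, max_eq_left (by linarith), zero_mul]
    positivity

theorem lintegral_exp_neg_norm_sq_lt_top (n : ℕ) :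
    ∫⁻ z : E n, ENNReal.ofReal (Real.exp 1 * Real.exp (-‖z‖ ^ 2)) < ∞ := by
  have h := GaussianFourier.integral_rexp_neg_mul_sq_norm (V := E n) (b := 1) one_pos
  have hi : Integrable fun z : E n => Real.exp (-1 * ‖z‖ ^ 2) := by
    refine Integrable.of_integral_ne_zero ?_
    rw [h]
    positivity
  have hi' := (hi.const_mul (Real.exp 1)).lintegral_lt_top
  simpa using hi'

theorem tendsto_rescaledWeight {n m : ℕ} {z : E n} (hz : lastScale n m 0 z ≠ 0) :
    Tendsto (fun σ => rescaledWeight n m σ z) (𝓝[>] 0) (𝓝 (rescaledWeight n m 0 z)) := by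
  have hn : Tendsto (fun σ : ℝ => ‖lastScale n m σ z‖) (𝓝[>] 0) (𝓝 ‖lastScale n m 0 z‖) := by
    have h1 : ∀ σ : ℝ, ‖lastScale n m σ z‖ =
        √(‖lastScale n m 0 z‖ ^ 2 + σ ^ 2 * ‖lastProj n m z‖ ^ 2) := by
      intro σ
      rw [← norm_lastScale_sq, Real.sqrt_sq (norm_nonneg _)]
    have h2 : Continuous fun σ : ℝ => ‖lastScale n m σ z‖ := by
      rw [show (fun σ : ℝ => ‖lastScale n m σ z‖) = _ from funext h1]
      fun_prop
    exact (h2.tendsto 0).mono_left nhdsWithin_le_nhds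
  unfold rescaledWeight
  refine (tendsto_const_nhds.max (tendsto_const_nhds.sub hn)).mul ?_
  refine (Real.continuous_exp.tendsto _).comp (Tendsto.neg ?_)
  exact tendsto_const_nhds.div (hn.pow 2) (pow_ne_zero 2 (norm_ne_zero_iff.2 hz))

theorem exists_norm_eq_one {n : ℕ} (hn : 0 < n) : ∃ e : E n, ‖e‖ = 1 :=
  ⟨EuclideanSpace.single ⟨0, hn⟩ 1, by simp⟩

theorem weight_integral_pos (n : ℕ) : 0 < ∫⁻ z : E n, ENNReal.ofReal (max 0 (1 - ‖z‖)) := by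
  rw [lintegral_pos_iff_support (by fun_prop)]
  refine lt_of_lt_of_le (Metric.measure_ball_pos volume (0 : E n) one_pos) (measure_mono ?_)
  intro z hz
  simp only [Metric.mem_ball, dist_zero_right] at hz
  simp [hz]

theorem weight_integral_lt_top (n : ℕ) :
    ∫⁻ z : E n, ENNReal.ofReal (max 0 (1 - ‖z‖)) < ∞ := by
  refine lt_of_le_of_lt (lintegral_mono fun z => ENNReal.ofReal_le_ofReal ?_)
    (lintegral_exp_neg_norm_sq_lt_top n)
  by_cases h : ‖z‖ < 1
  · have h0 := norm_nonneg z
    rw [← Real.exp_add]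
    refine (max_le zero_le_one (by linarith)).trans (Real.one_le_exp ?_)
    nlinarith
  · rw [max_eq_left (by linarith)]
    positivity

/-- Since `m < n`, some coordinate survives `lastScale n m 0`, so the kernel is a proper subspace.
-/
theorem ae_lastScale_zero_ne {n m : ℕ} (h : m < n) : ∀ᵐ z : E n, lastScale n m 0 z ≠ 0 := by
  have hn : LinearMap.ker (lastScale n m 0) ≠ ⊤ := by
    intro ht
    have h1 : (EuclideanSpace.single ⟨0, by omega⟩ 1 : E n) ∈ LinearMap.ker (lastScale n m 0) := by
      rw [ht]; trivial
    have h2 := congrArg (fun v : E n => v ⟨0, by omega⟩) (LinearMap.mem_ker.1 h1)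
    simp only [lastScale_apply] at h2
    rw [if_neg (by simp; omega)] at h2
    simp at h2
  exact compl_mem_ae_iff.2 (Measure.addHaar_submodule volume _ hn)

theorem rescaledWeight_zero_integral_pos (n m : ℕ) :
    0 < ∫⁻ z : E n, ENNReal.ofReal (rescaledWeight n m 0 z) := by
  rw [lintegral_pos_iff_support (measurable_rescaledWeight 0).ennreal_ofReal]
  refine lt_of_lt_of_le (Metric.measure_ball_pos volume (0 : E n) one_pos) (measure_mono ?_)
  intro z hz
  simp only [Metric.mem_ball, dist_zero_right] at hz
  have h2 := norm_sq_eq_lastScale (m := m) z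
  have h3 : ‖lastScale n m 0 z‖ ≤ ‖z‖ := by
    refine le_of_sq_le_sq ?_ (norm_nonneg _)
    rw [h2]
    nlinarith [sq_nonneg ‖lastProj n m z‖]
  have h4 : 0 < rescaledWeight n m 0 z := by
    unfold rescaledWeight
    have : 0 < max 0 (1 - ‖lastScale n m 0 z‖) := lt_max_of_lt_right (by linarith)
    positivity
  simpa using h4

/-- The averaged kernel is comparable to `‖z‖⁻ᵐ`, and asymptotic to a multiple of it. -/
theorem exists_avgKernel_asymptotics {n m : ℕ} (h : m < n) :
    ∃ C : ℝ≥0∞, C ≠ ∞ ∧ ∃ c : ℝ≥0∞, 0 < c ∧ c ≠ ∞ ∧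
      (∀ σ : ℝ, 0 < σ → ∀ z : E n, z ≠ 0 →
        avgKernel n m σ z ≤ C * ENNReal.ofReal (‖z‖ ^ m)⁻¹) ∧
      ∀ z : E n, z ≠ 0 → Tendsto (fun σ => avgKernel n m σ z) (𝓝[>] 0)
        (𝓝 (c * ENNReal.ofReal (‖z‖ ^ m)⁻¹)) := by
  obtain ⟨e, he⟩ := exists_norm_eq_one (n := n) (by omega)
  set W := ∫⁻ z : E n, ENNReal.ofReal (max 0 (1 - ‖z‖)) with hW
  have hW0 : W ≠ 0 := (weight_integral_pos n).ne'
  have hWt : W ≠ ∞ := (weight_integral_lt_top n).ne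
  have hav : ∀ σ : ℝ, 0 < σ → avgKernel n m σ e =
      W⁻¹ * ∫⁻ z : E n, ENNReal.ofReal (rescaledWeight n m σ z) := by
    intro σ hσ
    rw [← lintegral_weight_mul_avgKernel h.le hσ he, ← mul_assoc, ENNReal.inv_mul_cancel hW0 hWt,
      one_mul]
  set I := ∫⁻ z : E n, ENNReal.ofReal (Real.exp 1 * Real.exp (-‖z‖ ^ 2)) with hI
  have hIt : I ≠ ∞ := (lintegral_exp_neg_norm_sq_lt_top n).ne
  have hWi : W⁻¹ ≠ ∞ := ENNReal.inv_ne_top.2 hW0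
  have hlim : Tendsto (fun σ => ∫⁻ z : E n, ENNReal.ofReal (rescaledWeight n m σ z)) (𝓝[>] 0)
      (𝓝 (∫⁻ z : E n, ENNReal.ofReal (rescaledWeight n m 0 z))) := by
    refine tendsto_lintegral_filter_of_dominated_convergence
      (fun z => ENNReal.ofReal (Real.exp 1 * Real.exp (-‖z‖ ^ 2)))
      (Eventually.of_forall fun σ => (measurable_rescaledWeight σ).ennreal_ofReal) ?_ hIt ?_
    · filter_upwards [self_mem_nhdsWithin] with σ hσ
      exact Eventually.of_forall fun z => ENNReal.ofReal_le_ofReal (rescaledWeight_le hσ z)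
    · filter_upwards [ae_lastScale_zero_ne h] with z hz
      exact ENNReal.tendsto_ofReal (tendsto_rescaledWeight hz)
  have hle0 : ∫⁻ z : E n, ENNReal.ofReal (rescaledWeight n m 0 z) ≤ I := by
    refine le_of_tendsto hlim ?_
    filter_upwards [self_mem_nhdsWithin] with σ hσ
    exact lintegral_mono fun z => ENNReal.ofReal_le_ofReal (rescaledWeight_le hσ z)
  refine ⟨W⁻¹ * I, ENNReal.mul_ne_top hWi hIt,
    W⁻¹ * ∫⁻ z : E n, ENNReal.ofReal (rescaledWeight n m 0 z), ?_, ?_, ?_, ?_⟩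
  · exact ENNReal.mul_pos (ENNReal.inv_ne_zero.2 hWt) (rescaledWeight_zero_integral_pos n m).ne'
  · exact ENNReal.mul_ne_top hWi (ne_top_of_le_ne_top hIt hle0)
  · intro σ hσ z hz
    have hz' : 0 < ‖z‖ := norm_pos_iff.2 hz
    rw [avgKernel_eq_smul hz he, mul_comm, hav _ (by positivity)]
    gcongr
    exact lintegral_mono fun z => ENNReal.ofReal_le_ofReal (rescaledWeight_le (by positivity) z)
  · intro z hz
    have hz' : 0 < ‖z‖ := norm_pos_iff.2 hz
    have ht : Tendsto (fun σ : ℝ => σ / ‖z‖) (𝓝[>] 0) (𝓝[>] 0) := by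
      refine tendsto_nhdsWithin_iff.2 ⟨?_, ?_⟩
      · have : Tendsto (fun σ : ℝ => σ / ‖z‖) (𝓝 0) (𝓝 (0 / ‖z‖)) := by
          exact tendsto_id.div_const _
        rw [zero_div] at this
        exact this.mono_left nhdsWithin_le_nhds
      · filter_upwards [self_mem_nhdsWithin] with σ hσ
        exact div_pos hσ hz'
    have h1 := ENNReal.Tendsto.const_mul (hlim.comp ht) (Or.inr hWi)
    have h2 := ENNReal.Tendsto.const_mul (a := ENNReal.ofReal (‖z‖ ^ m)⁻¹) h1
      (Or.inr ENNReal.ofReal_ne_top)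
    rw [mul_comm]
    refine h2.congr' ?_
    filter_upwards [self_mem_nhdsWithin] with σ hσ
    have hσ : 0 < σ := hσ
    rw [avgKernel_eq_smul hz he, hav _ (by positivity)]
    rfl

/-! ### Convolution of Gaussian kernels -/

section Convolution

variable {F : Type*} [NormedAddCommGroup F] [InnerProductSpace ℝ F]

/-- Completing the square: the product of two Gaussians in the integration variable is a Gaussian
about the weighted mean times a factor in `p - q` alone. -/
theorem weighted_norm_sq_add (p q : F) {a b : ℝ} (hab : a + b ≠ 0) :
    a * ‖p‖ ^ 2 + b * ‖q‖ ^ 2 =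
      (a + b) * ‖(a + b)⁻¹ • (a • p + b • q)‖ ^ 2 + a * b / (a + b) * ‖p - q‖ ^ 2 := by
  rw [norm_smul, mul_pow, norm_add_sq_real, norm_sub_sq_real, norm_smul, norm_smul,
    real_inner_smul_left, real_inner_smul_right, mul_pow, mul_pow]
  simp only [Real.norm_eq_abs, sq_abs]
  field_simp
  ring

variable [FiniteDimensional ℝ F] [MeasurableSpace F] [BorelSpace F]

theorem lintegral_exp_neg_mul_norm_sub_sq {b : ℝ} (hb : 0 < b) (c : F) :
    ∫⁻ u : F, ENNReal.ofReal (Real.exp (-b * ‖u - c‖ ^ 2)) =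
      ENNReal.ofReal ((Real.pi / b) ^ ((Module.finrank ℝ F : ℝ) / 2)) := by
  have h := GaussianFourier.integral_rexp_neg_mul_sq_norm (V := F) hb
  have hi : Integrable fun z : F => Real.exp (-b * ‖z‖ ^ 2) := by
    refine Integrable.of_integral_ne_zero ?_
    rw [h]
    positivity
  rw [lintegral_sub_right_eq_self (fun u : F => ENNReal.ofReal (Real.exp (-b * ‖u‖ ^ 2))) c, ← h,
    ofReal_integral_eq_lintegral_ofReal hi (Eventually.of_forall fun z => (Real.exp_pos _).le)]

/-- The convolution of two Gaussian kernels is a Gaussian kernel. -/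
theorem lintegral_gaussK_mul_gaussK {m : ℕ} (hF : Module.finrank ℝ F = m) {δ ε : ℝ} (hδ : 0 < δ)
    (hε : 0 < ε) (a b : F) :
    ∫⁻ u : F, ENNReal.ofReal (gaussK m δ (a - u) * gaussK m ε (b - u)) =
      ENNReal.ofReal (Real.pi ^ ((m : ℝ) / 2)) *
        ENNReal.ofReal (gaussK m √(δ ^ 2 + ε ^ 2) (a - b)) := by
  set A := (δ ^ 2)⁻¹ with hA
  set B := (ε ^ 2)⁻¹ with hB
  have hA0 : 0 < A := by positivity
  have hB0 : 0 < B := by positivity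
  set c := (A + B)⁻¹ • (A • a + B • b) with hc
  have key : ∀ u : F, gaussK m δ (a - u) * gaussK m ε (b - u) =
      ((δ ^ m)⁻¹ * (ε ^ m)⁻¹ * Real.exp (-(‖a - b‖ ^ 2 / (δ ^ 2 + ε ^ 2)))) *
        Real.exp (-(A + B) * ‖u - c‖ ^ 2) := by
    intro u
    have h1 := weighted_norm_sq_add (a - u) (b - u) (a := A) (b := B) (by positivity)
    have h2 : (A + B)⁻¹ • (A • (a - u) + B • (b - u)) = c - u := by
      have : A • (a - u) + B • (b - u) = (A • a + B • b) - (A + B) • u := by module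
      rw [this, smul_sub, smul_smul, inv_mul_cancel₀ (by positivity), one_smul]
    have h3 : A * B / (A + B) = (δ ^ 2 + ε ^ 2)⁻¹ := by
      rw [hA, hB]; field_simp; ring
    rw [h2, h3, sub_sub_sub_cancel_right, norm_sub_rev c u] at h1
    unfold gaussK
    rw [mul_mul_mul_comm, ← Real.exp_add, mul_assoc ((δ ^ m)⁻¹ * (ε ^ m)⁻¹), ← Real.exp_add]
    congr 2
    rw [div_eq_inv_mul, div_eq_inv_mul, div_eq_inv_mul]
    linarith
  simp only [key]
  have hS : 0 < δ ^ 2 + ε ^ 2 := by positivity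
  have hAB : 0 < A + B := by positivity
  have hconst : (0 : ℝ) ≤ (δ ^ m)⁻¹ * (ε ^ m)⁻¹ * Real.exp (-(‖a - b‖ ^ 2 / (δ ^ 2 + ε ^ 2))) := by
    positivity
  simp only [ENNReal.ofReal_mul hconst]
  rw [lintegral_const_mul _ (by fun_prop), lintegral_exp_neg_mul_norm_sub_sq hAB, hF,
    ← ENNReal.ofReal_mul hconst, ← ENNReal.ofReal_mul (by positivity)]
  congr 1
  have h4 : ∀ x : ℝ, 0 < x → x ^ m = (x ^ 2) ^ ((m : ℝ) / 2) := by
    intro x hx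
    rw [← Real.rpow_natCast x 2, ← Real.rpow_mul hx.le, ← Real.rpow_natCast]
    congr 1
    push_cast
    ring
  have h5 : Real.pi / (A + B) = Real.pi * (δ ^ 2 * ε ^ 2) / (δ ^ 2 + ε ^ 2) := by
    rw [hA, hB]; field_simp; ring
  unfold gaussK
  rw [Real.sq_sqrt hS.le, h4 _ (Real.sqrt_pos.2 hS), Real.sq_sqrt hS.le, h5,
    Real.div_rpow (by positivity) hS.le, Real.mul_rpow Real.pi_pos.le (by positivity),
    Real.mul_rpow (by positivity) (by positivity), ← h4 _ hδ, ← h4 _ hε]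
  field_simp

end Convolution

/-! ### Smoothed projections and the `m`-energy -/

/-- The measure on pairs of a rotation and a transversal coordinate. -/
def bundleMeasure (n m : ℕ) : Measure (O n × LastSpace n m) := (haarO n).prod volume

/-- The density at scale `δ` of the projection of `μ` to the transversal coordinates. -/
def smoothed {n : ℕ} (m : ℕ) (δ : ℝ) (μ : Measure (E n)) (p : O n × LastSpace n m) : ℝ :=
  ∫ y, gaussK m δ (transv m p.1 y - p.2) ∂μ

section smoothed

variable {n m : ℕ} {δ ε : ℝ} {μ : Measure (E n)}

theorem continuous_transv_sub :
    Continuous fun q : (O n × LastSpace n m) × E n => transv m q.1.1 q.2 - q.1.2 := by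
  have h1 : Continuous fun q : (O n × LastSpace n m) × E n => (q.1.1, q.2) :=
    (continuous_fst.comp continuous_fst).prodMk continuous_snd
  exact (continuous_transv.comp h1).sub (continuous_snd.comp continuous_fst)

theorem measurable_transv_right (g : O n) : Measurable (transv m g) := by
  have h : Continuous (transv m g) :=
    (lastProj n m).continuous.comp ((star g : O n) : E n →L[ℝ] E n).continuous
  exact h.measurable

theorem measurable_gaussK_transv_right (g : O n) (u : LastSpace n m) :
    Measurable fun y => gaussK m δ (transv m g y - u) :=
  (continuous_gaussK δ).measurable.comp ((measurable_transv_right g).sub_const u)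

theorem measurable_gaussK_transv (y : E n) :
    Measurable fun p : O n × LastSpace n m => gaussK m δ (transv m p.1 y - p.2) :=
  (continuous_gaussK δ).measurable.comp
    (((measurable_transv_left y).comp measurable_fst).sub measurable_snd)

theorem integrable_gaussK_transv [IsFiniteMeasure μ] (hδ : 0 < δ) (p : O n × LastSpace n m) :
    Integrable (fun y => gaussK m δ (transv m p.1 y - p.2)) μ := by
  refine Integrable.of_bound (C := (δ ^ m)⁻¹) ?_ (Eventually.of_forall fun y => ?_)
  · exact (measurable_gaussK_transv_right p.1 p.2).aestronglyMeasurable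
  · rw [Real.norm_of_nonneg (gaussK_nonneg hδ _)]
    exact gaussK_le hδ _

theorem smoothed_nonneg (hδ : 0 < δ) (p : O n × LastSpace n m) : 0 ≤ smoothed m δ μ p :=
  integral_nonneg fun _ => gaussK_nonneg hδ _

theorem ofReal_smoothed [IsFiniteMeasure μ] (hδ : 0 < δ) (p : O n × LastSpace n m) :
    ENNReal.ofReal (smoothed m δ μ p) =
      ∫⁻ y, ENNReal.ofReal (gaussK m δ (transv m p.1 y - p.2)) ∂μ :=
  ofReal_integral_eq_lintegral_ofReal (integrable_gaussK_transv hδ p)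
    (Eventually.of_forall fun _ => gaussK_nonneg hδ _)

theorem measurable_smoothed [IsFiniteMeasure μ] : Measurable (smoothed m δ μ) := by
  have h : Measurable fun q : (O n × LastSpace n m) × E n =>
      gaussK m δ (transv m q.1.1 q.2 - q.1.2) :=
    ((continuous_gaussK δ).comp continuous_transv_sub).measurable
  exact (h.stronglyMeasurable.integral_prod_right').measurable

/-- The `L²` pairing of two smoothed projections is a mutual energy. -/
theorem lintegral_smoothed_mul [IsFiniteMeasure μ] (h : m ≤ n) (hδ : 0 < δ) (hε : 0 < ε) :
    ∫⁻ p, ENNReal.ofReal (smoothed m δ μ p * smoothed m ε μ p) ∂bundleMeasure n m =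
      ENNReal.ofReal (Real.pi ^ ((m : ℝ) / 2)) *
        ∫⁻ y, ∫⁻ z, avgKernel n m √(δ ^ 2 + ε ^ 2) (y - z) ∂μ ∂μ := by
  have hJ : Measurable fun q : (O n × LastSpace n m) × (E n × E n) =>
      ENNReal.ofReal (gaussK m δ (transv m q.1.1 q.2.1 - q.1.2) *
        gaussK m ε (transv m q.1.1 q.2.2 - q.1.2)) := by
    have ht : ∀ f : E n × E n → E n, Continuous f → Continuous fun
        q : (O n × LastSpace n m) × (E n × E n) => transv m q.1.1 (f q.2) - q.1.2 := by
      intro f hf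
      have h1 : Continuous fun q : (O n × LastSpace n m) × (E n × E n) => (q.1.1, f q.2) :=
        (continuous_fst.comp continuous_fst).prodMk (hf.comp continuous_snd)
      exact (continuous_transv.comp h1).sub (continuous_snd.comp continuous_fst)
    exact ((((continuous_gaussK δ).comp (ht _ continuous_fst)).mul
      ((continuous_gaussK ε).comp (ht _ continuous_snd))).measurable).ennreal_ofReal
  have h1 : ∀ p : O n × LastSpace n m,
      ENNReal.ofReal (smoothed m δ μ p * smoothed m ε μ p) =
      ∫⁻ q, ENNReal.ofReal (gaussK m δ (transv m p.1 q.1 - p.2) *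
        gaussK m ε (transv m p.1 q.2 - p.2)) ∂(μ.prod μ) := by
    intro p
    rw [ENNReal.ofReal_mul (smoothed_nonneg hδ p), ofReal_smoothed hδ, ofReal_smoothed hε,
      ← lintegral_prod_mul]
    · exact lintegral_congr fun q => (ENNReal.ofReal_mul (gaussK_nonneg hδ _)).symm
    · exact (measurable_gaussK_transv_right p.1 p.2).ennreal_ofReal.aemeasurable
    · exact (measurable_gaussK_transv_right p.1 p.2).ennreal_ofReal.aemeasurable
  simp only [h1]
  unfold bundleMeasure
  rw [lintegral_lintegral_swap hJ.aemeasurable]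
  have h2 : ∀ q : E n × E n, ∫⁻ p : O n × LastSpace n m,
      ENNReal.ofReal (gaussK m δ (transv m p.1 q.1 - p.2) *
        gaussK m ε (transv m p.1 q.2 - p.2)) ∂((haarO n).prod volume) =
      ENNReal.ofReal (Real.pi ^ ((m : ℝ) / 2)) * avgKernel n m √(δ ^ 2 + ε ^ 2) (q.1 - q.2) := by
    intro q
    have hq : Measurable fun p : O n × LastSpace n m =>
        ENNReal.ofReal (gaussK m δ (transv m p.1 q.1 - p.2) *
          gaussK m ε (transv m p.1 q.2 - p.2)) :=
      ((measurable_gaussK_transv q.1).mul (measurable_gaussK_transv q.2)).ennreal_ofReal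
    rw [lintegral_prod _ hq.aemeasurable]
    -- Integrating the fibre coordinate first merges the kernels into one of width `√(δ ^ 2 + ε ^
    -- 2)`; the remaining rotation average is `avgKernel`.
    simp only [lintegral_gaussK_mul_gaussK (finrank_lastSpace h) hδ hε, ← transv_sub]
    rw [lintegral_const_mul]
    · rfl
    · exact ((continuous_gaussK _).measurable.comp (measurable_transv_left _)).ennreal_ofReal
  have hm : Measurable fun q : E n × E n => avgKernel n m √(δ ^ 2 + ε ^ 2) (q.1 - q.2) :=
    (measurable_avgKernel _).comp (measurable_fst.sub measurable_snd)
  simp only [h2]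
  rw [lintegral_const_mul _ hm, lintegral_prod _ hm.aemeasurable]

/-- The `m`-energy of a measure; the diagonal does not contribute. -/
def rieszEnergy (m : ℕ) (μ : Measure (E n)) : ℝ≥0∞ :=
  ∫⁻ y, ∫⁻ z, ENNReal.ofReal (‖y - z‖ ^ m)⁻¹ ∂μ ∂μ

theorem measurable_rieszKernel :
    Measurable fun q : E n × E n => ENNReal.ofReal (‖q.1 - q.2‖ ^ m)⁻¹ := by
  fun_prop

theorem ae_ne_prod [IsFiniteMeasure μ] [NullSingletonClass μ] :
    ∀ᵐ q : E n × E n ∂(μ.prod μ), q.1 - q.2 ≠ 0 := by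
  have hms : MeasurableSet {q : E n × E n | q.1 - q.2 ≠ 0} :=
    (measurableSet_singleton (0 : E n)).compl.preimage (measurable_fst.sub measurable_snd)
  rw [Measure.ae_prod_iff_ae_ae hms]
  refine Eventually.of_forall fun y => ?_
  filter_upwards [compl_mem_ae_iff.2 (measure_singleton (μ := μ) y)] with z hz h
  exact hz (sub_eq_zero.1 h).symm

theorem exists_lintegral_smoothed_sq_le (h : m < n) : ∃ C : ℝ≥0∞, C ≠ ∞ ∧
    ∀ (μ : Measure (E n)) [IsFiniteMeasure μ] [NullSingletonClass μ] (δ : ℝ), 0 < δ →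
      ∫⁻ p, ENNReal.ofReal (smoothed m δ μ p ^ 2) ∂bundleMeasure n m ≤ C * rieszEnergy m μ := by
  obtain ⟨C, hC, c, -, -, hle, -⟩ := exists_avgKernel_asymptotics h
  refine ⟨ENNReal.ofReal (Real.pi ^ ((m : ℝ) / 2)) * C,
    ENNReal.mul_ne_top ENNReal.ofReal_ne_top hC, fun μ _ _ δ hδ => ?_⟩
  simp only [sq (smoothed m δ μ _)]
  have hm : ∀ σ, Measurable fun q : E n × E n => avgKernel n m σ (q.1 - q.2) := fun σ =>
    (measurable_avgKernel _).comp (measurable_fst.sub measurable_snd)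
  rw [lintegral_smoothed_mul h.le hδ hδ, mul_assoc, rieszEnergy,
    ← lintegral_prod (fun q : E n × E n => avgKernel n m _ (q.1 - q.2)) (hm _).aemeasurable,
    ← lintegral_prod (fun q : E n × E n => ENNReal.ofReal (‖q.1 - q.2‖ ^ m)⁻¹)
      measurable_rieszKernel.aemeasurable, ← lintegral_const_mul _ measurable_rieszKernel]
  gcongr 1
  refine lintegral_mono_ae ?_
  filter_upwards [ae_ne_prod] with q hq
  exact hle _ (by positivity) _ hq

/-- Smoothed projections of a measure of finite `m`-energy are Cauchy in `L²` as the scale tends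
to zero. -/
theorem exists_lintegral_smoothed_sub_sq_le [IsFiniteMeasure μ] [NullSingletonClass μ] (h : m < n)
    (hE : rieszEnergy m μ ≠ ∞) {η : ℝ≥0∞} (hη : 0 < η) :
    ∃ δ₀ : ℝ, 0 < δ₀ ∧ ∀ δ ε : ℝ, 0 < δ → δ < δ₀ → 0 < ε → ε < δ₀ →
      ∫⁻ p, ENNReal.ofReal ((smoothed m δ μ p - smoothed m ε μ p) ^ 2) ∂bundleMeasure n m ≤ η := by
  obtain ⟨C, hC, c, hc0, hct, hle, hlim⟩ := exists_avgKernel_asymptotics h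
  set κ := ENNReal.ofReal (Real.pi ^ ((m : ℝ) / 2)) with hκ
  have hm : ∀ σ, Measurable fun q : E n × E n => avgKernel n m σ (q.1 - q.2) := fun σ =>
    (measurable_avgKernel _).comp (measurable_fst.sub measurable_snd)
  have hE' : ∫⁻ q : E n × E n, ENNReal.ofReal (‖q.1 - q.2‖ ^ m)⁻¹ ∂(μ.prod μ) =
      rieszEnergy m μ := lintegral_prod _ measurable_rieszKernel.aemeasurable
  -- A pairing depends on its two scales only through `√(δ ^ 2 + ε ^ 2)`, so all three terms of the
  -- expanded square share one limit.
  set P : ℝ → ℝ≥0∞ := fun σ => κ * ∫⁻ q : E n × E n, avgKernel n m σ (q.1 - q.2) ∂(μ.prod μ)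
    with hP
  have hPlim : Tendsto P (𝓝[>] 0) (𝓝 (κ * (c * rieszEnergy m μ))) := by
    refine ENNReal.Tendsto.const_mul ?_ (Or.inr ENNReal.ofReal_ne_top)
    rw [← hE', ← lintegral_const_mul _ measurable_rieszKernel]
    refine tendsto_lintegral_filter_of_dominated_convergence
      (fun q => C * ENNReal.ofReal (‖q.1 - q.2‖ ^ m)⁻¹) (Eventually.of_forall hm) ?_ ?_ ?_
    · filter_upwards [self_mem_nhdsWithin] with σ hσ
      filter_upwards [ae_ne_prod] with q hq
      exact hle _ hσ _ hq
    · rw [lintegral_const_mul _ measurable_rieszKernel, hE']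
      exact ENNReal.mul_ne_top hC hE
    · filter_upwards [ae_ne_prod] with q hq
      exact hlim _ hq
  have hLt : κ * (c * rieszEnergy m μ) ≠ ∞ :=
    ENNReal.mul_ne_top ENNReal.ofReal_ne_top (ENNReal.mul_ne_top hct hE)
  set Λ := κ * (c * rieszEnergy m μ) with hΛ
  -- Two squares bounded above and twice the cross term bounded below accumulate four errors of `η /
  -- 4`.
  have hη4 : η / 4 ≠ 0 := (ENNReal.div_pos hη.ne' (by simp)).ne'
  have hev : ∀ᶠ σ in 𝓝[>] (0 : ℝ), P σ ∈ Icc (Λ - η / 4) (Λ + η / 4) :=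
    hPlim (ENNReal.Icc_mem_nhds hLt hη4)
  obtain ⟨r, hr, hrP⟩ := mem_nhdsGT_iff_exists_Ioo_subset.1 hev
  have hr : 0 < r := hr
  refine ⟨r / 2, by positivity, fun δ ε hδ hδr hε hεr => ?_⟩
  have hbd : ∀ a b : ℝ, 0 < a → a < r / 2 → 0 < b → b < r / 2 →
      ∫⁻ p, ENNReal.ofReal (smoothed m a μ p * smoothed m b μ p) ∂bundleMeasure n m ∈
        Icc (Λ - η / 4) (Λ + η / 4) := by
    intro a b ha har hb hbr
    rw [lintegral_smoothed_mul h.le ha hb,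
      ← lintegral_prod (fun q : E n × E n => avgKernel n m _ (q.1 - q.2)) (hm _).aemeasurable]
    refine hrP ⟨by positivity, ?_⟩
    rw [Real.sqrt_lt' hr]
    nlinarith
  have hs : ∀ a, Measurable (smoothed m a μ) := fun a => measurable_smoothed
  have hsum : ∫⁻ p, ENNReal.ofReal ((smoothed m δ μ p - smoothed m ε μ p) ^ 2) ∂bundleMeasure n m
      + 2 * ∫⁻ p, ENNReal.ofReal (smoothed m δ μ p * smoothed m ε μ p) ∂bundleMeasure n m =
      ∫⁻ p, ENNReal.ofReal (smoothed m δ μ p * smoothed m δ μ p) ∂bundleMeasure n m +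
      ∫⁻ p, ENNReal.ofReal (smoothed m ε μ p * smoothed m ε μ p) ∂bundleMeasure n m := by
    have hmul : ∀ a b, Measurable fun p : O n × LastSpace n m =>
        ENNReal.ofReal (smoothed m a μ p * smoothed m b μ p) :=
      fun a b => ((hs a).mul (hs b)).ennreal_ofReal
    rw [← lintegral_const_mul _ (hmul δ ε), ← lintegral_add_right _ ((hmul δ ε).const_mul 2),
      ← lintegral_add_left (hmul δ δ)]
    refine lintegral_congr fun p => ?_
    have h1 := smoothed_nonneg (μ := μ) hδ p
    have h2 := smoothed_nonneg (μ := μ) hε p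
    rw [show (2 : ℝ≥0∞) = ENNReal.ofReal 2 by simp, ← ENNReal.ofReal_mul zero_le_two,
      ← ENNReal.ofReal_add (by positivity) (by positivity),
      ← ENNReal.ofReal_add (by positivity) (by positivity)]
    congr 1
    ring
  have h1 := (hbd δ δ hδ hδr hδ hδr).2
  have h2 := (hbd ε ε hε hεr hε hεr).2
  have h3 := hbd δ ε hδ hδr hε hεr
  have h4 : Λ ≤ ∫⁻ p, ENNReal.ofReal (smoothed m δ μ p * smoothed m ε μ p) ∂bundleMeasure n m +
      η / 4 := tsub_le_iff_right.1 h3.1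
  by_cases hηt : η = ∞
  · simp [hηt]
  have h3t : ∫⁻ p, ENNReal.ofReal (smoothed m δ μ p * smoothed m ε μ p) ∂bundleMeasure n m ≠ ∞ :=
    ne_top_of_le_ne_top (by simp [hLt, hηt, ENNReal.div_eq_top]) h3.2
  set X := ∫⁻ p, ENNReal.ofReal ((smoothed m δ μ p - smoothed m ε μ p) ^ 2) ∂bundleMeasure n m
  set Y := ∫⁻ p, ENNReal.ofReal (smoothed m δ μ p * smoothed m ε μ p) ∂bundleMeasure n m
  have h5 : X + 2 * Y ≤ η + 2 * Y := by
    rw [hsum]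
    calc _ ≤ (Λ + η / 4) + (Λ + η / 4) := add_le_add h1 h2
      _ ≤ ((Y + η / 4) + η / 4) + ((Y + η / 4) + η / 4) := by gcongr
      _ = 4 * (η / 4) + 2 * Y := by ring
      _ = η + 2 * Y := by rw [ENNReal.mul_div_cancel (by simp) (by simp)]
  exact (ENNReal.add_le_add_iff_right (ENNReal.mul_ne_top (by simp) h3t)).1 h5

end smoothed

/-! ### Potentials and a discrete Frostman lemma -/

/-- A measure with growth exponent `τ > m` has bounded `m`-potentials. -/
theorem exists_lintegral_inv_pow_le {m : ℕ} {τ : ℝ} (hτ : (m : ℝ) < τ) :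
    ∃ K : ℝ, 0 < K ∧ ∀ {α : Type} [MeasurableSpace α] (ν : Measure α) (d : α → ℝ) (C R : ℝ),
      0 ≤ C → 0 < R → Measurable d → (∀ a, 0 ≤ d a) → (∀ᵐ a ∂ν, d a ≤ R) →
      (∀ r, 0 < r → r ≤ R → ν {a | d a ≤ r} ≤ ENNReal.ofReal (C * r ^ τ)) →
      ∫⁻ a, ENNReal.ofReal (d a ^ m)⁻¹ ∂ν ≤ ENNReal.ofReal (K * C * R ^ (τ - m)) := by
  -- The shell `R / 2^(l+1) < d ≤ R / 2^l` contributes at most `2^m * C * R^(τ-m) * q^l`; `K` is the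
  -- sum of the geometric series.
  set q : ℝ := (1 / 2 : ℝ) ^ (τ - m) with hq
  have hq0 : 0 < q := by positivity
  have hq1 : q < 1 := Real.rpow_lt_one (by norm_num) (by norm_num) (by linarith)
  refine ⟨2 ^ m * (1 - q)⁻¹, mul_pos (by positivity) (inv_pos.2 (by linarith)), ?_⟩
  intro α _ ν d C R hC hR hd hd0 hdR hν
  set ρ : ℕ → ℝ := fun l => R * (1 / 2) ^ l with hρ
  have hρ0 : ∀ l, 0 < ρ l := fun l => by positivity
  have hρR : ∀ l, ρ l ≤ R := fun l =>
    mul_le_of_le_one_right hR.le (pow_le_one₀ (by norm_num) (by norm_num))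
  have hpt : ∀ a, d a ≤ R → ENNReal.ofReal (d a ^ m)⁻¹ ≤
      ∑' l, ENNReal.ofReal (ρ (l + 1) ^ m)⁻¹ * {a | d a ≤ ρ l}.indicator 1 a := by
    intro a ha
    rcases (hd0 a).eq_or_lt with h0 | h0
    · rcases Nat.eq_zero_or_pos m with rfl | hm
      · refine le_trans ?_ (ENNReal.le_tsum 0)
        have : a ∈ {a | d a ≤ ρ 0} := by
          rw [mem_ofPred_eq, ← h0]; exact (hρ0 0).le
        rw [indicator_of_mem this]
        simp
      · rw [← h0, zero_pow hm.ne']; simp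
    · obtain ⟨l, hl1, hl2⟩ := exists_nat_pow_near_of_lt_one (x := d a / R) (y := 1 / 2)
        (by positivity) ((div_le_one hR).2 ha) (by norm_num) (by norm_num)
      rw [lt_div_iff₀ hR, mul_comm] at hl1
      rw [div_le_iff₀ hR, mul_comm] at hl2
      refine le_trans ?_ (ENNReal.le_tsum l)
      have : a ∈ {a | d a ≤ ρ l} := hl2
      rw [indicator_of_mem this, Pi.one_apply, mul_one]
      refine ENNReal.ofReal_le_ofReal (inv_anti₀ (pow_pos (hρ0 _) _) ?_)
      exact pow_le_pow_left₀ (hρ0 _).le hl1.le _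
  have hms : ∀ l, MeasurableSet {a | d a ≤ ρ l} := fun l => measurableSet_le hd measurable_const
  calc ∫⁻ a, ENNReal.ofReal (d a ^ m)⁻¹ ∂ν
      ≤ ∫⁻ a, ∑' l, ENNReal.ofReal (ρ (l + 1) ^ m)⁻¹ * {a | d a ≤ ρ l}.indicator 1 a ∂ν :=
        lintegral_mono_ae (hdR.mono hpt)
    _ = ∑' l, ENNReal.ofReal (ρ (l + 1) ^ m)⁻¹ * ν {a | d a ≤ ρ l} := by
        rw [lintegral_tsum fun l =>
          ((measurable_one.indicator (hms l)).const_mul _).aemeasurable]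
        refine tsum_congr fun l => ?_
        rw [lintegral_const_mul _ (measurable_one.indicator (hms l)),
          lintegral_indicator_one (hms l)]
    _ ≤ ∑' l, ENNReal.ofReal (2 ^ m * C * R ^ (τ - m) * q ^ l) := by
        refine ENNReal.tsum_le_tsum fun l => ?_
        refine (mul_le_mul_right (hν _ (hρ0 l) (hρR l)) _).trans ?_
        rw [← ENNReal.ofReal_mul (by have := hρ0 (l + 1); positivity)]
        refine ENNReal.ofReal_le_ofReal (le_of_eq ?_)
        have h1 : ρ (l + 1) = ρ l / 2 := by simp only [hρ]; ring
        have h2 : (ρ l) ^ τ = ρ l ^ m * ρ l ^ (τ - m) := by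
          rw [← Real.rpow_natCast, ← Real.rpow_add (hρ0 l)]; congr 1; ring
        have h3 : ρ l ^ (τ - m) = R ^ (τ - m) * q ^ l := by
          rw [hρ, Real.mul_rpow hR.le (by positivity), hq, ← Real.rpow_natCast,
            ← Real.rpow_natCast, ← Real.rpow_mul (by norm_num), ← Real.rpow_mul (by norm_num),
            mul_comm (l : ℝ)]
        have h4 : ρ l ^ m ≠ 0 := (pow_pos (hρ0 l) m).ne'
        rw [h1, h2, h3, div_pow]
        field_simp
    _ = ENNReal.ofReal (2 ^ m * (1 - q)⁻¹ * C * R ^ (τ - m)) := by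
        rw [← ENNReal.ofReal_tsum_of_nonneg (fun l => by positivity)
          ((summable_geometric_of_lt_one hq0.le hq1).mul_left _), tsum_mul_left,
          tsum_geometric_of_lt_one hq0.le hq1]
        congr 1
        ring

/-- A maximal weight below given capacities saturates a constraint through every point. -/
theorem exists_saturated_weight {ι κ : Type*} [Fintype ι] [Finite κ] [DecidableEq ι]
    (S : κ → Finset ι) (c : κ → ℝ) (hc : ∀ k, 0 ≤ c k) (hcov : ∀ x, ∃ k, x ∈ S k) :
    ∃ w : ι → ℝ, (∀ x, 0 ≤ w x) ∧ (∀ k, ∑ x ∈ S k, w x ≤ c k) ∧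
      ∀ x, ∃ k, x ∈ S k ∧ ∑ y ∈ S k, w y = c k := by
  choose k hk using hcov
  set A : Set (ι → ℝ) := {w | (∀ x, 0 ≤ w x) ∧ ∀ k, ∑ x ∈ S k, w x ≤ c k} with hA
  have hAc : IsCompact A := by
    refine Metric.isCompact_of_isClosed_isBounded ?_ ?_
    · have h1 : IsClosed {w : ι → ℝ | ∀ x, 0 ≤ w x} := by
        simp only [ofPred_forall]
        exact isClosed_iInter fun x => isClosed_le continuous_const (continuous_apply x)
      have h2 : IsClosed {w : ι → ℝ | ∀ k, ∑ x ∈ S k, w x ≤ c k} := by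
        simp only [ofPred_forall]
        exact isClosed_iInter fun k => isClosed_le
          (continuous_finsetSum _ fun x _ => continuous_apply x) continuous_const
      exact h1.inter h2
    · refine (Metric.isBounded_Icc (0 : ι → ℝ) (fun x => c (k x))).subset ?_
      rintro w ⟨h0, h1⟩
      refine ⟨h0, fun x => le_trans ?_ (h1 (k x))⟩
      exact Finset.single_le_sum (f := w) (fun y _ => h0 y) (hk x)
  have hA0 : A.Nonempty := ⟨0, fun _ => le_rfl, fun k => by simpa using hc k⟩
  obtain ⟨w, hwA, hmax⟩ := hAc.exists_isMaxOn hA0 (f := fun w => ∑ x, w x)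
    (continuous_finsetSum _ fun x _ => continuous_apply x).continuousOn
  refine ⟨w, hwA.1, hwA.2, fun x => ?_⟩
  by_contra! hx
  have hlt : ∀ j, x ∈ S j → 0 < c j - ∑ y ∈ S j, w y := fun j hj =>
    sub_pos.2 (lt_of_le_of_ne (hwA.2 j) (hx j hj))
  have : Nonempty κ := ⟨k x⟩
  obtain ⟨j₀, hj₀⟩ := Finite.exists_min fun j => if x ∈ S j then c j - ∑ y ∈ S j, w y else 1
  set ε := if x ∈ S j₀ then c j₀ - ∑ y ∈ S j₀, w y else 1 with hε
  have hε0 : 0 < ε := by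
    rw [hε]; split_ifs with h
    · exact hlt _ h
    · exact one_pos
  have hsum : ∀ s : Finset ι, ∑ y ∈ s, (w + Pi.single x ε : ι → ℝ) y =
      ∑ y ∈ s, w y + if x ∈ s then ε else 0 := by
    intro s
    simp only [Pi.add_apply, Finset.sum_add_distrib]
    congr 1
    simp [Pi.single_apply]
  have hw' : w + Pi.single x ε ∈ A := by
    refine ⟨fun y => add_nonneg (hwA.1 y) ?_, fun j => ?_⟩
    · by_cases h : y = x
      · subst h; simpa using hε0.le
      · simp [h]
    · rw [hsum]
      have := hj₀ j
      split_ifs with h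
      · rw [if_pos h] at this; linarith
      · simpa using hwA.2 j
  have := hmax hw'
  simp only [mem_ofPred_eq] at this
  rw [hsum] at this
  simp only [Finset.mem_univ, if_true] at this
  linarith

/-- The Hausdorff content. -/
def hContent (n : ℕ) (τ : ℝ) : OuterMeasure (E n) :=
  OuterMeasure.mkMetric'.pre (fun s => Metric.ediam s ^ τ) ∞

theorem hContent_closedBall_le {n : ℕ} {τ : ℝ} (hτ : 0 ≤ τ) (x : E n) {r : ℝ} (hr : 0 ≤ r) :
    hContent n τ (Metric.closedBall x r) ≤ ENNReal.ofReal ((2 * r) ^ τ) := by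
  refine (OuterMeasure.mkMetric'.pre_le le_top).trans ?_
  rw [← ENNReal.ofReal_rpow_of_nonneg (by positivity) hτ]
  refine ENNReal.rpow_le_rpow ?_ hτ
  refine Metric.ediam_le fun a ha b hb => ?_
  rw [edist_dist]
  refine ENNReal.ofReal_le_ofReal ((dist_triangle_right a b x).trans ?_)
  linarith [Metric.mem_closedBall.1 ha, Metric.mem_closedBall.1 hb]

/-- A cover with `∑ diam ^ τ < r ^ τ` has all diameters at most `r`, so nullity for unrestricted
covers already gives nullity for fine ones. -/
theorem hausdorffMeasure_eq_zero_of_hContent {n : ℕ} {τ : ℝ} (hτ : 0 < τ) {S : Set (E n)}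
    (h : hContent n τ S = 0) : (Measure.hausdorffMeasure τ : Measure (E n)) S = 0 := by
  rw [Measure.hausdorffMeasure_apply, ← nonpos_iff_eq_zero]
  refine iSup₂_le fun r hr => ?_
  refine le_of_forall_pos_le_add fun ε hε => ?_
  rw [zero_add]
  have hlt : hContent n τ S < min ε (r ^ τ) := by
    rw [h]
    exact lt_min hε (ENNReal.rpow_pos_of_nonneg hr hτ.le)
  unfold hContent OuterMeasure.mkMetric'.pre at hlt
  rw [OuterMeasure.boundedBy_apply] at hlt
  simp only [iInf_lt_iff] at hlt
  obtain ⟨t, hSt, ht⟩ := hlt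
  have hterm : ∀ i, (⨆ _ : (t i).Nonempty, Metric.ediam (t i) ^ τ) ≤
      ⨆ _ : (t i).Nonempty, extend (fun s (_ : Metric.ediam s ≤ ∞) => Metric.ediam s ^ τ) (t i) := by
    intro i
    refine iSup_mono fun _ => ?_
    exact le_iInf fun _ => le_rfl
  refine iInf₂_le_of_le t hSt (iInf_le_of_le (fun i => ?_) ?_)
  · rcases (t i).eq_empty_or_nonempty with he | he
    · simp [he]
    · have h1 : Metric.ediam (t i) ^ τ ≤ r ^ τ := by
        refine le_trans ?_ (ht.le.trans (min_le_right _ _))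
        refine le_trans ?_ (ENNReal.le_tsum i)
        exact le_trans (le_iSup (fun _ : (t i).Nonempty => Metric.ediam (t i) ^ τ) he) (hterm i)
      exact (ENNReal.rpow_le_rpow_iff hτ).1 h1
  · exact (ENNReal.tsum_le_tsum hterm).trans (ht.le.trans (min_le_left _ _))

/-- A discrete Frostman lemma: a bounded set carries a finitely supported measure whose mass is
comparable to the Hausdorff content and which has growth exponent `τ` at scales above `ρ`. -/
theorem exists_discrete_frostman {n : ℕ} {τ : ℝ} (hτ : 0 < τ) {S : Set (E n)} {R : ℝ}
    (hS : S ⊆ Metric.closedBall 0 R) {ρ : ℝ} (hρ : 0 < ρ) :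
    ∃ ν : Measure (E n), IsFiniteMeasure ν ∧ (∀ᵐ y ∂ν, y ∈ S) ∧
      (∀ᵐ y ∂ν, ∀ r, ρ ≤ r → ν (Metric.closedBall y r) ≤ ENNReal.ofReal ((2 * r) ^ τ)) ∧
      hContent n τ S ≤ ENNReal.ofReal (10 ^ τ) * ν univ := by
  classical
  have htb : TotallyBounded S :=
    (isCompact_closedBall (0 : E n) R).totallyBounded.subset hS
  obtain ⟨t₀, ht₀S, ht₀f, ht₀c⟩ := Metric.finite_approx_of_totallyBounded htb ρ hρ
  obtain ⟨t, rfl⟩ := ht₀f.exists_finset_coe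
  have hdist : ∀ x y : t, dist (x : E n) y ≤ 2 * R := by
    intro x y
    have h1 := mem_closedBall_zero_iff.1 (hS (ht₀S x.2))
    have h2 := mem_closedBall_zero_iff.1 (hS (ht₀S y.2))
    rw [dist_eq_norm]
    linarith [norm_sub_le (x : E n) (y : E n)]
  -- The largest radius `2 ^ L * ρ` exceeds the diameter of the net, so finitely many dyadic radii
  -- control all `r ≥ ρ`.
  obtain ⟨L, hL⟩ := pow_unbounded_of_one_lt (2 * R / ρ) (one_lt_two (α := ℝ))
  have hL' : 2 * R ≤ 2 ^ L * ρ := ((div_lt_iff₀ hρ).1 hL).le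
  set rad : t × Fin (L + 1) → ℝ := fun k => 2 ^ (k.2 : ℕ) * ρ with hrad
  have hrad0 : ∀ k, 0 < rad k := fun k => by positivity
  have hradρ : ∀ k, ρ ≤ rad k := fun k =>
    le_mul_of_one_le_left hρ.le (one_le_pow₀ one_le_two)
  set B : t × Fin (L + 1) → Finset t := fun k =>
    Finset.univ.filter fun y : t => dist (y : E n) k.1 ≤ rad k with hB
  have hBmem : ∀ k (y : t), y ∈ B k ↔ dist (y : E n) k.1 ≤ rad k := by
    intro k y; simp [hB]
  obtain ⟨w, hw0, hwc, hsat⟩ := exists_saturated_weight B (fun k => rad k ^ τ)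
    (fun k => (Real.rpow_pos_of_pos (hrad0 k) τ).le)
    (fun x => ⟨(x, 0), by rw [hBmem]; simpa using (hrad0 (x, 0)).le⟩)
  have hgrow : ∀ (y : t) (r : ℝ), ρ ≤ r →
      ∑ z ∈ Finset.univ.filter (fun z : t => dist (z : E n) y ≤ r), w z ≤ (2 * r) ^ τ := by
    intro y r hr
    have hr0 : 0 < r := hρ.trans_le hr
    have key : ∀ k : t × Fin (L + 1), k.1 = y → rad k ≤ 2 * r →
        (∀ z : t, dist (z : E n) y ≤ r → dist (z : E n) y ≤ rad k) →
        ∑ z ∈ Finset.univ.filter (fun z : t => dist (z : E n) y ≤ r), w z ≤ (2 * r) ^ τ := by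
      rintro k rfl h1 h2
      calc _ ≤ ∑ z ∈ B k, w z := by
            refine Finset.sum_le_sum_of_subset_of_nonneg (fun z hz => ?_) fun z _ _ => hw0 z
            rw [hBmem]
            exact h2 z (by simpa using hz)
        _ ≤ rad k ^ τ := hwc k
        _ ≤ (2 * r) ^ τ := Real.rpow_le_rpow (hrad0 k).le h1 hτ.le
    -- Rounding `r` up to a dyadic multiple of `ρ` costs the factor `2` in `(2 * r) ^ τ`.
    obtain ⟨l, hl1, hl2⟩ := exists_nat_pow_near ((one_le_div hρ).2 hr) (one_lt_two (α := ℝ))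
    rw [le_div_iff₀ hρ] at hl1
    rw [div_lt_iff₀ hρ] at hl2
    by_cases hlL : l + 1 ≤ L
    · refine key (y, ⟨l + 1, by omega⟩) rfl ?_ fun z hz => hz.trans hl2.le
      simp only [hrad, pow_succ]
      linarith
    · refine key (y, ⟨L, by omega⟩) rfl ?_ fun z _ => (hdist z y).trans hL'
      have : (2 : ℝ) ^ L ≤ 2 ^ l := pow_le_pow_right₀ one_le_two (by omega)
      simp only [hrad]
      nlinarith
  set ν : Measure (E n) := ∑ x : t, ENNReal.ofReal (w x) • Measure.dirac (x : E n) with hν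
  have hνapp : ∀ A : Set (E n), MeasurableSet A →
      ν A = ENNReal.ofReal (∑ x ∈ Finset.univ.filter (fun x : t => (x : E n) ∈ A), w x) := by
    intro A hA
    rw [ENNReal.ofReal_sum_of_nonneg fun x _ => hw0 x, Finset.sum_filter, hν,
      Measure.finsetSum_apply]
    refine Finset.sum_congr rfl fun x _ => ?_
    rw [Measure.smul_apply, Measure.dirac_apply' _ hA, indicator_apply]
    split_ifs <;> simp
  have hνuniv : ν univ = ENNReal.ofReal (∑ x, w x) := by
    rw [hνapp _ MeasurableSet.univ]; simp
  have hae : ∀ᵐ y ∂ν, y ∈ (t : Set (E n)) := by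
    rw [ae_iff]
    have : {y | y ∉ (t : Set (E n))} = (t : Set (E n))ᶜ := rfl
    rw [this, hνapp _ t.finite_toSet.measurableSet.compl]
    simp
  refine ⟨ν, ⟨by rw [hνuniv]; exact ENNReal.ofReal_lt_top⟩, hae.mono fun y hy => ht₀S hy, ?_, ?_⟩
  · filter_upwards [hae] with y hy r hr
    rw [hνapp _ Metric.isClosed_closedBall.measurableSet]
    exact ENNReal.ofReal_le_ofReal (hgrow ⟨y, hy⟩ r hr)
  · obtain ⟨u, hut, hdisj, hcov⟩ :=
      Vitali.exists_disjoint_subfamily_covering_enlargement_closedBall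
        {k : t × Fin (L + 1) | ∑ y ∈ B k, w y = rad k ^ τ} (fun k => (k.1 : E n)) rad
        (2 ^ L * ρ) (fun k _ => by
          have : (2 : ℝ) ^ (k.2 : ℕ) ≤ 2 ^ L := pow_le_pow_right₀ one_le_two (by omega)
          simp only [hrad]
          nlinarith) 4 (by norm_num)
    -- Points of `S` are within `ρ ≤ rad` of a net point lying in a saturated ball, hence in a
    -- fourfold Vitali enlargement. Five radii give diameter at most ten radii, whence `10 ^ τ`.
    have hSsub : S ⊆ ⋃ k ∈ u.toFinset, Metric.closedBall (k.1 : E n) (5 * rad k) := by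
      intro s hs
      obtain ⟨x, hx, hsx⟩ := mem_iUnion₂.1 (ht₀c hs)
      obtain ⟨k, hk, hks⟩ := hsat ⟨x, hx⟩
      obtain ⟨b, hbu, hb⟩ := hcov k hks
      refine mem_iUnion₂.2 ⟨b, mem_toFinset.2 hbu, ?_⟩
      have h0 : dist x k.1 ≤ rad k := (hBmem k ⟨x, hx⟩).1 hk
      have h1 : x ∈ Metric.closedBall (b.1 : E n) (4 * rad b) := hb (Metric.mem_closedBall.2 h0)
      have h2 := dist_triangle s x b.1
      have h3 := hradρ b
      rw [Metric.mem_closedBall] at h1 ⊢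
      rw [Metric.mem_ball] at hsx
      linarith
    calc hContent n τ S ≤ ∑ k ∈ u.toFinset, hContent n τ (Metric.closedBall (k.1 : E n)
          (5 * rad k)) := (measure_mono hSsub).trans (measure_biUnion_finset_le _ _)
      _ ≤ ∑ k ∈ u.toFinset, ENNReal.ofReal (10 ^ τ * ∑ y ∈ B k, w y) := by
          refine Finset.sum_le_sum fun k hk => ?_
          have hk' : ∑ y ∈ B k, w y = rad k ^ τ := hut (mem_toFinset.1 hk)
          refine (hContent_closedBall_le hτ.le _ (by have := hrad0 k; positivity)).trans ?_
          refine ENNReal.ofReal_le_ofReal (le_of_eq ?_)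
          rw [hk', ← Real.mul_rpow (by norm_num) (hrad0 k).le]
          congr 1
          ring
      _ = ENNReal.ofReal (10 ^ τ * ∑ k ∈ u.toFinset, ∑ y ∈ B k, w y) := by
          rw [Finset.mul_sum, ENNReal.ofReal_sum_of_nonneg]
          intro k _
          exact mul_nonneg (by positivity) (Finset.sum_nonneg fun y _ => hw0 y)
      _ ≤ ENNReal.ofReal (10 ^ τ * ∑ x, w x) := by
          refine ENNReal.ofReal_le_ofReal (mul_le_mul_of_nonneg_left ?_ (by positivity))
          rw [← Finset.sum_biUnion]
          · exact Finset.sum_le_univ_sum_of_nonneg hw0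
          · intro k hk k' hk' hne
            refine Finset.disjoint_left.2 fun y hy hy' => ?_
            have h1 : (y : E n) ∈ Metric.closedBall (k.1 : E n) (rad k) :=
              Metric.mem_closedBall.2 ((hBmem k y).1 hy)
            have h2 : (y : E n) ∈ Metric.closedBall (k'.1 : E n) (rad k') :=
              Metric.mem_closedBall.2 ((hBmem k' y).1 hy')
            exact Set.disjoint_left.1 (hdisj (mem_toFinset.1 hk) (mem_toFinset.1 hk') hne) h1 h2
      _ = ENNReal.ofReal (10 ^ τ) * ν univ := by
          rw [hνuniv, ENNReal.ofReal_mul (by positivity)]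

/-! ### The capacitary estimate -/

/-- A function is bounded by its oscillation plus a Gaussian average. -/
theorem ofReal_le_add_lintegral_gaussK {F : Type*} [NormedAddCommGroup F] [InnerProductSpace ℝ F]
    [FiniteDimensional ℝ F] [MeasurableSpace F] [BorelSpace F] {m : ℕ}
    (hF : Module.finrank ℝ F = m) {f : F → ℝ} (hf0 : ∀ u, 0 ≤ f u) (a : F)
    {ρ ε : ℝ} (hρ : 0 < ρ) (hε : 0 ≤ ε) (hosc : ∀ u, dist u a ≤ ρ → f a ≤ f u + ε) :
    ENNReal.ofReal (f a) ≤ ENNReal.ofReal ε +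
      ENNReal.ofReal (Real.exp 1) * (volume (Metric.ball (0 : F) 1))⁻¹ *
        ∫⁻ u, ENNReal.ofReal (f u * gaussK m ρ (a - u)) := by
  set v := volume (Metric.ball (0 : F) 1) with hv
  have hv0 : v ≠ 0 := (Metric.measure_ball_pos volume (0 : F) one_pos).ne'
  have hvt : v ≠ ∞ := measure_ball_lt_top.ne
  set V := volume (Metric.closedBall a ρ) with hV
  have hVeq : V = ENNReal.ofReal (ρ ^ m) * v := by
    rw [hV, Measure.addHaar_closedBall _ _ hρ.le, hF]
  have hρm : ENNReal.ofReal (ρ ^ m) ≠ 0 := by simp; positivity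
  have hV0 : V ≠ 0 := by rw [hVeq]; exact mul_ne_zero hρm hv0
  have hVt : V ≠ ∞ := by rw [hVeq]; exact ENNReal.mul_ne_top ENNReal.ofReal_ne_top hvt
  set J := ∫⁻ u, ENNReal.ofReal (f u * gaussK m ρ (a - u)) with hJ
  have hcb : MeasurableSet (Metric.closedBall a ρ) := Metric.isClosed_closedBall.measurableSet
  have h1 : V * ENNReal.ofReal (f a) ≤
      V * ENNReal.ofReal ε + ENNReal.ofReal (Real.exp 1) * ENNReal.ofReal (ρ ^ m) * J := by
    calc V * ENNReal.ofReal (f a) = ∫⁻ _ in Metric.closedBall a ρ, ENNReal.ofReal (f a) := by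
          rw [setLIntegral_const, mul_comm]
      _ ≤ ∫⁻ u in Metric.closedBall a ρ, (ENNReal.ofReal ε +
            ENNReal.ofReal (Real.exp 1) * ENNReal.ofReal (ρ ^ m) *
              ENNReal.ofReal (f u * gaussK m ρ (a - u))) := by
          refine setLIntegral_mono_ae' hcb (Eventually.of_forall fun u hu => ?_)
          have hg := gaussK_nonneg (m := m) hρ (a - u)
          have hu' := hf0 u
          rw [← ENNReal.ofReal_mul (Real.exp_pos _).le, ← ENNReal.ofReal_mul (by positivity),
            ← ENNReal.ofReal_add hε (by positivity)]
          refine ENNReal.ofReal_le_ofReal ?_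
          -- Within distance `ρ` the kernel is at least `(e * ρ ^ m)⁻¹`; this is the source of the
          -- constant `exp 1`.
          have h2 : 1 ≤ Real.exp 1 * ρ ^ m * gaussK m ρ (a - u) := by
            unfold gaussK
            have h3 : Real.exp 1 * ρ ^ m * ((ρ ^ m)⁻¹ * Real.exp (-(‖a - u‖ ^ 2 / ρ ^ 2))) =
                Real.exp (1 + -(‖a - u‖ ^ 2 / ρ ^ 2)) := by
              rw [Real.exp_add]; field_simp
            rw [h3]
            refine Real.one_le_exp ?_
            have h4 : ‖a - u‖ ≤ ρ := by
              rw [← dist_eq_norm, dist_comm]; exact hu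
            have h5 : ‖a - u‖ ^ 2 / ρ ^ 2 ≤ 1 := by
              rw [div_le_one (by positivity)]
              exact pow_le_pow_left₀ (norm_nonneg _) h4 2
            linarith
          have h6 := hosc u hu
          nlinarith
      _ = V * ENNReal.ofReal ε + ∫⁻ u in Metric.closedBall a ρ,
            ENNReal.ofReal (Real.exp 1) * ENNReal.ofReal (ρ ^ m) *
              ENNReal.ofReal (f u * gaussK m ρ (a - u)) := by
          rw [lintegral_add_left measurable_const, setLIntegral_const, mul_comm V]
      _ ≤ _ := by
          gcongr
          refine (setLIntegral_le_lintegral _ _).trans (le_of_eq ?_)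
          rw [lintegral_const_mul']
          exact ENNReal.mul_ne_top ENNReal.ofReal_ne_top ENNReal.ofReal_ne_top
  have h2 : ∀ X : ℝ≥0∞, X = V⁻¹ * (V * X) := fun X => by
    rw [← mul_assoc, ENNReal.inv_mul_cancel hV0 hVt, one_mul]
  have hVinv : V⁻¹ * ENNReal.ofReal (ρ ^ m) = v⁻¹ := by
    rw [hVeq, ENNReal.mul_inv (Or.inl hρm) (Or.inl ENNReal.ofReal_ne_top), mul_right_comm,
      ENNReal.inv_mul_cancel hρm ENNReal.ofReal_ne_top, one_mul]
  calc ENNReal.ofReal (f a) = V⁻¹ * (V * ENNReal.ofReal (f a)) := h2 _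
    _ ≤ V⁻¹ * (V * ENNReal.ofReal ε +
          ENNReal.ofReal (Real.exp 1) * ENNReal.ofReal (ρ ^ m) * J) := by gcongr
    _ = V⁻¹ * (V * ENNReal.ofReal ε) +
          ENNReal.ofReal (Real.exp 1) * (V⁻¹ * ENNReal.ofReal (ρ ^ m)) * J := by ring
    _ = _ := by rw [← h2, hVinv]

/-- The functions of a rotation and a transversal coordinate that are uniformly continuous in the
coordinate, uniformly over all rotations. -/
def EquiUniformContinuous {n m : ℕ} (f : O n × LastSpace n m → ℝ) : Prop :=
  ∀ ε > 0, ∃ η > 0, ∀ (g : O n) (u v : LastSpace n m), dist u v ≤ η → |f (g, u) - f (g, v)| ≤ ε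

/-- The discrete Frostman measures have atoms, so the kernel must stay bounded on the diagonal. For
`‖z‖ ≤ ρ` the trivial bound `σ⁻ᵐ ≤ ρ⁻ᵐ` is used instead of the asymptotics. -/
theorem exists_avgKernel_le_max {n m : ℕ} (h : m < n) : ∃ C : ℝ≥0∞, C ≠ ∞ ∧
    ∀ (ρ σ : ℝ), 0 < ρ → ρ ≤ σ → ∀ z : E n,
      avgKernel n m σ z ≤ C * ENNReal.ofReal (max ‖z‖ ρ ^ m)⁻¹ := by
  obtain ⟨C, hC, c, -, -, hle, -⟩ := exists_avgKernel_asymptotics h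
  refine ⟨max C 1, by simp [hC], fun ρ σ hρ hσ z => ?_⟩
  rcases le_total ρ ‖z‖ with hz | hz
  · rw [max_eq_left hz]
    refine (hle σ (hρ.trans_le hσ) z (norm_pos_iff.1 (hρ.trans_le hz))).trans ?_
    gcongr
    exact le_max_left _ _
  · rw [max_eq_right hz]
    refine (avgKernel_le (hρ.trans_le hσ) z).trans ?_
    refine le_trans ?_ (le_mul_of_one_le_left' (le_max_right _ _))
    refine ENNReal.ofReal_le_ofReal (inv_anti₀ (by positivity) ?_)
    exact pow_le_pow_left₀ hρ.le hσ m

/-- A measure with growth exponent `τ > m` above the scale `ρ` has `L²` bounded projections at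
scale `ρ`. -/
theorem exists_lintegral_smoothed_sq_le_of_growth {n m : ℕ} (h : m < n) {τ : ℝ}
    (hτ : (m : ℝ) < τ) {R : ℝ} (hR : 0 < R) : ∃ K : ℝ, 0 < K ∧
    ∀ (ν : Measure (E n)) [IsFiniteMeasure ν] (ρ : ℝ), 0 < ρ → ρ ≤ 1 →
      (∀ᵐ y ∂ν, y ∈ Metric.closedBall (0 : E n) R) →
      (∀ᵐ y ∂ν, ∀ r, ρ ≤ r → ν (Metric.closedBall y r) ≤ ENNReal.ofReal ((2 * r) ^ τ)) →
      ∫⁻ p, ENNReal.ofReal (smoothed m ρ ν p ^ 2) ∂bundleMeasure n m ≤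
        ENNReal.ofReal K * ν univ := by
  obtain ⟨C, hC, hker⟩ := exists_avgKernel_le_max (n := n) h
  obtain ⟨K, hK, hpot⟩ := exists_lintegral_inv_pow_le hτ
  set A := ENNReal.ofReal (Real.pi ^ ((m : ℝ) / 2)) *
    (C * ENNReal.ofReal (K * 2 ^ τ * (2 * R + 1) ^ (τ - m))) with hA
  have hAt : A ≠ ∞ := ENNReal.mul_ne_top ENNReal.ofReal_ne_top
    (ENNReal.mul_ne_top hC ENNReal.ofReal_ne_top)
  refine ⟨A.toReal + 1, by positivity, fun ν _ ρ hρ hρ1 hsupp hgr => ?_⟩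
  have hA1 : A ≤ ENNReal.ofReal (A.toReal + 1) := by
    rw [ENNReal.le_ofReal_iff_toReal_le hAt (by positivity)]
    linarith
  simp only [sq (smoothed m ρ ν _)]
  rw [lintegral_smoothed_mul h.le hρ hρ]
  have hσ : ρ ≤ √(ρ ^ 2 + ρ ^ 2) := Real.le_sqrt_of_sq_le (by nlinarith)
  have hin : ∀ᵐ y ∂ν, ∫⁻ z, avgKernel n m √(ρ ^ 2 + ρ ^ 2) (y - z) ∂ν ≤
      C * ENNReal.ofReal (K * 2 ^ τ * (2 * R + 1) ^ (τ - m)) := by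
    filter_upwards [hsupp, hgr] with y hy hgy
    have hd : Measurable fun z : E n => max ‖y - z‖ ρ := by fun_prop
    refine (lintegral_mono fun z => hker ρ _ hρ hσ (y - z)).trans ?_
    rw [lintegral_const_mul _ (by fun_prop)]
    gcongr
    -- Truncating the distance at `ρ` empties the sublevel sets below `ρ`, so growth is needed only
    -- from `ρ` on. Points of the ball are at most `2 * R` apart and `ρ ≤ 1`, hence the radius `2 *
    -- R + 1`.
    refine hpot ν (fun z => max ‖y - z‖ ρ) (2 ^ τ) (2 * R + 1) (by positivity) (by positivity) hd
      (fun z => le_max_of_le_right hρ.le) ?_ ?_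
    · filter_upwards [hsupp] with z hz
      rw [mem_closedBall_zero_iff] at hy hz
      refine max_le ((norm_sub_le y z).trans (by linarith)) (by linarith)
    · intro r hr _
      rcases lt_or_ge r ρ with hrρ | hrρ
      · have : {z : E n | max ‖y - z‖ ρ ≤ r} = ∅ := by
          ext z
          simp only [mem_ofPred_eq, mem_empty_iff_false, iff_false, not_le]
          exact lt_max_of_lt_right hrρ
        rw [this]; simp
      · rw [← Real.mul_rpow zero_le_two hr.le]
        refine (measure_mono fun z hz => ?_).trans (hgy r hrρ)
        rw [Metric.mem_closedBall, dist_comm, dist_eq_norm]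
        exact (le_max_left _ _).trans hz
  calc _ ≤ ENNReal.ofReal (Real.pi ^ ((m : ℝ) / 2)) * ∫⁻ _, C *
        ENNReal.ofReal (K * 2 ^ τ * (2 * R + 1) ^ (τ - m)) ∂ν := by
        gcongr 1
        exact lintegral_mono_ae hin
    _ = A * ν univ := by rw [lintegral_const, hA]; ring
    _ ≤ _ := by gcongr

/-- The capacitary estimate: averages of an `L²` function of the transversal coordinates are large
only on a set of small Hausdorff content of every dimension above `m`. -/
theorem exists_hContent_le {n m : ℕ} (h : m < n) {τ : ℝ} (hτ : (m : ℝ) < τ) {R : ℝ}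
    (hR : 0 < R) : ∃ M : ℝ, 0 < M ∧ ∀ f : O n × LastSpace n m → ℝ, Measurable f →
      (∀ p, 0 ≤ f p) → EquiUniformContinuous f → ∀ l : ℝ, 0 < l →
      hContent n τ {x | x ∈ Metric.closedBall (0 : E n) R ∧
        ENNReal.ofReal l < ∫⁻ g, ENNReal.ofReal (f (g, transv m g x)) ∂haarO n} ≤
      ENNReal.ofReal (M / l ^ 2) * ∫⁻ p, ENNReal.ofReal (f p ^ 2) ∂bundleMeasure n m := by
  have hτ0 : 0 < τ := lt_of_le_of_lt (Nat.cast_nonneg m) hτ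
  obtain ⟨K, hK, hKν⟩ := exists_lintegral_smoothed_sq_le_of_growth h hτ hR
  set v := volume (Metric.ball (0 : LastSpace n m) 1) with hv
  have hv0 : v ≠ 0 := (Metric.measure_ball_pos volume (0 : LastSpace n m) one_pos).ne'
  have hvt : v ≠ ∞ := measure_ball_lt_top.ne
  set c : ℝ := Real.exp 1 * v.toReal⁻¹ with hc
  have hvr : 0 < v.toReal := ENNReal.toReal_pos hv0 hvt
  have hc0 : 0 < c := by positivity
  have hcE : ENNReal.ofReal (Real.exp 1) * v⁻¹ = ENNReal.ofReal c := by
    rw [hc, ENNReal.ofReal_mul (Real.exp_pos 1).le, ENNReal.ofReal_inv_of_pos hvr,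
      ENNReal.ofReal_toReal hvt]
  -- Below, `l / 4` times the mass of `ν` is at most `c ^ 2 * K / l` times the squared norm of `f`;
  -- solving for the mass and inserting the Frostman factor gives `M / l ^ 2`.
  refine ⟨10 ^ τ * (4 * (c ^ 2 * K)), by positivity, fun f hf hf0 hfu l hl => ?_⟩
  set S := {x | x ∈ Metric.closedBall (0 : E n) R ∧
        ENNReal.ofReal l < ∫⁻ g, ENNReal.ofReal (f (g, transv m g x)) ∂haarO n} with hS
  -- Half of `l` pays for the oscillation of `f`. This fixes the scale `ρ` of the Frostman measure,
  -- on which `M` does not depend.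
  obtain ⟨η, hη, hosc⟩ := hfu (l / 2) (by positivity)
  set ρ := min η 1 with hρdef
  have hρ : 0 < ρ := lt_min hη one_pos
  obtain ⟨ν, hνf, hνS, hνg, hνc⟩ := exists_discrete_frostman hτ0 (S := S) (fun x hx => hx.1) hρ
  have hsm := hKν ν ρ hρ (min_le_right _ _) (hνS.mono fun y hy => hy.1) hνg
  set Φ := ∫⁻ p, ENNReal.ofReal (f p ^ 2) ∂bundleMeasure n m with hΦ
  have hfg : ∀ y : E n, Measurable fun p : O n × LastSpace n m =>
      ENNReal.ofReal (f p * gaussK m ρ (transv m p.1 y - p.2)) := fun y =>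
    (hf.mul (measurable_gaussK_transv y)).ennreal_ofReal
  have hpt : ∀ y ∈ S, ENNReal.ofReal (l / 2) ≤ ENNReal.ofReal c *
      ∫⁻ p, ENNReal.ofReal (f p * gaussK m ρ (transv m p.1 y - p.2)) ∂bundleMeasure n m := by
    intro y hy
    have h1 : ∫⁻ g, ENNReal.ofReal (f (g, transv m g y)) ∂haarO n ≤ ENNReal.ofReal (l / 2) +
        ENNReal.ofReal c * ∫⁻ p, ENNReal.ofReal (f p * gaussK m ρ (transv m p.1 y - p.2))
          ∂bundleMeasure n m := by
      calc _ ≤ ∫⁻ g, (ENNReal.ofReal (l / 2) + ENNReal.ofReal c *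
            ∫⁻ u, ENNReal.ofReal (f (g, u) * gaussK m ρ (transv m g y - u))) ∂haarO n := by
            refine lintegral_mono fun g => ?_
            rw [← hcE]
            refine ofReal_le_add_lintegral_gaussK (finrank_lastSpace h.le)
              (f := fun u => f (g, u)) (fun u => hf0 _) _ hρ
              (by positivity) fun u hu => ?_
            have := (abs_le.1 (hosc g u (transv m g y) (hu.trans (min_le_left _ _)))).1
            linarith
        _ = _ := by
            rw [lintegral_add_left measurable_const, lintegral_const, measure_univ, mul_one,
              lintegral_const_mul' _ _ ENNReal.ofReal_ne_top, bundleMeasure,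
              lintegral_prod _ (hfg y).aemeasurable]
    have h2 := hy.2.le.trans h1
    have h3 : ENNReal.ofReal l = ENNReal.ofReal (l / 2) + ENNReal.ofReal (l / 2) := by
      rw [← ENNReal.ofReal_add (by positivity) (by positivity)]; congr 1; ring
    rw [h3] at h2
    exact (ENNReal.add_le_add_iff_left ENNReal.ofReal_ne_top).1 h2
  have hsmm : Measurable (smoothed m ρ ν) := measurable_smoothed
  have hint : ENNReal.ofReal (l / 2) * ν univ ≤ ENNReal.ofReal c *
      ∫⁻ p, ENNReal.ofReal (f p * smoothed m ρ ν p) ∂bundleMeasure n m := by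
    have hJ : Measurable fun q : E n × (O n × LastSpace n m) =>
        ENNReal.ofReal (f q.2 * gaussK m ρ (transv m q.2.1 q.1 - q.2.2)) := by
      have h1 : Measurable fun q : E n × (O n × LastSpace n m) => (q.2, q.1) :=
        measurable_snd.prodMk measurable_fst
      have h2 := ((continuous_gaussK (F := LastSpace n m) (m := m) ρ).comp
        (continuous_transv_sub (n := n))).measurable.comp h1
      exact ((hf.comp measurable_snd).mul h2).ennreal_ofReal
    calc ENNReal.ofReal (l / 2) * ν univ = ∫⁻ _, ENNReal.ofReal (l / 2) ∂ν := by
          rw [lintegral_const]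
      _ ≤ ∫⁻ y, ENNReal.ofReal c * ∫⁻ p, ENNReal.ofReal (f p *
            gaussK m ρ (transv m p.1 y - p.2)) ∂bundleMeasure n m ∂ν :=
          lintegral_mono_ae (hνS.mono hpt)
      _ = ENNReal.ofReal c * ∫⁻ p, ∫⁻ y, ENNReal.ofReal (f p *
            gaussK m ρ (transv m p.1 y - p.2)) ∂ν ∂bundleMeasure n m := by
          have : SFinite (bundleMeasure n m) := by unfold bundleMeasure; infer_instance
          rw [lintegral_const_mul' _ _ ENNReal.ofReal_ne_top,
            lintegral_lintegral_swap hJ.aemeasurable]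
      _ = _ := by
          congr 1
          refine lintegral_congr fun p => ?_
          rw [ENNReal.ofReal_mul (hf0 p), ofReal_smoothed hρ,
            ← lintegral_const_mul' _ _ ENNReal.ofReal_ne_top]
          exact lintegral_congr fun y => ENNReal.ofReal_mul (hf0 p)
  -- Cauchy–Schwarz as a weighted AM–GM inequality, tuned so that by `hsm` the `ν` term is half of
  -- the left side of `hint`; it can be absorbed because `ν` is finite.
  have hamgm : ENNReal.ofReal c * ∫⁻ p, ENNReal.ofReal (f p * smoothed m ρ ν p) ∂bundleMeasure n m
      ≤ ENNReal.ofReal (c ^ 2 * K / l) * Φ + ENNReal.ofReal (l / 4) * ν univ := by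
    have h1 : ∫⁻ p, ENNReal.ofReal (c * (f p * smoothed m ρ ν p)) ∂bundleMeasure n m ≤
        ∫⁻ p, (ENNReal.ofReal (c ^ 2 * K / l) * ENNReal.ofReal (f p ^ 2) +
          ENNReal.ofReal (l / (4 * K)) * ENNReal.ofReal (smoothed m ρ ν p ^ 2))
            ∂bundleMeasure n m := by
      refine lintegral_mono fun p => ?_
      rw [← ENNReal.ofReal_mul (by positivity), ← ENNReal.ofReal_mul (by positivity),
        ← ENNReal.ofReal_add (by positivity) (by positivity)]
      refine ENNReal.ofReal_le_ofReal ?_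
      have h2 : c ^ 2 * K / l * f p ^ 2 + l / (4 * K) * smoothed m ρ ν p ^ 2 -
          c * (f p * smoothed m ρ ν p) =
          (2 * c * K * f p - l * smoothed m ρ ν p) ^ 2 / (4 * K * l) := by
        field_simp; ring
      have h3 : 0 ≤ (2 * c * K * f p - l * smoothed m ρ ν p) ^ 2 / (4 * K * l) := by positivity
      linarith
    calc _ = ∫⁻ p, ENNReal.ofReal (c * (f p * smoothed m ρ ν p)) ∂bundleMeasure n m := by
          rw [← lintegral_const_mul' _ _ ENNReal.ofReal_ne_top]
          exact lintegral_congr fun p => (ENNReal.ofReal_mul hc0.le).symm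
      _ ≤ _ := h1
      _ = ENNReal.ofReal (c ^ 2 * K / l) * Φ + ENNReal.ofReal (l / (4 * K)) *
            ∫⁻ p, ENNReal.ofReal (smoothed m ρ ν p ^ 2) ∂bundleMeasure n m := by
          rw [lintegral_add_left (by fun_prop), lintegral_const_mul' _ _ ENNReal.ofReal_ne_top,
            lintegral_const_mul' _ _ ENNReal.ofReal_ne_top]
      _ ≤ ENNReal.ofReal (c ^ 2 * K / l) * Φ + ENNReal.ofReal (l / (4 * K)) *
            (ENNReal.ofReal K * ν univ) := by gcongr
      _ = _ := by
          rw [← mul_assoc, ← ENNReal.ofReal_mul (by positivity)]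
          congr 3
          field_simp
  have hfin : ENNReal.ofReal (l / 4) * ν univ ≤ ENNReal.ofReal (c ^ 2 * K / l) * Φ := by
    have h1 := hint.trans hamgm
    have h2 : ENNReal.ofReal (l / 2) * ν univ = ENNReal.ofReal (l / 4) * ν univ +
        ENNReal.ofReal (l / 4) * ν univ := by
      rw [← add_mul, ← ENNReal.ofReal_add (by positivity) (by positivity)]
      congr 2; ring
    rw [h2] at h1
    exact (ENNReal.add_le_add_iff_right (ENNReal.mul_ne_top ENNReal.ofReal_ne_top
      (measure_ne_top ν univ))).1 h1
  calc hContent n τ S ≤ ENNReal.ofReal (10 ^ τ) * ν univ := hνc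
    _ = ENNReal.ofReal (10 ^ τ * (4 / l)) * (ENNReal.ofReal (l / 4) * ν univ) := by
        rw [← mul_assoc, ← ENNReal.ofReal_mul (by positivity)]
        congr 2
        field_simp
    _ ≤ ENNReal.ofReal (10 ^ τ * (4 / l)) * (ENNReal.ofReal (c ^ 2 * K / l) * Φ) := by gcongr
    _ = _ := by
        rw [← mul_assoc, ← ENNReal.ofReal_mul (by positivity)]
        congr 2
        field_simp

/-! ### Compact subsets with growth exponent `s` -/

theorem exists_cover_of_hausdorffMeasure_lt {n : ℕ} {s : ℝ} (hs : 0 < s) {S : Set (E n)} {a : ℝ≥0∞}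
    (h : (Measure.hausdorffMeasure s : Measure (E n)) S < a) {r : ℝ≥0∞} (hr : 0 < r) :
    ∃ t : ℕ → Set (E n), S ⊆ ⋃ i, t i ∧ (∀ i, t i ⊆ S) ∧ (∀ i, Metric.ediam (t i) ≤ r) ∧
      ∑' i, Metric.ediam (t i) ^ s < a := by
  rw [Measure.hausdorffMeasure_apply] at h
  have h1 := (le_iSup₂ (f := fun (r : ℝ≥0∞) (_ : 0 < r) => ⨅ (t : ℕ → Set (E n))
    (_ : S ⊆ ⋃ n, t n) (_ : ∀ n, Metric.ediam (t n) ≤ r),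
      ∑' n, ⨆ _ : (t n).Nonempty, Metric.ediam (t n) ^ s) r hr).trans_lt h
  simp only [iInf_lt_iff] at h1
  obtain ⟨t, ht, htr, hsum⟩ := h1
  refine ⟨fun i => t i ∩ S, fun x hx => ?_, fun i => inter_subset_right,
    fun i => (Metric.ediam_mono inter_subset_left).trans (htr i), ?_⟩
  · obtain ⟨i, hi⟩ := mem_iUnion.1 (ht hx)
    exact mem_iUnion.2 ⟨i, hi, hx⟩
  · refine lt_of_le_of_lt (ENNReal.tsum_le_tsum fun i => ?_) hsum
    rcases (t i).eq_empty_or_nonempty with he | he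
    · simp [he, hs]
    · refine le_trans ?_ (le_iSup (fun _ : (t i).Nonempty => Metric.ediam (t i) ^ s) he)
      exact ENNReal.rpow_le_rpow (Metric.ediam_mono inter_subset_left) hs.le

/-- A Carathéodory measurable set of positive finite Hausdorff measure contains a compact set of
positive measure. -/
theorem exists_isCompact_subset_hausdorffMeasure_pos {n : ℕ} {s : ℝ} {A : Set (E n)}
    (hA : (Measure.hausdorffMeasure s : Measure (E n)).toOuterMeasure.IsCaratheodory A)
    (hpos : 0 < (Measure.hausdorffMeasure s : Measure (E n)) A)
    (hfin : (Measure.hausdorffMeasure s : Measure (E n)) A < ∞) :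
    ∃ K ⊆ A, IsCompact K ∧ 0 < (Measure.hausdorffMeasure s : Measure (E n)) K := by
  set H : Measure (E n) := Measure.hausdorffMeasure s with hH
  set A₁ := toMeasurable H A with hA₁
  have hAA : A ⊆ A₁ := subset_toMeasurable H A
  have hnull : H (A₁ \ A) = 0 := by
    have h1 : H A₁ = H (A₁ ∩ A) + H (A₁ \ A) := hA A₁
    rw [inter_eq_self_of_subset_right hAA, measure_toMeasurable] at h1
    have h2 : H A + H (A₁ \ A) ≤ H A + 0 := by rw [← h1, add_zero]
    exact nonpos_iff_eq_zero.1 ((ENNReal.add_le_add_iff_left hfin.ne).1 h2)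
  -- Removing from the measurable hull of `A` a measurable null set containing `A₁ \ A` leaves a
  -- Borel subset of `A` of full measure, where inner regularity applies.
  set N := toMeasurable H (A₁ \ A) with hN
  have hNnull : H N = 0 := by rw [hN, measure_toMeasurable, hnull]
  set A₂ := A₁ \ N with hA₂
  have hA₂m : MeasurableSet A₂ := (measurableSet_toMeasurable _ _).diff
    (measurableSet_toMeasurable _ _)
  have hA₂A : A₂ ⊆ A := by
    intro x hx
    by_contra hxA
    exact hx.2 (subset_toMeasurable H _ ⟨hx.1, hxA⟩)
  have hA₂pos : 0 < H A₂ := by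
    rw [hA₂, measure_sdiff_null hNnull, hA₁, measure_toMeasurable]
    exact hpos
  have hA₂fin : H A₂ < ∞ := (measure_mono hA₂A).trans_lt hfin
  have : IsFiniteMeasure (H.restrict A₂) := ⟨by rwa [Measure.restrict_apply_univ]⟩
  obtain ⟨K, hKA, hKc, hK⟩ := hA₂m.exists_lt_isCompact_of_ne_top (μ := H.restrict A₂) (r := 0)
    (measure_ne_top _ _) (by rwa [Measure.restrict_apply_self])
  refine ⟨K, hKA.trans hA₂A, hKc, hK.trans_le (Measure.restrict_apply_le _ _)⟩

/-- Points of large upper density form a set of small Hausdorff measure. -/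
theorem hausdorffMeasure_le_of_upper_density {n : ℕ} {s c : ℝ} (hs : 0 < s) (hc : 0 < c)
    {ν : Measure (E n)} {Z : Set (E n)}
    (hZ : ∀ y ∈ Z, ∀ ε > 0, ∃ r, 0 < r ∧ r < ε ∧
      ENNReal.ofReal (c * r ^ s) < ν (Metric.closedBall y r)) :
    (Measure.hausdorffMeasure s : Measure (E n)) Z ≤ ENNReal.ofReal (8 ^ s / c) * ν univ := by
  have hex : ∀ N : ℕ, ∃ (u : Set (E n)) (r : E n → ℝ), u.Countable ∧
      (∀ y ∈ u, 0 < r y ∧ r y < 1 / ((N : ℝ) + 1)) ∧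
      (Z ⊆ ⋃ y ∈ u, Metric.closedBall y (4 * r y)) ∧
      ∑' y : u, ENNReal.ofReal ((8 * r y) ^ s) ≤ ENNReal.ofReal (8 ^ s / c) * ν univ := by
    intro N
    have hN : (0 : ℝ) < 1 / ((N : ℝ) + 1) := by positivity
    choose! r hr0 hrN hrν using fun y hy => hZ y hy _ hN
    -- The fourfold enlargement of a ball of radius `r` has diameter at most `8 * r`, whence `8 ^
    -- s`.
    obtain ⟨u, huZ, hdisj, hcov⟩ :=
      Vitali.exists_disjoint_subfamily_covering_enlargement_closedBall Z id r
        (1 / ((N : ℝ) + 1)) (fun y hy => (hrN y hy).le) 4 (by norm_num)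
    have hdisj' : u.PairwiseDisjoint fun y => Metric.closedBall y (r y) := hdisj
    have huc : u.Countable := hdisj'.countable_of_nonempty_interior fun y hy =>
      ⟨y, Metric.ball_subset_interior_closedBall (Metric.mem_ball_self (hr0 y (huZ hy)))⟩
    refine ⟨u, r, huc, fun y hy => ⟨hr0 y (huZ hy), hrN y (huZ hy)⟩, fun y hy => ?_, ?_⟩
    · obtain ⟨b, hbu, hb⟩ := hcov y hy
      exact mem_iUnion₂.2 ⟨b, hbu, hb (Metric.mem_closedBall_self (hr0 y hy).le)⟩
    · have : Countable u := huc.to_subtype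
      calc ∑' y : u, ENNReal.ofReal ((8 * r y) ^ s)
          ≤ ∑' y : u, ENNReal.ofReal (8 ^ s / c) * ν (Metric.closedBall (y : E n) (r y)) := by
            refine ENNReal.tsum_le_tsum fun y => ?_
            have hy := huZ y.2
            refine le_trans (le_of_eq ?_) (mul_le_mul_right (hrν y hy).le _)
            rw [← ENNReal.ofReal_mul (by positivity),
              Real.mul_rpow (by norm_num) (hr0 y hy).le]
            congr 1
            field_simp
        _ = ENNReal.ofReal (8 ^ s / c) * ν (⋃ y ∈ u, Metric.closedBall y (r y)) := by
            rw [ENNReal.tsum_mul_left, measure_biUnion huc hdisj'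
              fun y _ => Metric.isClosed_closedBall.measurableSet]
        _ ≤ _ := by gcongr; exact subset_univ _
  choose u r huc hur hcov hsum using hex
  have : ∀ N, Countable (u N) := fun N => (huc N).to_subtype
  have hdiam : ∀ N (y : u N), Metric.ediam (Metric.closedBall (y : E n) (4 * r N y)) ≤
      ENNReal.ofReal (8 * r N y) := by
    intro N y
    refine Metric.ediam_le_of_forall_dist_le fun a ha b hb => ?_
    rw [Metric.mem_closedBall] at ha hb
    linarith [dist_triangle_right a b (y : E n)]
  refine (Measure.hausdorffMeasure_le_liminf_tsum (l := atTop) s Z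
    (fun N : ℕ => ENNReal.ofReal (8 * (1 / ((N : ℝ) + 1)))) ?_
    (fun N (y : u N) => Metric.closedBall (y : E n) (4 * r N y)) ?_ ?_).trans ?_
  · have h1 := (tendsto_one_div_add_atTop_nhds_zero_nat (𝕜 := ℝ)).const_mul 8
    simpa using ENNReal.tendsto_ofReal h1
  · refine Eventually.of_forall fun N y => (hdiam N y).trans (ENNReal.ofReal_le_ofReal ?_)
    linarith [(hur N y y.2).2]
  · refine Eventually.of_forall fun N => (hcov N).trans ?_
    rw [biUnion_eq_iUnion]
  · refine liminf_le_of_le ?_ fun b hb => ?_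
    · isBoundedDefault
    · obtain ⟨N, hN⟩ := hb.exists
      refine hN.trans (le_trans (ENNReal.tsum_le_tsum fun y => ?_) (hsum N))
      rw [← ENNReal.ofReal_rpow_of_nonneg (by have := (hur N y y.2).1; positivity) hs.le]
      exact ENNReal.rpow_le_rpow (hdiam N y) hs.le

/-- The measure of an open ball is lower semicontinuous in its centre: most of it is carried by a
slightly smaller concentric ball, which nearby balls of the original radius still contain. -/
theorem isClosed_setOf_measure_ball_le {n : ℕ} (ν : Measure (E n)) (r : ℝ) (a : ℝ≥0∞) :
    IsClosed {y : E n | ν (Metric.ball y r) ≤ a} := by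
  rw [← isOpen_compl_iff, isOpen_iff_mem_nhds]
  intro y hy
  have hy : a < ν (Metric.ball y r) := not_le.1 hy
  have hU : Metric.ball y r = ⋃ k : ℕ, Metric.ball y (r - 1 / ((k : ℝ) + 1)) := by
    ext z
    simp only [mem_iUnion, Metric.mem_ball]
    constructor
    · intro hz
      obtain ⟨k, hk⟩ := exists_nat_one_div_lt (sub_pos.2 hz)
      exact ⟨k, by linarith⟩
    · rintro ⟨k, hk⟩
      have : (0 : ℝ) < 1 / ((k : ℝ) + 1) := by positivity
      linarith
  have hmono : Monotone fun k : ℕ => Metric.ball y (r - 1 / ((k : ℝ) + 1)) := by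
    intro k l hkl
    refine Metric.ball_subset_ball ?_
    have := Nat.one_div_le_one_div (α := ℝ) hkl
    linarith
  rw [hU, hmono.measure_iUnion, lt_iSup_iff] at hy
  obtain ⟨k, hk⟩ := hy
  filter_upwards [Metric.ball_mem_nhds y (show (0 : ℝ) < 1 / ((k : ℝ) + 1) by positivity)] with z hz
  refine not_le.2 (hk.trans_le (measure_mono fun w hw => ?_))
  rw [Metric.mem_ball] at *
  rw [dist_comm] at hz
  linarith [dist_triangle w y z]

/-- A set of positive finite Hausdorff measure contains a compact subset of positive measure on
which the measure has growth exponent `s`. -/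
theorem exists_isCompact_growth {n : ℕ} {s : ℝ} (hs : 0 < s) {A : Set (E n)}
    (hA : (Measure.hausdorffMeasure s : Measure (E n)).toOuterMeasure.IsCaratheodory A)
    (hpos : 0 < (Measure.hausdorffMeasure s : Measure (E n)) A)
    (hfin : (Measure.hausdorffMeasure s : Measure (E n)) A < ∞) :
    ∃ K ⊆ A, IsCompact K ∧ 0 < (Measure.hausdorffMeasure s : Measure (E n)) K ∧
      ∃ C : ℝ, 0 ≤ C ∧ ∀ y ∈ K, ∀ r, 0 < r →
        (Measure.hausdorffMeasure s : Measure (E n)) (K ∩ Metric.closedBall y r) ≤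
          ENNReal.ofReal (C * r ^ s) := by
  obtain ⟨K, hKA, hKc, hKpos⟩ := exists_isCompact_subset_hausdorffMeasure_pos hA hpos hfin
  set H : Measure (E n) := Measure.hausdorffMeasure s with hH
  have hKfin : H K < ∞ := (measure_mono hKA).trans_lt hfin
  set ν := H.restrict K with hν
  have hνuniv : ν univ = H K := Measure.restrict_apply_univ _
  -- With this `c` the points of upper density above `c` carry at most half of `K`, so some `Γ N` is
  -- not null.
  set c : ℝ := 2 * 8 ^ s with hc
  have hc0 : 0 < c := by positivity
  set Γ : ℕ → Set (E n) := fun N => K ∩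
    ⋂ (r : ℝ) (_ : 0 < r) (_ : r < 1 / ((N : ℝ) + 1)),
      {y | ν (Metric.ball y r) ≤ ENNReal.ofReal (c * r ^ s)} with hΓ
  have hΓc : ∀ N, IsCompact (Γ N) := fun N => hKc.inter_right <|
    isClosed_iInter fun r => isClosed_iInter fun _ => isClosed_iInter fun _ =>
      isClosed_setOf_measure_ball_le ν r _
  have hex : ∃ N, 0 < H (Γ N) := by
    by_contra! hno
    have hun : H (⋃ N, Γ N) = 0 := measure_iUnion_null fun N => nonpos_iff_eq_zero.1 (hno N)
    have hZ : H (K \ ⋃ N, Γ N) ≤ ENNReal.ofReal (8 ^ s / c) * ν univ := by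
      refine hausdorffMeasure_le_of_upper_density hs hc0 fun y hy ε hε => ?_
      obtain ⟨N, hN⟩ := exists_nat_one_div_lt hε
      have hyN : y ∉ Γ N := fun h => hy.2 (mem_iUnion.2 ⟨N, h⟩)
      simp only [hΓ, mem_inter_iff, hy.1, true_and, mem_iInter, mem_ofPred_eq, not_forall,
        not_le] at hyN
      obtain ⟨r, hr0, hrN, hr⟩ := hyN
      exact ⟨r, hr0, hrN.trans hN, hr.trans_le (measure_mono Metric.ball_subset_closedBall)⟩
    have h8 : (8 : ℝ) ^ s / c = 1 / 2 := by rw [hc]; field_simp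
    have h1 : H K ≤ H K / 2 := by
      calc H K ≤ H (K \ ⋃ N, Γ N) + H (⋃ N, Γ N) := by
            refine (measure_mono fun x hx => ?_).trans (measure_union_le _ _)
            by_cases hx' : x ∈ ⋃ N, Γ N
            · exact Or.inr hx'
            · exact Or.inl ⟨hx, hx'⟩
        _ ≤ ENNReal.ofReal (8 ^ s / c) * ν univ := by rw [hun, add_zero]; exact hZ
        _ = H K / 2 := by
            rw [h8, hνuniv, ENNReal.ofReal_div_of_pos two_pos, ENNReal.ofReal_one,
              ENNReal.ofReal_ofNat, ENNReal.div_eq_inv_mul, ENNReal.div_eq_inv_mul, mul_one]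
    exact absurd (ENNReal.half_lt_self hKpos.ne' hKfin.ne) (not_lt.2 h1)
  obtain ⟨N, hN⟩ := hex
  set ε : ℝ := 1 / ((N : ℝ) + 1) with hε
  have hε0 : 0 < ε := by positivity
  -- The first summand serves `2 * r < ε`, where a closed ball sits in the open ball of twice the
  -- radius; the second bounds larger balls by all of `K`.
  refine ⟨Γ N, inter_subset_left.trans hKA, hΓc N, hN,
    c * 2 ^ s + (H K).toReal * (2 / ε) ^ s, by positivity, fun y hy r hr => ?_⟩
  rcases lt_or_ge (2 * r) ε with h2r | h2r
  · have h1 : ν (Metric.ball y (2 * r)) ≤ ENNReal.ofReal (c * (2 * r) ^ s) := by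
      have := hy.2
      simp only [mem_iInter] at this
      exact this (2 * r) (by positivity) h2r
    calc H (Γ N ∩ Metric.closedBall y r) ≤ H (Metric.ball y (2 * r) ∩ K) := by
          refine measure_mono fun z hz => ⟨?_, hz.1.1⟩
          have := Metric.mem_closedBall.1 hz.2
          rw [Metric.mem_ball]; linarith
      _ = ν (Metric.ball y (2 * r)) := (Measure.restrict_apply Metric.isOpen_ball.measurableSet).symm
      _ ≤ _ := h1.trans (ENNReal.ofReal_le_ofReal ?_)
    rw [Real.mul_rpow zero_le_two hr.le, ← mul_assoc]
    have : 0 ≤ (H K).toReal * (2 / ε) ^ s := by positivity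
    gcongr
    linarith
  · calc H (Γ N ∩ Metric.closedBall y r) ≤ H K := measure_mono fun z hz => hz.1.1
      _ = ENNReal.ofReal (H K).toReal := (ENNReal.ofReal_toReal hKfin.ne).symm
      _ ≤ _ := ENNReal.ofReal_le_ofReal ?_
    have h1 : 1 ≤ (2 / ε) ^ s * r ^ s := by
      rw [← Real.mul_rpow (by positivity) hr.le]
      refine Real.one_le_rpow ?_ hs.le
      rw [div_mul_eq_mul_div, le_div_iff₀ hε0]
      linarith
    have h2 : 0 ≤ c * 2 ^ s * r ^ s := by positivity
    have h3 : 0 ≤ (H K).toReal := ENNReal.toReal_nonneg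
    nlinarith

/-! ### Upper bound for the dimension of sections -/

/-- The probability that a random plane passes within distance `d` of a given point. -/
theorem exists_haarO_norm_transv_le {n m : ℕ} (h : m < n) : ∃ C : ℝ≥0∞, C ≠ ∞ ∧
    ∀ (z : E n) (d : ℝ), z ≠ 0 → 0 < d →
      haarO n {g | ‖transv m g z‖ ≤ d} ≤
        C * ENNReal.ofReal (d ^ m) * ENNReal.ofReal (‖z‖ ^ m)⁻¹ := by
  obtain ⟨C, hC, c, -, -, hle, -⟩ := exists_avgKernel_asymptotics h
  refine ⟨ENNReal.ofReal (Real.exp 1) * C, ENNReal.mul_ne_top ENNReal.ofReal_ne_top hC,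
    fun z d hz hd => ?_⟩
  have hms : MeasurableSet {g : O n | ‖transv m g z‖ ≤ d} :=
    measurableSet_le (measurable_transv_left z).norm measurable_const
  calc haarO n {g | ‖transv m g z‖ ≤ d}
      = ∫⁻ g, {g : O n | ‖transv m g z‖ ≤ d}.indicator 1 g ∂haarO n :=
        (lintegral_indicator_one hms).symm
    _ ≤ ∫⁻ g, ENNReal.ofReal (Real.exp 1 * d ^ m) *
          ENNReal.ofReal (gaussK m d (transv m g z)) ∂haarO n := by
        refine lintegral_mono fun g => ?_
        by_cases hg : ‖transv m g z‖ ≤ d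
        · rw [indicator_of_mem (s := {g : O n | ‖transv m g z‖ ≤ d}) hg]
          rw [← ENNReal.ofReal_mul (by positivity), Pi.one_apply, ← ENNReal.ofReal_one]
          refine ENNReal.ofReal_le_ofReal ?_
          have h3 : Real.exp 1 * d ^ m * gaussK m d (transv m g z) =
              Real.exp (1 + -(‖transv m g z‖ ^ 2 / d ^ 2)) := by
            unfold gaussK; rw [Real.exp_add]; field_simp
          rw [h3]
          refine Real.one_le_exp ?_
          have h5 : ‖transv m g z‖ ^ 2 / d ^ 2 ≤ 1 := by
            rw [div_le_one (by positivity)]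
            exact pow_le_pow_left₀ (norm_nonneg _) hg 2
          linarith
        · rw [indicator_of_notMem (s := {g : O n | ‖transv m g z‖ ≤ d}) hg]
          exact zero_le
    _ = ENNReal.ofReal (Real.exp 1 * d ^ m) * avgKernel n m d z :=
        lintegral_const_mul' _ _ ENNReal.ofReal_ne_top
    _ ≤ ENNReal.ofReal (Real.exp 1 * d ^ m) * (C * ENNReal.ofReal (‖z‖ ^ m)⁻¹) := by
        gcongr
        exact hle d hd z hz
    _ = _ := by rw [ENNReal.ofReal_mul (Real.exp_pos 1).le]; ring

/-- Away from `x`, almost every plane section through `x` of a set of finite `s`-dimensional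
measure has finite `(s - m)`-dimensional measure. -/
theorem ae_hausdorffMeasure_section_lt_top {n m : ℕ} (h : m < n) {s : ℝ} (hms : (m : ℝ) < s)
    {A : Set (E n)} (hfin : (Measure.hausdorffMeasure s : Measure (E n)) A < ∞) (x : E n) {ε : ℝ}
    (hε : 0 < ε) (hA : ∀ y ∈ A, ε ≤ ‖y - x‖) :
    ∀ᵐ g ∂haarO n, (Measure.hausdorffMeasure (s - m) : Measure (E n))
      (A ∩ {y | transv m g (y - x) = 0}) < ∞ := by
  have hs : 0 < s := lt_of_le_of_lt (Nat.cast_nonneg m) hms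
  have hsm : 0 < s - m := sub_pos.2 hms
  obtain ⟨C, hC, hprob⟩ := exists_haarO_norm_transv_le h
  set a := (Measure.hausdorffMeasure s : Measure (E n)) A + 1 with ha
  have hat : a ≠ ∞ := by simp [ha, hfin.ne]
  have hlt : (Measure.hausdorffMeasure s : Measure (E n)) A < a :=
    ENNReal.lt_add_right hfin.ne one_ne_zero
  have hr : ∀ i : ℕ, 0 < ENNReal.ofReal (1 / ((i : ℝ) + 1)) := fun i => by
    rw [ENNReal.ofReal_pos]; positivity
  choose t htA htsub htr htsum using fun i =>
    exists_cover_of_hausdorffMeasure_lt hs hlt (hr i)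
  have hdt : ∀ i l, Metric.ediam (t i l) ≠ ∞ := fun i l =>
    ne_top_of_le_ne_top ENNReal.ofReal_ne_top (htr i l)
  have hpt : ∀ i l, ∃ y : E n, (t i l).Nonempty → y ∈ t i l := fun i l => by
    rcases (t i l).eq_empty_or_nonempty with he | ⟨y, hy⟩
    · exact ⟨0, fun hne => absurd he hne.ne_empty⟩
    · exact ⟨y, fun _ => hy⟩
  choose y hy using hpt
  set D : ℕ → ℕ → ℝ := fun i l => (Metric.ediam (t i l)).toReal with hD
  -- If the plane through `x` meets `t i l` at `z`, then `y i l - x` and `y i l - z` have the same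
  -- transversal coordinates, of norm at most `D i l`. So `M i l` contains every such rotation.
  set M : ℕ → ℕ → Set (O n) := fun i l => {g | ‖transv m g (y i l - x)‖ ≤ D i l} with hM
  have hMm : ∀ i l, MeasurableSet (M i l) := fun i l =>
    measurableSet_le (measurable_transv_left _).norm measurable_const
  set φ : ℕ → O n → ℝ≥0∞ := fun i g =>
    ∑' l, Metric.ediam (t i l) ^ (s - m) * (M i l).indicator 1 g with hφ
  have hφm : ∀ i, Measurable (φ i) := fun i => Measurable.tsum fun l =>
    (measurable_one.indicator (hMm i l)).const_mul _
  set B := C * ENNReal.ofReal (ε ^ m)⁻¹ * a with hB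
  have hBt : B ≠ ∞ :=
    ENNReal.mul_ne_top (ENNReal.mul_ne_top hC ENNReal.ofReal_ne_top) hat
  have hint : ∀ i, ∫⁻ g, φ i g ∂haarO n ≤ B := by
    intro i
    simp only [hφ]
    rw [lintegral_tsum fun l => ((measurable_one.indicator (hMm i l)).const_mul _).aemeasurable]
    calc ∑' l, ∫⁻ g, Metric.ediam (t i l) ^ (s - m) * (M i l).indicator 1 g ∂haarO n
        ≤ ∑' l, C * ENNReal.ofReal (ε ^ m)⁻¹ * Metric.ediam (t i l) ^ s := by
          refine ENNReal.tsum_le_tsum fun l => ?_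
          rw [lintegral_const_mul _ (measurable_one.indicator (hMm i l)),
            lintegral_indicator_one (hMm i l)]
          rcases eq_or_ne (Metric.ediam (t i l)) 0 with h0 | h0
          · rw [h0, ENNReal.zero_rpow_of_pos hsm]; simp
          · have hne : (t i l).Nonempty := by
              by_contra hne
              rw [not_nonempty_iff_eq_empty] at hne
              simp [hne] at h0
            have hyA := hA _ (htsub i l (hy i l hne))
            have hD0 : 0 < D i l := ENNReal.toReal_pos h0 (hdt i l)
            have hDe : Metric.ediam (t i l) = ENNReal.ofReal (D i l) :=
              (ENNReal.ofReal_toReal (hdt i l)).symm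
            have h1 := hprob (y i l - x) (D i l) (norm_pos_iff.1 (hε.trans_le hyA)) hD0
            calc Metric.ediam (t i l) ^ (s - m) * haarO n (M i l)
                ≤ Metric.ediam (t i l) ^ (s - m) * (C * ENNReal.ofReal (D i l ^ m) *
                  ENNReal.ofReal (‖y i l - x‖ ^ m)⁻¹) := by gcongr
              _ ≤ Metric.ediam (t i l) ^ (s - m) * (C * ENNReal.ofReal (D i l ^ m) *
                  ENNReal.ofReal (ε ^ m)⁻¹) := by gcongr
              _ = C * ENNReal.ofReal (ε ^ m)⁻¹ * (ENNReal.ofReal (D i l ^ m) *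
                  Metric.ediam (t i l) ^ (s - m)) := by ring
              _ = _ := by
                  congr 1
                  rw [hDe, ENNReal.ofReal_rpow_of_pos hD0, ENNReal.ofReal_rpow_of_pos hD0,
                    ← ENNReal.ofReal_mul (by positivity), ← Real.rpow_natCast,
                    ← Real.rpow_add hD0]
                  congr 2
                  ring
      _ = C * ENNReal.ofReal (ε ^ m)⁻¹ * ∑' l, Metric.ediam (t i l) ^ s :=
          ENNReal.tsum_mul_left
      _ ≤ B := mul_le_mul_right (htsum i).le _
  -- The expected cover sums stay below `B` as the mesh tends to zero; Fatou gives a finite liminf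
  -- for almost every `g`.
  have hliminf : ∫⁻ g, liminf (fun i => φ i g) atTop ∂haarO n ≠ ∞ := by
    refine ne_top_of_le_ne_top hBt ((lintegral_liminf_le hφm).trans ?_)
    refine liminf_le_of_le (by isBoundedDefault) fun b hb => ?_
    obtain ⟨i, hi⟩ := hb.exists
    exact hi.trans (hint i)
  have hae := ae_lt_top (Measurable.liminf hφm) hliminf
  filter_upwards [hae] with g hg
  refine lt_of_le_of_lt ?_ hg
  set S := A ∩ {y | transv m g (y - x) = 0} with hS
  refine (Measure.hausdorffMeasure_le_liminf_tsum (l := atTop) (s - m) S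
    (fun i : ℕ => ENNReal.ofReal (1 / ((i : ℝ) + 1))) ?_ (fun i l => t i l ∩ S) ?_ ?_).trans ?_
  · simpa using ENNReal.tendsto_ofReal (tendsto_one_div_add_atTop_nhds_zero_nat (𝕜 := ℝ))
  · exact Eventually.of_forall fun i l => (Metric.ediam_mono inter_subset_left).trans (htr i l)
  · refine Eventually.of_forall fun i z hz => ?_
    obtain ⟨l, hl⟩ := mem_iUnion.1 (htA i hz.1)
    exact mem_iUnion.2 ⟨l, hl, hz⟩
  · refine liminf_le_liminf (Eventually.of_forall fun i => ENNReal.tsum_le_tsum fun l => ?_)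
    rcases (t i l ∩ S).eq_empty_or_nonempty with he | ⟨z, hz⟩
    · simp [he, hsm]
    · have hmem : g ∈ M i l := by
        have h1 : transv m g (y i l - x) = transv m g (y i l - z) := by
          have h0 : transv m g (z - x) = 0 := hz.2.2
          have h2 : y i l - z = (y i l - x) - (z - x) := by abel
          rw [h2, transv_sub g (y i l - x), h0, sub_zero]
        have h2 : ‖y i l - z‖ ≤ D i l := by
          rw [← dist_eq_norm, dist_edist]
          exact ENNReal.toReal_mono (hdt i l)
            (Metric.edist_le_ediam_of_mem (hy i l ⟨z, hz.1⟩) hz.1)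
        show ‖transv m g (y i l - x)‖ ≤ D i l
        rw [h1]
        exact (norm_transv_le g _).trans h2
      rw [indicator_of_mem hmem, Pi.one_apply, mul_one]
      exact ENNReal.rpow_le_rpow (Metric.ediam_mono inter_subset_left) hsm.le

/-- Almost every plane section through any point has dimension at most `s - m`. -/
theorem ae_dimH_section_le {n m : ℕ} (h : m < n) {s : ℝ} (hms : (m : ℝ) < s)
    {A : Set (E n)} (hfin : (Measure.hausdorffMeasure s : Measure (E n)) A < ∞) (x : E n) :
    ∀ᵐ g ∂haarO n, dimH (A ∩ {y | transv m g (y - x) = 0}) ≤ ENNReal.ofReal (s - m) := by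
  have hall : ∀ᵐ g ∂haarO n, ∀ N : ℕ, (Measure.hausdorffMeasure (s - m) : Measure (E n))
      ((A ∩ {y | 1 / ((N : ℝ) + 1) ≤ ‖y - x‖}) ∩ {y | transv m g (y - x) = 0}) < ∞ := by
    refine ae_all_iff.2 fun N => ae_hausdorffMeasure_section_lt_top h hms
      ((measure_mono inter_subset_left).trans_lt hfin) x (ε := 1 / ((N : ℝ) + 1)) (by positivity)
      fun y hy => hy.2
  filter_upwards [hall] with g hg
  -- The hitting estimate degenerates at `x`; that single point has dimension zero, and the
  -- remainder is exhausted by sets at positive distance from `x`.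
  have hsub : A ∩ {y | transv m g (y - x) = 0} ⊆ {x} ∪ ⋃ N : ℕ,
      (A ∩ {y | 1 / ((N : ℝ) + 1) ≤ ‖y - x‖}) ∩ {y | transv m g (y - x) = 0} := by
    intro y hy
    by_cases hyx : y = x
    · exact Or.inl hyx
    · obtain ⟨N, hN⟩ := exists_nat_one_div_lt (norm_pos_iff.2 (sub_ne_zero.2 hyx))
      exact Or.inr (mem_iUnion.2 ⟨N, ⟨hy.1, hN.le⟩, hy.2⟩)
  refine (dimH_mono hsub).trans ?_
  rw [dimH_union, dimH_singleton, dimH_iUnion]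
  refine max_le zero_le (iSup_le fun N => ?_)
  have h1 : ((s - m).toNNReal : ℝ) = s - m := Real.coe_toNNReal _ (sub_pos.2 hms).le
  refine dimH_le_of_hausdorffMeasure_ne_top (d := (s - m).toNNReal) ?_
  rw [h1]
  exact (hg N).ne

/-! ### Dyadic cubes and a lower bound for Hausdorff measure -/

/-- The dyadic cube of side `2⁻ᵏ` with index `q`. -/
def dyadicCube {n : ℕ} (k : ℕ) (q : Fin n → ℤ) : Set (E n) :=
  {y | ∀ i, ⌊(2 : ℝ) ^ k * y i⌋ = q i}

theorem measurableSet_dyadicCube {n : ℕ} (k : ℕ) (q : Fin n → ℤ) :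
    MeasurableSet (dyadicCube k q) := by
  have h : dyadicCube k q = ⋂ i, {y : E n | ⌊(2 : ℝ) ^ k * y i⌋ = q i} := by
    ext y; simp [dyadicCube]
  rw [h]
  refine MeasurableSet.iInter fun i => ?_
  have hm : Measurable fun y : E n => ⌊(2 : ℝ) ^ k * y i⌋ :=
    Int.measurable_floor.comp (by fun_prop)
  exact hm (measurableSet_singleton (q i))

theorem disjoint_dyadicCube {n : ℕ} (k : ℕ) {q q' : Fin n → ℤ} (h : q ≠ q') :
    Disjoint (dyadicCube k q) (dyadicCube k q') := by
  refine Set.disjoint_left.2 fun y hy hy' => h (funext fun i => ?_)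
  rw [← hy i, ← hy' i]

theorem norm_sub_le_of_mem_dyadicCube {n k : ℕ} {q : Fin n → ℤ} {y z : E n}
    (hy : y ∈ dyadicCube k q) (hz : z ∈ dyadicCube k q) : ‖y - z‖ ≤ √n * (1 / 2) ^ k := by
  have h2 : (0 : ℝ) < 2 ^ k := by positivity
  have hi : ∀ i, ‖(y - z) i‖ ≤ (1 / 2) ^ k := by
    intro i
    have h1 := Int.abs_sub_lt_one_of_floor_eq_floor ((hy i).trans (hz i).symm)
    rw [← mul_sub, abs_mul, abs_of_pos h2] at h1
    rw [PiLp.sub_apply, Real.norm_eq_abs, one_div, inv_pow, inv_eq_one_div, le_div_iff₀ h2]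
    linarith
  rw [EuclideanSpace.norm_eq]
  refine Real.sqrt_le_iff.2 ⟨by positivity, ?_⟩
  rw [mul_pow, Real.sq_sqrt (Nat.cast_nonneg n)]
  calc ∑ i, ‖(y - z) i‖ ^ 2 ≤ ∑ _i : Fin n, ((1 / 2 : ℝ) ^ k) ^ 2 :=
        Finset.sum_le_sum fun i _ => pow_le_pow_left₀ (norm_nonneg _) (hi i) 2
    _ = _ := by simp

/-- The indices of the cubes of level `k` near the point `y`. -/
def nearCubes {n : ℕ} (k : ℕ) (y : E n) : Finset (Fin n → ℤ) :=
  Fintype.piFinset fun i => Finset.Icc (⌊(2 : ℝ) ^ k * y i⌋ - 2) (⌊(2 : ℝ) ^ k * y i⌋ + 2)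

theorem card_nearCubes {n : ℕ} (k : ℕ) (y : E n) : (nearCubes k y).card = 5 ^ n := by
  rw [nearCubes, Fintype.card_piFinset]
  have : ∀ i : Fin n, (Finset.Icc (⌊(2 : ℝ) ^ k * y i⌋ - 2) (⌊(2 : ℝ) ^ k * y i⌋ + 2)).card = 5 := by
    intro i
    rw [Int.card_Icc]
    omega
  simp only [this, Finset.prod_const, Finset.card_univ, Fintype.card_fin]

/-- After scaling by `2 ^ k` the ball has radius `2`, so each integer part moves by at most `2`;
this explains the window in `nearCubes`. -/
theorem exists_mem_dyadicCube_of_mem_ball {n k : ℕ} {y z : E n}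
    (hz : z ∈ Metric.ball y (2 * (1 / 2) ^ k)) : ∃ q ∈ nearCubes k y, z ∈ dyadicCube k q := by
  refine ⟨fun i => ⌊(2 : ℝ) ^ k * z i⌋, ?_, fun i => rfl⟩
  rw [nearCubes, Fintype.mem_piFinset]
  intro i
  have h2 : (0 : ℝ) < 2 ^ k := by positivity
  have h1 : |z i - y i| < 2 * (1 / 2) ^ k := by
    have := PiLp.norm_apply_le (z - y) i
    rw [PiLp.sub_apply, Real.norm_eq_abs] at this
    exact this.trans_lt (by rw [← dist_eq_norm]; exact hz)
  have h3 : |(2 : ℝ) ^ k * z i - 2 ^ k * y i| < 2 := by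
    rw [← mul_sub, abs_mul, abs_of_pos h2]
    calc (2 : ℝ) ^ k * |z i - y i| < 2 ^ k * (2 * (1 / 2) ^ k) := by gcongr
      _ = 2 := by rw [mul_left_comm, ← mul_pow]; norm_num
  rw [abs_lt] at h3
  rw [Finset.mem_Icc]
  constructor
  · rw [Int.le_floor]
    push_cast
    linarith [Int.floor_le ((2 : ℝ) ^ k * y i)]
  · have h4 : ⌊(2 : ℝ) ^ k * z i⌋ < ⌊(2 : ℝ) ^ k * y i⌋ + 3 := by
      rw [Int.floor_lt]
      push_cast
      linarith [Int.lt_floor_add_one ((2 : ℝ) ^ k * y i)]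
    omega

/-- A Hausdorff null set is efficiently covered by balls of dyadic radii. -/
theorem exists_dyadic_ball_cover {n : ℕ} {t : ℝ} (ht : 0 < t) {S : Set (E n)}
    (hS : (Measure.hausdorffMeasure t : Measure (E n)) S = 0) {ε : ℝ} (hε : 0 < ε) :
    ∃ (y : ℕ → E n) (k : ℕ → ℕ), S ⊆ ⋃ i, Metric.ball (y i) (2 * (1 / 2) ^ k i) ∧
      ∑' i, ENNReal.ofReal (((1 / 2 : ℝ) ^ k i) ^ t) ≤ ENNReal.ofReal ε := by
  set ε' : ℝ := ε / 2 / 2 ^ t with hε'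
  have hε'0 : 0 < ε' := by positivity
  obtain ⟨T, hST, -, hTr, hTs⟩ := exists_cover_of_hausdorffMeasure_lt ht (S := S)
    (a := ENNReal.ofReal ε') (by rw [hS]; simpa using hε'0) (r := 1) one_pos
  have hTt : ∀ i, Metric.ediam (T i) ≠ ∞ := fun i => ne_top_of_le_ne_top ENNReal.one_ne_top (hTr i)
  have hex : ∀ i, ∃ (y : E n) (k : ℕ), T i ⊆ Metric.ball y (2 * (1 / 2) ^ k) ∧
      ENNReal.ofReal (((1 / 2 : ℝ) ^ k) ^ t) ≤
        ENNReal.ofReal (2 ^ t) * Metric.ediam (T i) ^ t + ENNReal.ofReal (ε / 2 / 2 / 2 ^ i) := by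
    intro i
    obtain ⟨y, hy⟩ : ∃ y : E n, T i ⊆ Metric.closedBall y (Metric.ediam (T i)).toReal := by
      rcases (T i).eq_empty_or_nonempty with he | ⟨y, hy⟩
      · exact ⟨0, by simp [he]⟩
      · refine ⟨y, fun z hz => ?_⟩
        rw [Metric.mem_closedBall, dist_edist]
        exact ENNReal.toReal_mono (hTt i) (Metric.edist_le_ediam_of_mem hz hy)
    set d := (Metric.ediam (T i)).toReal with hd
    have hdE : Metric.ediam (T i) = ENNReal.ofReal d := (ENNReal.ofReal_toReal (hTt i)).symm
    have hd1 : d ≤ 1 := by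
      have := ENNReal.toReal_mono ENNReal.one_ne_top (hTr i)
      simpa using this
    have hsub : ∀ k : ℕ, d ≤ (1 / 2) ^ k → T i ⊆ Metric.ball y (2 * (1 / 2) ^ k) := by
      intro k hk z hz
      have h1 := Metric.mem_closedBall.1 (hy hz)
      have h2 : (0 : ℝ) < (1 / 2) ^ k := by positivity
      rw [Metric.mem_ball]
      linarith
    -- A set of diameter zero still needs a ball of positive radius; its cost goes into the `i`-th
    -- term of a geometric series with sum `ε / 2`.
    rcases (show 0 ≤ d from ENNReal.toReal_nonneg).eq_or_lt with h0 | h0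
    · have hlim : Tendsto (fun k : ℕ => ((1 / 2 : ℝ) ^ k) ^ t) atTop (𝓝 0) := by
        have h1 := (tendsto_pow_atTop_nhds_zero_of_lt_one (r := (1 / 2 : ℝ)) (by norm_num)
          (by norm_num)).rpow_const (Or.inr ht.le)
        rwa [Real.zero_rpow ht.ne'] at h1
      obtain ⟨k, hk⟩ := (hlim.eventually_lt_const
        (show (0 : ℝ) < ε / 2 / 2 / 2 ^ i by positivity)).exists
      refine ⟨y, k, hsub k (by rw [← h0]; positivity), le_trans ?_ le_add_self⟩
      exact ENNReal.ofReal_le_ofReal hk.le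
    · obtain ⟨k, hk1, hk2⟩ := exists_nat_pow_near_of_lt_one h0 hd1
        (show (0 : ℝ) < 1 / 2 by norm_num) (by norm_num)
      refine ⟨y, k, hsub k hk2, le_trans ?_ le_self_add⟩
      rw [hdE, ENNReal.ofReal_rpow_of_pos h0, ← ENNReal.ofReal_mul (by positivity),
        ← Real.mul_rpow zero_le_two h0.le]
      refine ENNReal.ofReal_le_ofReal (Real.rpow_le_rpow (by positivity) ?_ ht.le)
      rw [pow_succ] at hk1
      linarith
  choose y k hyk hk using hex
  refine ⟨y, k, hST.trans (iUnion_mono hyk), ?_⟩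
  calc _ ≤ ∑' i, (ENNReal.ofReal (2 ^ t) * Metric.ediam (T i) ^ t +
        ENNReal.ofReal (ε / 2 / 2 / 2 ^ i)) := ENNReal.tsum_le_tsum hk
    _ = ENNReal.ofReal (2 ^ t) * ∑' i, Metric.ediam (T i) ^ t + ENNReal.ofReal (ε / 2) := by
        rw [ENNReal.tsum_add, ENNReal.tsum_mul_left, ← ENNReal.ofReal_tsum_of_nonneg
          (fun i => by positivity) (summable_geometric_two' _), tsum_geometric_two']
    _ ≤ ENNReal.ofReal (2 ^ t) * ENNReal.ofReal ε' + ENNReal.ofReal (ε / 2) := by gcongr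
    _ = ENNReal.ofReal ε := by
        rw [← ENNReal.ofReal_mul (by positivity), ← ENNReal.ofReal_add (by positivity)
          (by positivity)]
        congr 1
        rw [hε']
        field_simp
        ring

theorem sum_biUnion_le_of_nonneg {ι κ : Type*} [DecidableEq ι] [DecidableEq κ] (I : Finset ι)
    (T : ι → Finset κ) {f : κ → ℝ} (hf : ∀ x, 0 ≤ f x) :
    ∑ x ∈ I.biUnion T, f x ≤ ∑ i ∈ I, ∑ x ∈ T i, f x := by
  induction I using Finset.induction_on with
  | empty => simp
  | insert i I hi ih =>
    rw [Finset.biUnion_insert, Finset.sum_insert hi]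
    have h1 := Finset.sum_union_inter (s₁ := T i) (s₂ := I.biUnion T) (f := f)
    have h2 : 0 ≤ ∑ x ∈ T i ∩ I.biUnion T, f x := Finset.sum_nonneg fun x _ => hf x
    linarith

/-- A lower bound for Hausdorff measure by approximating measures with small `ℓ²` norms over the
dyadic cubes. -/
theorem hausdorffMeasure_ne_zero_of_dyadic_sq_sum_le {n : ℕ} {t : ℝ} (ht : 0 < t)
    {K S : Set (E n)} (hS : IsCompact S) {ν : ℕ → Measure (E n)}
    (hνf : ∀ j, IsFiniteMeasure (ν j)) (hνK : ∀ j, ν j Kᶜ = 0)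
    (hνS : ∀ U, IsOpen U → S ⊆ U → Tendsto (fun j => (ν j).real (K \ U)) atTop (𝓝 0))
    {c : ℝ} (hc : 0 < c) (hνc : ∀ᶠ j in atTop, c ≤ (ν j).real univ) {b : ℕ → ℝ}
    (hb : ∀ k, 0 ≤ b k) (hbs : Summable fun k => ((2 : ℝ) ^ k) ^ t * b k)
    (hsq : ∀ k j, k ≤ j → ∀ 𝒬 : Finset (Fin n → ℤ),
      ∑ q ∈ 𝒬, (ν j).real (dyadicCube k q) ^ 2 ≤ b k) :
    (Measure.hausdorffMeasure t : Measure (E n)) S ≠ 0 := by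
  classical
  intro hnull
  set B := ∑' k, ((2 : ℝ) ^ k) ^ t * b k with hB
  have hB0 : 0 ≤ B := tsum_nonneg fun k => mul_nonneg (by positivity) (hb k)
  -- Here `a` makes `B / (4 * a)` at most `c / 4`, and `ε` makes the cover contribute `c / 8`. With
  -- less than `c / 4` outside `U` the total mass stays below `c`, a contradiction.
  set a := B / c + 1 with ha
  have ha0 : 0 < a := by positivity
  have hBa : B / (4 * a) ≤ c / 4 := by
    rw [div_le_div_iff₀ (by positivity) (by positivity), ha]
    have : B = B / c * c := by field_simp
    nlinarith
  set ε := c / (8 * a * 5 ^ n) with hε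
  have hε0 : 0 < ε := by positivity
  obtain ⟨y, k, hcov, hsum⟩ := exists_dyadic_ball_cover ht hnull hε0
  obtain ⟨I, hI⟩ := hS.elim_finite_subcover (fun i => Metric.ball (y i) (2 * (1 / 2) ^ k i))
    (fun i => Metric.isOpen_ball) hcov
  set U := ⋃ i ∈ I, Metric.ball (y i) (2 * (1 / 2) ^ k i) with hU
  have hUo : IsOpen U := isOpen_biUnion fun i _ => Metric.isOpen_ball
  set 𝓕 : Finset (ℕ × (Fin n → ℤ)) :=
    I.biUnion fun i => (nearCubes (k i) (y i)).image fun q => (k i, q) with h𝓕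
  have hUcov : U ⊆ ⋃ p ∈ 𝓕, dyadicCube p.1 p.2 := by
    intro z hz
    obtain ⟨i, hi, hzi⟩ := mem_iUnion₂.1 hz
    obtain ⟨q, hq, hzq⟩ := exists_mem_dyadicCube_of_mem_ball hzi
    refine mem_iUnion₂.2 ⟨(k i, q), ?_, hzq⟩
    exact Finset.mem_biUnion.2 ⟨i, hi, Finset.mem_image.2 ⟨q, hq, rfl⟩⟩
  have hI' : ∑ i ∈ I, ((1 / 2 : ℝ) ^ k i) ^ t ≤ ε := by
    have h1 := (ENNReal.sum_le_tsum I).trans hsum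
    rw [← ENNReal.ofReal_sum_of_nonneg fun i _ => by positivity] at h1
    exact (ENNReal.ofReal_le_ofReal_iff hε0.le).1 h1
  have hF1 : ∑ p ∈ 𝓕, ((1 / 2 : ℝ) ^ p.1) ^ t ≤ 5 ^ n * ε := by
    calc ∑ p ∈ 𝓕, ((1 / 2 : ℝ) ^ p.1) ^ t
        ≤ ∑ i ∈ I, ∑ p ∈ (nearCubes (k i) (y i)).image (fun q => (k i, q)),
            ((1 / 2 : ℝ) ^ p.1) ^ t :=
          sum_biUnion_le_of_nonneg I _ fun p => by positivity
      _ = ∑ i ∈ I, 5 ^ n * ((1 / 2 : ℝ) ^ k i) ^ t := by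
          refine Finset.sum_congr rfl fun i _ => ?_
          rw [Finset.sum_image fun q _ q' _ h => (Prod.mk.inj h).2]
          simp only [Finset.sum_const, card_nearCubes, nsmul_eq_mul]
          push_cast
          rfl
      _ ≤ 5 ^ n * ε := by rw [← Finset.mul_sum]; gcongr
  -- Compactness leaves finitely many cubes, so their levels are bounded and `hsq` covers all of
  -- them once `j ≥ J`.
  obtain ⟨J, hJ⟩ : ∃ J, ∀ p ∈ 𝓕, p.1 ≤ J := ⟨𝓕.sup Prod.fst, fun p hp => Finset.le_sup hp⟩
  have hF2 : ∀ j, J ≤ j →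
      ∑ p ∈ 𝓕, ((2 : ℝ) ^ p.1) ^ t * (ν j).real (dyadicCube p.1 p.2) ^ 2 ≤ B := by
    intro j hj
    rw [← Finset.sum_fiberwise_of_maps_to (t := 𝓕.image Prod.fst) (g := Prod.fst)
      fun p hp => Finset.mem_image_of_mem _ hp]
    refine le_trans (Finset.sum_le_sum (g := fun k => ((2 : ℝ) ^ k) ^ t * b k) fun l hl => ?_)
      (hbs.sum_le_tsum _ fun k _ => mul_nonneg (by positivity) (hb k))
    obtain ⟨p₀, hp₀, rfl⟩ := Finset.mem_image.1 hl
    calc ∑ p ∈ 𝓕 with p.1 = p₀.1, ((2 : ℝ) ^ p.1) ^ t * (ν j).real (dyadicCube p.1 p.2) ^ 2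
        = ∑ p ∈ 𝓕 with p.1 = p₀.1,
            ((2 : ℝ) ^ p₀.1) ^ t * (ν j).real (dyadicCube p₀.1 p.2) ^ 2 := by
          refine Finset.sum_congr rfl fun p hp => ?_
          rw [(Finset.mem_filter.1 hp).2]
      _ = ((2 : ℝ) ^ p₀.1) ^ t * ∑ q ∈ (𝓕.filter fun p => p.1 = p₀.1).image Prod.snd,
            (ν j).real (dyadicCube p₀.1 q) ^ 2 := by
          rw [Finset.sum_image, Finset.mul_sum]
          intro p hp p' hp' h
          refine Prod.ext ?_ h
          rw [(Finset.mem_filter.1 hp).2, (Finset.mem_filter.1 hp').2]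
      _ ≤ ((2 : ℝ) ^ p₀.1) ^ t * b p₀.1 := by
          gcongr
          exact hsq _ _ ((hJ p₀ hp₀).trans hj) _
  obtain ⟨j, ⟨hj1, hj2⟩, hj3⟩ := ((hνc.and (eventually_ge_atTop J)).and
    ((hνS U hUo hI).eventually_lt_const (show 0 < c / 4 by positivity))).exists
  have hbound : (ν j).real univ ≤ (ν j).real (K \ U) +
      ∑ p ∈ 𝓕, (ν j).real (dyadicCube p.1 p.2) := by
    have h1 : (ν j).real univ ≤ (ν j).real (K \ U) + (ν j).real (⋃ p ∈ 𝓕, dyadicCube p.1 p.2) := by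
      have h2 : (ν j).real Kᶜ = 0 := by simp [Measure.real, hνK j]
      calc (ν j).real univ ≤ (ν j).real (Kᶜ ∪ ((K \ U) ∪ ⋃ p ∈ 𝓕, dyadicCube p.1 p.2)) := by
            refine measureReal_mono (fun z _ => ?_)
            by_cases hzK : z ∈ K
            · by_cases hzU : z ∈ U
              · exact Or.inr (Or.inr (hUcov hzU))
              · exact Or.inr (Or.inl ⟨hzK, hzU⟩)
            · exact Or.inl hzK
        _ ≤ (ν j).real Kᶜ + ((ν j).real (K \ U) + (ν j).real (⋃ p ∈ 𝓕, dyadicCube p.1 p.2)) :=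
            (measureReal_union_le _ _).trans (by gcongr; exact measureReal_union_le _ _)
        _ = _ := by rw [h2, zero_add]
    exact h1.trans (by gcongr; exact measureReal_biUnion_finset_le _ _)
  -- AM–GM trades the mass of a cube for its side to the power `t` plus its weighted squared mass.
  have hpt : ∀ p ∈ 𝓕, (ν j).real (dyadicCube p.1 p.2) ≤ a * ((1 / 2 : ℝ) ^ p.1) ^ t +
      (4 * a)⁻¹ * (((2 : ℝ) ^ p.1) ^ t * (ν j).real (dyadicCube p.1 p.2) ^ 2) := by
    intro p _
    set X := (ν j).real (dyadicCube p.1 p.2)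
    set e := ((2 : ℝ) ^ p.1) ^ t with he
    have he0 : 0 < e := by positivity
    have h1 : ((1 / 2 : ℝ) ^ p.1) ^ t = e⁻¹ := by
      rw [he, ← Real.inv_rpow (by positivity), one_div, inv_pow]
    rw [h1]
    have h2 : a * e⁻¹ + (4 * a)⁻¹ * (e * X ^ 2) - X = (2 * a - e * X) ^ 2 / (4 * a * e) := by
      field_simp; ring
    have h3 : 0 ≤ (2 * a - e * X) ^ 2 / (4 * a * e) := by positivity
    linarith
  have hfinal := Finset.sum_le_sum hpt
  rw [Finset.sum_add_distrib, ← Finset.mul_sum, ← Finset.mul_sum] at hfinal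
  have h1 : a * ∑ p ∈ 𝓕, ((1 / 2 : ℝ) ^ p.1) ^ t ≤ c / 8 := by
    calc a * ∑ p ∈ 𝓕, ((1 / 2 : ℝ) ^ p.1) ^ t ≤ a * (5 ^ n * ε) := by gcongr
      _ = c / 8 := by rw [hε]; field_simp
  have h2 : (4 * a)⁻¹ * ∑ p ∈ 𝓕, ((2 : ℝ) ^ p.1) ^ t * (ν j).real (dyadicCube p.1 p.2) ^ 2 ≤
      c / 4 := by
    calc _ ≤ (4 * a)⁻¹ * B := by gcongr; exact hF2 j hj2
      _ = B / (4 * a) := by rw [div_eq_inv_mul]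
      _ ≤ c / 4 := hBa
  linarith

/-! ### Equicontinuity in the transversal coordinate -/

namespace EquiUniformContinuous

variable {n m : ℕ} {f f' : O n × LastSpace n m → ℝ}

theorem add (hf : EquiUniformContinuous f) (hf' : EquiUniformContinuous f') :
    EquiUniformContinuous fun p => f p + f' p := by
  intro ε hε
  obtain ⟨η, hη, h⟩ := hf (ε / 2) (by positivity)
  obtain ⟨η', hη', h'⟩ := hf' (ε / 2) (by positivity)
  refine ⟨min η η', lt_min hη hη', fun g u v huv => ?_⟩
  have h1 := h g u v (huv.trans (min_le_left _ _))
  have h2 := h' g u v (huv.trans (min_le_right _ _))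
  rw [abs_le] at *
  constructor <;> linarith

theorem const_mul (hf : EquiUniformContinuous f) (c : ℝ) :
    EquiUniformContinuous fun p => c * f p := by
  intro ε hε
  obtain ⟨η, hη, h⟩ := hf (ε / (|c| + 1)) (by positivity)
  refine ⟨η, hη, fun g u v huv => ?_⟩
  rw [← mul_sub, abs_mul]
  have h1 := h g u v huv
  rw [le_div_iff₀ (by positivity)] at h1
  have h2 := abs_nonneg (f (g, u) - f (g, v))
  linarith

theorem abs_sub (hf : EquiUniformContinuous f) (hf' : EquiUniformContinuous f') :
    EquiUniformContinuous fun p => |f p - f' p| := by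
  intro ε hε
  obtain ⟨η, hη, h⟩ := hf.add (hf'.const_mul (-1)) ε hε
  refine ⟨η, hη, fun g u v huv => (abs_abs_sub_abs_le_abs_sub _ _).trans ?_⟩
  have h1 := h g u v huv
  rwa [show f (g, u) + -1 * f' (g, u) - (f (g, v) + -1 * f' (g, v)) =
    f (g, u) - f' (g, u) - (f (g, v) - f' (g, v)) by ring] at h1

theorem sum {ι : Type*} (I : Finset ι) {f : ι → O n × LastSpace n m → ℝ}
    (hf : ∀ i ∈ I, EquiUniformContinuous (f i)) :
    EquiUniformContinuous fun p => ∑ i ∈ I, f i p := by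
  classical
  induction I using Finset.induction_on with
  | empty => exact fun ε hε => ⟨1, one_pos, fun g u v _ => by simpa using hε.le⟩
  | insert i I hi ih =>
    simp only [Finset.sum_insert hi]
    exact (hf i (Finset.mem_insert_self i I)).add
      (ih fun j hj => hf j (Finset.mem_insert_of_mem hj))

end EquiUniformContinuous

/-- The reverse triangle inequality for the Euclidean norm, followed by `ℓ² ≤ ℓ¹`. -/
theorem abs_sqrt_sum_sq_sub_le {ι : Type*} (I : Finset ι) (a b : ι → ℝ) :
    |√(∑ i ∈ I, a i ^ 2) - √(∑ i ∈ I, b i ^ 2)| ≤ ∑ i ∈ I, |a i - b i| := by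
  have hn : ∀ c : ι → ℝ, √(∑ i ∈ I, c i ^ 2) =
      ‖(WithLp.toLp 2 fun i : I => c i : EuclideanSpace ℝ I)‖ := by
    intro c
    rw [EuclideanSpace.norm_eq, ← Finset.sum_coe_sort]
    simp
  rw [hn a, hn b]
  refine (abs_norm_sub_norm_le _ _).trans ?_
  rw [← WithLp.toLp_sub]
  have h1 := hn (fun i => a i - b i)
  refine (le_of_eq h1.symm).trans ?_
  refine Real.sqrt_le_iff.2 ⟨Finset.sum_nonneg fun i _ => abs_nonneg _, ?_⟩
  have h2 := Finset.sum_sq_le_sq_sum_of_nonneg (s := I) (f := fun i => |a i - b i|)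
    fun i _ => abs_nonneg _
  simpa only [sq_abs] using h2

theorem EquiUniformContinuous.sqrt_sum_sq {n m : ℕ} {ι : Type*} (I : Finset ι)
    {f : ι → O n × LastSpace n m → ℝ} (hf : ∀ i ∈ I, EquiUniformContinuous (f i)) :
    EquiUniformContinuous fun p => √(∑ i ∈ I, f i p ^ 2) := by
  intro ε hε
  have hex : ∀ i, ∃ η > 0, i ∈ I → ∀ (g : O n) (u v : LastSpace n m), dist u v ≤ η →
      |f i (g, u) - f i (g, v)| ≤ ε / (I.card + 1) := by
    intro i
    by_cases hi : i ∈ I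
    · obtain ⟨η, hη, h⟩ := hf i hi (ε / (I.card + 1)) (by positivity)
      exact ⟨η, hη, fun _ => h⟩
    · exact ⟨1, one_pos, fun h => absurd h hi⟩
  choose η hη h using hex
  obtain ⟨r, hr0, hr⟩ : ∃ r > 0, ∀ i ∈ I, r ≤ η i := by
    rcases I.eq_empty_or_nonempty with rfl | hne
    · exact ⟨1, one_pos, by simp⟩
    · exact ⟨I.inf' hne η, (Finset.lt_inf'_iff _).2 fun i _ => hη i, fun i hi =>
        Finset.inf'_le _ hi⟩
  refine ⟨r, hr0, fun g u v huv => (abs_sqrt_sum_sq_sub_le I _ _).trans ?_⟩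
  calc ∑ i ∈ I, |f i (g, u) - f i (g, v)| ≤ ∑ _i ∈ I, ε / (I.card + 1) :=
        Finset.sum_le_sum fun i hi => h i hi g u v (huv.trans (hr i hi))
    _ ≤ ε := by
        rw [Finset.sum_const, nsmul_eq_mul, mul_div_assoc', div_le_iff₀ (by positivity)]
        nlinarith

theorem uniformContinuous_gaussK {F : Type*} [NormedAddCommGroup F] [ProperSpace F] {m : ℕ}
    {σ : ℝ} (hσ : 0 < σ) : UniformContinuous (gaussK m σ : F → ℝ) := by
  refine (continuous_gaussK σ).uniformContinuous_of_tendsto_cocompact (x := 0) ?_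
  have h1 : Tendsto (fun v : F => ‖v‖ ^ 2 / σ ^ 2) (cocompact F) atTop :=
    ((tendsto_pow_atTop two_ne_zero).comp tendsto_norm_cocompact_atTop).atTop_div_const
      (by positivity)
  have h2 := (Real.tendsto_exp_neg_atTop_nhds_zero.comp h1).const_mul ((σ ^ m)⁻¹)
  rw [mul_zero] at h2
  exact h2

theorem equiUniformContinuous_smoothed {n m : ℕ} {μ : Measure (E n)} [IsFiniteMeasure μ] {δ : ℝ}
    (hδ : 0 < δ) : EquiUniformContinuous (smoothed m δ μ) := by
  intro ε hε
  obtain ⟨η, hη, h⟩ := Metric.uniformContinuous_iff.1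
    (uniformContinuous_gaussK (F := LastSpace n m) (m := m) hδ) (ε / (μ.real univ + 1))
    (by positivity)
  refine ⟨η / 2, by positivity, fun g u v huv => ?_⟩
  unfold smoothed
  rw [← integral_sub (integrable_gaussK_transv hδ (g, u)) (integrable_gaussK_transv hδ (g, v)),
    ← Real.norm_eq_abs]
  refine (norm_integral_le_of_norm_le_const (C := ε / (μ.real univ + 1))
    (Eventually.of_forall fun y => ?_)).trans ?_
  · rw [← dist_eq_norm]
    refine (h ?_).le
    rw [dist_sub_left]
    linarith
  · rw [div_mul_eq_mul_div, div_le_iff₀ (by positivity)]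
    nlinarith [measureReal_nonneg (μ := μ) (s := univ)]

/-! ### Energies of dyadic pieces and choice of scales -/

/-- Only finitely many dyadic cubes of a given level meet a bounded set. -/
theorem exists_finset_dyadicCube {n : ℕ} {K : Set (E n)} {R : ℝ}
    (hK : K ⊆ Metric.closedBall 0 R) (k : ℕ) :
    ∃ 𝒬 : Finset (Fin n → ℤ), ∀ y ∈ K, ∃ q ∈ 𝒬, y ∈ dyadicCube k q := by
  refine ⟨Fintype.piFinset fun _ => Finset.Icc ⌊-((2 : ℝ) ^ k * R)⌋ ⌊(2 : ℝ) ^ k * R⌋,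
    fun y hy => ⟨fun i => ⌊(2 : ℝ) ^ k * y i⌋, ?_, fun i => rfl⟩⟩
  rw [Fintype.mem_piFinset]
  intro i
  have h1 : |y i| ≤ R := by
    have h2 := PiLp.norm_apply_le y i
    exact h2.trans (mem_closedBall_zero_iff.1 (hK hy))
  have h2 : (0 : ℝ) < 2 ^ k := by positivity
  rw [abs_le] at h1
  rw [Finset.mem_Icc]
  constructor <;> refine Int.floor_le_floor ?_ <;> nlinarith

/-- The total `L²` norm of the smoothed projections of the dyadic pieces of a measure with growth
exponent `s > m`. -/
theorem exists_sum_lintegral_smoothed_dyadic_sq_le {n m : ℕ} (h : m < n) {s : ℝ}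
    (hms : (m : ℝ) < s) {μ : Measure (E n)} [IsFiniteMeasure μ] [NullSingletonClass μ]
    {C : ℝ} (hC : 0 ≤ C)
    (hμ : ∀ᵐ y ∂μ, ∀ r, 0 < r → μ (Metric.closedBall y r) ≤ ENNReal.ofReal (C * r ^ s)) :
    (∀ k q, rieszEnergy m (μ.restrict (dyadicCube k q)) ≠ ∞) ∧
    ∃ D : ℝ, 0 ≤ D ∧ ∀ (k : ℕ) (𝒬 : Finset (Fin n → ℤ)) (δ : ℝ), 0 < δ →
      ∑ q ∈ 𝒬, ∫⁻ p, ENNReal.ofReal (smoothed m δ (μ.restrict (dyadicCube k q)) p ^ 2)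
        ∂bundleMeasure n m ≤ ENNReal.ofReal (D * ((1 / 2 : ℝ) ^ k) ^ (s - m)) := by
  obtain ⟨P, hP, hpot⟩ := exists_lintegral_inv_pow_le hms
  obtain ⟨L, hL, hsm⟩ := exists_lintegral_smoothed_sq_le (n := n) h
  have hn : (0 : ℝ) < √n := Real.sqrt_pos.2 (by exact_mod_cast (by omega : 0 < n))
  have hen : ∀ k q, rieszEnergy m (μ.restrict (dyadicCube k q)) ≤
      ENNReal.ofReal (P * C * √n ^ (s - m) * ((1 / 2 : ℝ) ^ k) ^ (s - m)) *
        μ (dyadicCube k q) := by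
    intro k q
    have hin : ∀ᵐ y ∂μ.restrict (dyadicCube k q),
        ∫⁻ z, ENNReal.ofReal (‖y - z‖ ^ m)⁻¹ ∂μ.restrict (dyadicCube k q) ≤
        ENNReal.ofReal (P * C * √n ^ (s - m) * ((1 / 2 : ℝ) ^ k) ^ (s - m)) := by
      filter_upwards [ae_restrict_of_ae hμ, ae_restrict_mem (measurableSet_dyadicCube k q)]
        with y hy hyq
      -- The cube lies within `√n * (1 / 2) ^ k` of `y`; that radius to the power `s - m` is the
      -- gain in the potential bound.
      have h1 := hpot (μ.restrict (dyadicCube k q)) (fun z => ‖y - z‖) C (√n * (1 / 2) ^ k) hC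
        (by positivity) (by fun_prop) (fun z => norm_nonneg _) ?_ ?_
      · rwa [Real.mul_rpow hn.le (by positivity), ← mul_assoc] at h1
      · filter_upwards [ae_restrict_mem (measurableSet_dyadicCube k q)] with z hz
        exact norm_sub_le_of_mem_dyadicCube hyq hz
      · intro r hr _
        refine (Measure.restrict_apply_le _ _).trans ((measure_mono fun z hz => ?_).trans (hy r hr))
        rw [Metric.mem_closedBall, dist_comm, dist_eq_norm]
        exact hz
    refine (lintegral_mono_ae hin).trans (le_of_eq ?_)
    rw [lintegral_const, Measure.restrict_apply_univ]
  refine ⟨fun k q => ne_top_of_le_ne_top (ENNReal.mul_ne_top ENNReal.ofReal_ne_top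
    (measure_ne_top _ _)) (hen k q), L.toReal * (P * C * √n ^ (s - m)) * μ.real univ,
    by positivity, fun k 𝒬 δ hδ => ?_⟩
  calc _ ≤ ∑ q ∈ 𝒬, L * (ENNReal.ofReal (P * C * √n ^ (s - m) * ((1 / 2 : ℝ) ^ k) ^ (s - m)) *
        μ (dyadicCube k q)) :=
        Finset.sum_le_sum fun q _ => (hsm _ δ hδ).trans (by gcongr; exact hen k q)
    _ = L * (ENNReal.ofReal (P * C * √n ^ (s - m) * ((1 / 2 : ℝ) ^ k) ^ (s - m)) *
        μ (⋃ q ∈ 𝒬, dyadicCube k q)) := by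
        rw [measure_biUnion_finset (fun q _ q' _ hne => disjoint_dyadicCube k hne)
          fun q _ => measurableSet_dyadicCube k q, Finset.mul_sum, Finset.mul_sum]
    _ ≤ L * (ENNReal.ofReal (P * C * √n ^ (s - m) * ((1 / 2 : ℝ) ^ k) ^ (s - m)) *
        μ univ) := by gcongr; exact subset_univ _
    _ = _ := by
        rw [← ENNReal.ofReal_toReal hL, ← ENNReal.ofReal_toReal (measure_ne_top μ univ),
          ← ENNReal.ofReal_mul (by positivity), ← ENNReal.ofReal_mul (by positivity)]
        congr 1
        simp only [Measure.real, ENNReal.toReal_ofReal ENNReal.toReal_nonneg]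
        ring

/-- The running minimum of `r`, divided by `j + 2`, tends to zero. Both `δ j` and `δ (j + 1)` must
lie below `r j`, being the scales compared in the `j`-th increment. -/
theorem exists_scales {r : ℕ → ℝ} (hr : ∀ j, 0 < r j) : ∃ δ : ℕ → ℝ, (∀ j, 0 < δ j) ∧
    Tendsto δ atTop (𝓝 0) ∧ ∀ j, δ j < r j ∧ δ (j + 1) < r j := by
  set ρ : ℕ → ℝ := fun j => (Finset.range (j + 1)).inf' ⟨0, by simp⟩ r with hρ
  have hρ0 : ∀ j, 0 < ρ j := fun j => (Finset.lt_inf'_iff _).2 fun i _ => hr i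
  have hρr : ∀ i j, i ≤ j → ρ j ≤ r i := fun i j hij =>
    Finset.inf'_le _ (Finset.mem_range.2 (by omega))
  have hlt : ∀ j, ρ j / ((j : ℝ) + 2) < ρ j := fun j => by
    rw [div_lt_iff₀ (by positivity)]
    have : (0 : ℝ) ≤ j := Nat.cast_nonneg j
    nlinarith [hρ0 j]
  refine ⟨fun j => ρ j / ((j : ℝ) + 2), fun j => div_pos (hρ0 j) (by positivity), ?_, fun j =>
    ⟨(hlt j).trans_le (hρr j j le_rfl), (hlt (j + 1)).trans_le (hρr j (j + 1) (by omega))⟩⟩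
  have h1 := (tendsto_one_div_add_atTop_nhds_zero_nat (𝕜 := ℝ)).const_mul (r 0)
  rw [mul_zero] at h1
  refine squeeze_zero (fun j => (div_pos (hρ0 j) (by positivity)).le) (fun j => ?_) h1
  rw [mul_one_div]
  have := hρ0 j
  have := hρr 0 j (Nat.zero_le j)
  have := (hr 0).le
  gcongr
  norm_num

theorem summable_one_div_add_one_pow {p : ℕ} (hp : 1 < p) :
    Summable fun j : ℕ => 1 / ((j : ℝ) + 1) ^ p := by
  have h := (summable_nat_add_iff 1).2 (Real.summable_one_div_nat_pow.2 hp)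
  simpa using h

/-! ### The exceptional set -/

theorem measurable_lintegral_transv {n m : ℕ} {f : O n × LastSpace n m → ℝ} (hf : Measurable f) :
    Measurable fun x : E n => ∫⁻ g, ENNReal.ofReal (f (g, transv m g x)) ∂haarO n := by
  have h : Measurable fun q : O n × E n => ENNReal.ofReal (f (q.1, transv m q.1 q.2)) :=
    (hf.comp (measurable_fst.prodMk continuous_transv.measurable)).ennreal_ofReal
  exact h.lintegral_prod_left'

/-- A sequence of functions of rapidly decreasing `L²` norms has small averages outside a Borel set
of dimension at most `m`. -/
theorem exists_exceptional_set {n m : ℕ} (h : m < n) {F : ℕ → O n × LastSpace n m → ℝ}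
    (hFm : ∀ j, Measurable (F j)) (hF0 : ∀ j p, 0 ≤ F j p)
    (hFu : ∀ j, EquiUniformContinuous (F j)) {C : ℝ} (hC : 0 ≤ C)
    (hF2 : ∀ j, ∫⁻ p, ENNReal.ofReal (F j p ^ 2) ∂bundleMeasure n m ≤
      ENNReal.ofReal (C / ((j : ℝ) + 1) ^ 8)) :
    ∃ B : Set (E n), MeasurableSet B ∧ dimH B ≤ (m : ℝ≥0∞) ∧ ∀ x ∉ B, ∀ᶠ j in atTop,
      ∫⁻ g, ENNReal.ofReal (F j (g, transv m g x)) ∂haarO n ≤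
        ENNReal.ofReal (1 / ((j : ℝ) + 1) ^ 2) := by
  set S : ℕ → Set (E n) := fun j => {x | ENNReal.ofReal (1 / ((j : ℝ) + 1) ^ 2) <
    ∫⁻ g, ENNReal.ofReal (F j (g, transv m g x)) ∂haarO n} with hS
  have hSm : ∀ j, MeasurableSet (S j) := fun j =>
    measurableSet_lt measurable_const (measurable_lintegral_transv (hFm j))
  refine ⟨limsup S atTop, MeasurableSet.measurableSet_limsup hSm, ?_, fun x hx => ?_⟩
  · refine dimH_le fun d hd => ?_
    by_contra! hlt
    have hmd : (m : ℝ) < d := by exact_mod_cast hlt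
    have hd0 : (0 : ℝ) < d := lt_of_le_of_lt (Nat.cast_nonneg m) hmd
    have hnull : ∀ N : ℕ, (Measure.hausdorffMeasure (d : ℝ) : Measure (E n))
        (limsup (fun j : ℕ => {x | x ∈ Metric.closedBall (0 : E n) ((N : ℝ) + 1) ∧
          ENNReal.ofReal (1 / ((j : ℝ) + 1) ^ 2) <
            ∫⁻ g, ENNReal.ofReal (F j (g, transv m g x)) ∂haarO n}) atTop) = 0 := by
      intro N
      obtain ⟨M, hM, hMF⟩ := exists_hContent_le h hmd (R := (N : ℝ) + 1) (by positivity)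
      refine hausdorffMeasure_eq_zero_of_hContent hd0 (measure_limsup_atTop_eq_zero ?_)
      -- The squared threshold costs `(j + 1) ^ 4` out of the decay `(j + 1) ^ (-8)`, leaving a
      -- summable bound for Borel–Cantelli.
      have hbd : ∀ j : ℕ, hContent n d {x | x ∈ Metric.closedBall (0 : E n) ((N : ℝ) + 1) ∧
          ENNReal.ofReal (1 / ((j : ℝ) + 1) ^ 2) <
            ∫⁻ g, ENNReal.ofReal (F j (g, transv m g x)) ∂haarO n} ≤
          ENNReal.ofReal (M * C * (1 / ((j : ℝ) + 1) ^ 4)) := by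
        intro j
        refine (hMF (F j) (hFm j) (hF0 j) (hFu j) _ (by positivity)).trans ?_
        refine (mul_le_mul_right (hF2 j) _).trans (le_of_eq ?_)
        rw [← ENNReal.ofReal_mul (by positivity)]
        congr 1
        field_simp
      refine ne_top_of_le_ne_top ?_ (ENNReal.tsum_le_tsum hbd)
      rw [← ENNReal.ofReal_tsum_of_nonneg (fun j => by positivity)
        ((summable_one_div_add_one_pow (by norm_num)).mul_left _)]
      exact ENNReal.ofReal_ne_top
    have hsub : limsup S atTop ⊆ ⋃ N : ℕ, limsup (fun j : ℕ =>
        {x | x ∈ Metric.closedBall (0 : E n) ((N : ℝ) + 1) ∧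
          ENNReal.ofReal (1 / ((j : ℝ) + 1) ^ 2) <
            ∫⁻ g, ENNReal.ofReal (F j (g, transv m g x)) ∂haarO n}) atTop := by
      intro x hx
      obtain ⟨N, hN⟩ := exists_nat_ge ‖x‖
      refine mem_iUnion.2 ⟨N, ?_⟩
      rw [mem_limsup_iff_frequently_mem] at hx ⊢
      exact hx.mono fun j hj => ⟨mem_closedBall_zero_iff.2 (by linarith), hj⟩
    have h0 := measure_mono_null hsub (measure_iUnion_null hnull)
    rw [h0] at hd
    simp at hd
  · rw [mem_limsup_iff_frequently_mem, not_frequently] at hx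
    exact hx.mono fun j hj => not_lt.1 hj

/-! ### The control function and its `L²` norm -/

section Control

variable {n : ℕ} (m : ℕ) (s : ℝ) (μ : Measure (E n)) (𝒬 : ℕ → Finset (Fin n → ℤ)) (δ : ℕ → ℝ)

/-- The smoothed projection at the scale `δ j` of the part of `μ` in a dyadic cube. -/
def pieceDensity (j k : ℕ) (q : Fin n → ℤ) (p : O n × LastSpace n m) : ℝ :=
  smoothed m (δ j) (μ.restrict (dyadicCube k q)) p

/-- The total change of the densities of the pieces of levels up to `j` between consecutive
scales. -/
def increment (j : ℕ) (p : O n × LastSpace n m) : ℝ :=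
  ∑ a ∈ (Finset.range (j + 1)).sigma 𝒬,
    |pieceDensity m μ δ (j + 1) a.1 a.2 p - pieceDensity m μ δ j a.1 a.2 p|

/-- The `ℓ²` norm of the densities of the pieces of level `j`. -/
def levelNorm (j : ℕ) (p : O n × LastSpace n m) : ℝ :=
  √(∑ q ∈ 𝒬 j, pieceDensity m μ δ j j q p ^ 2)

/-- The weight attached to level `j`. -/
def levelWeight (j : ℕ) : ℝ := ((2 : ℝ) ^ j) ^ ((s - m) / 2)

/-- The quantity controlling both the convergence of the densities and their energy. -/
def sliceControl (j : ℕ) (p : O n × LastSpace n m) : ℝ :=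
  levelWeight m s j * increment m μ 𝒬 δ j p +
    levelWeight m s j / ((j : ℝ) + 1) ^ 4 * levelNorm m μ 𝒬 δ j p

end Control

section ControlLemmas

variable {n m : ℕ} {s : ℝ} {μ : Measure (E n)} {𝒬 : ℕ → Finset (Fin n → ℤ)} {δ : ℕ → ℝ}

theorem levelWeight_pos (j : ℕ) : 0 < levelWeight m s j := by
  unfold levelWeight; positivity

theorem levelWeight_sq (j : ℕ) : levelWeight m s j ^ 2 = ((2 : ℝ) ^ j) ^ (s - m) := by
  rw [levelWeight, ← Real.rpow_natCast, ← Real.rpow_mul (by positivity)]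
  congr 1
  push_cast
  ring

theorem levelWeight_mono (hms : (m : ℝ) < s) {i j : ℕ} (hij : i ≤ j) :
    levelWeight m s i ≤ levelWeight m s j := by
  unfold levelWeight
  refine Real.rpow_le_rpow (by positivity) (pow_le_pow_right₀ one_le_two hij) (by linarith)

theorem one_le_levelWeight (hms : (m : ℝ) < s) (j : ℕ) : 1 ≤ levelWeight m s j := by
  have h := levelWeight_mono hms (Nat.zero_le j)
  simpa [levelWeight] using h

theorem measurable_pieceDensity [IsFiniteMeasure μ] (j k : ℕ) (q : Fin n → ℤ) :
    Measurable (pieceDensity m μ δ j k q) := measurable_smoothed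

theorem increment_nonneg (j : ℕ) (p : O n × LastSpace n m) : 0 ≤ increment m μ 𝒬 δ j p :=
  Finset.sum_nonneg fun _ _ => abs_nonneg _

theorem measurable_increment [IsFiniteMeasure μ] (j : ℕ) : Measurable (increment m μ 𝒬 δ j) := by
  unfold increment
  refine Finset.measurable_fun_sum _ fun a _ => ?_
  have h1 := measurable_pieceDensity (m := m) (μ := μ) (δ := δ) (j + 1) a.1 a.2
  have h2 := measurable_pieceDensity (m := m) (μ := μ) (δ := δ) j a.1 a.2
  fun_prop

theorem measurable_levelNorm [IsFiniteMeasure μ] (j : ℕ) : Measurable (levelNorm m μ 𝒬 δ j) := by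
  unfold levelNorm
  refine (Finset.measurable_fun_sum _ fun q _ => ?_).sqrt
  exact (measurable_pieceDensity j j q).pow_const 2

theorem measurable_sliceControl [IsFiniteMeasure μ] (j : ℕ) : Measurable (sliceControl m s μ 𝒬 δ j) :=
  ((measurable_increment j).const_mul _).add ((measurable_levelNorm j).const_mul _)

theorem sliceControl_nonneg (j : ℕ) (p : O n × LastSpace n m) : 0 ≤ sliceControl m s μ 𝒬 δ j p := by
  have h1 := increment_nonneg (μ := μ) (𝒬 := 𝒬) (δ := δ) j p
  have h2 : 0 ≤ levelNorm m μ 𝒬 δ j p := Real.sqrt_nonneg _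
  have h3 := (levelWeight_pos (m := m) (s := s) j).le
  unfold sliceControl
  positivity

theorem weight_mul_increment_le_sliceControl (j : ℕ) (p : O n × LastSpace n m) :
    levelWeight m s j * increment m μ 𝒬 δ j p ≤ sliceControl m s μ 𝒬 δ j p := by
  have h2 : 0 ≤ levelNorm m μ 𝒬 δ j p := Real.sqrt_nonneg _
  have h3 := (levelWeight_pos (m := m) (s := s) j).le
  refine le_add_of_nonneg_right (by positivity)

theorem weight_mul_levelNorm_le_sliceControl (j : ℕ) (p : O n × LastSpace n m) :
    levelWeight m s j / ((j : ℝ) + 1) ^ 4 * levelNorm m μ 𝒬 δ j p ≤ sliceControl m s μ 𝒬 δ j p := by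
  have h1 := increment_nonneg (μ := μ) (𝒬 := 𝒬) (δ := δ) j p
  have h3 := (levelWeight_pos (m := m) (s := s) j).le
  refine le_add_of_nonneg_left (by positivity)

theorem equiUniformContinuous_sliceControl [IsFiniteMeasure μ] (hδ : ∀ j, 0 < δ j) (j : ℕ) :
    EquiUniformContinuous (sliceControl m s μ 𝒬 δ j) := by
  refine EquiUniformContinuous.add (EquiUniformContinuous.const_mul ?_ _)
    (EquiUniformContinuous.const_mul ?_ _)
  · exact EquiUniformContinuous.sum _ fun a _ =>
      (equiUniformContinuous_smoothed (hδ _)).abs_sub (equiUniformContinuous_smoothed (hδ _))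
  · exact EquiUniformContinuous.sqrt_sum_sq _ fun q _ => equiUniformContinuous_smoothed (hδ _)

/-- The scales can be chosen so sparse that the increments are as small as desired in `L²`. -/
theorem exists_scales_increment_le [IsFiniteMeasure μ] [NullSingletonClass μ] (h : m < n)
    (hE : ∀ k q, rieszEnergy m (μ.restrict (dyadicCube k q)) ≠ ∞) (𝒬 : ℕ → Finset (Fin n → ℤ))
    {η : ℕ → ℝ} (hη : ∀ j, 0 < η j) : ∃ δ : ℕ → ℝ, (∀ j, 0 < δ j) ∧ Tendsto δ atTop (𝓝 0) ∧
      ∀ j, ∫⁻ p, ENNReal.ofReal (increment m μ 𝒬 δ j p ^ 2) ∂bundleMeasure n m ≤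
        ENNReal.ofReal (η j) := by
  set I : ℕ → Finset (Σ _ : ℕ, Fin n → ℤ) := fun j => (Finset.range (j + 1)).sigma 𝒬 with hI
  -- One factor of the cardinality is lost to Cauchy–Schwarz, the other to the number of summands.
  set κ : ℕ → ℝ := fun j => η j / (((I j).card : ℝ) + 1) ^ 2 with hκ
  have hκ0 : ∀ j, 0 < κ j := fun j => div_pos (hη j) (by positivity)
  have hex : ∀ j (a : Σ _ : ℕ, Fin n → ℤ), ∃ r : ℝ, 0 < r ∧ ∀ d e : ℝ, 0 < d → d < r → 0 < e →
      e < r → ∫⁻ p, ENNReal.ofReal ((smoothed m d (μ.restrict (dyadicCube a.1 a.2)) p -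
        smoothed m e (μ.restrict (dyadicCube a.1 a.2)) p) ^ 2) ∂bundleMeasure n m ≤
          ENNReal.ofReal (κ j) := fun j a =>
    exists_lintegral_smoothed_sub_sq_le h (hE a.1 a.2) (ENNReal.ofReal_pos.2 (hκ0 j))
  choose r hr0 hr using hex
  have hmin : ∀ j, ∃ ρ : ℝ, 0 < ρ ∧ ∀ a ∈ I j, ρ ≤ r j a := by
    intro j
    rcases (I j).eq_empty_or_nonempty with he | hne
    · exact ⟨1, one_pos, by simp [he]⟩
    · exact ⟨(I j).inf' hne (r j), (Finset.lt_inf'_iff _).2 fun a _ => hr0 j a,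
        fun a ha => Finset.inf'_le _ ha⟩
  choose ρ hρ0 hρ using hmin
  obtain ⟨δ, hδ0, hδt, hδ⟩ := exists_scales hρ0
  refine ⟨δ, hδ0, hδt, fun j => ?_⟩
  have hms : ∀ a : Σ _ : ℕ, Fin n → ℤ, Measurable fun p : O n × LastSpace n m =>
      ENNReal.ofReal ((pieceDensity m μ δ (j + 1) a.1 a.2 p -
        pieceDensity m μ δ j a.1 a.2 p) ^ 2) := fun a =>
    (((measurable_pieceDensity _ _ _).sub (measurable_pieceDensity _ _ _)).pow_const
      2).ennreal_ofReal
  calc ∫⁻ p, ENNReal.ofReal (increment m μ 𝒬 δ j p ^ 2) ∂bundleMeasure n m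
      ≤ ∫⁻ p, ENNReal.ofReal ((I j).card : ℝ) * ∑ a ∈ I j, ENNReal.ofReal
          ((pieceDensity m μ δ (j + 1) a.1 a.2 p - pieceDensity m μ δ j a.1 a.2 p) ^ 2)
            ∂bundleMeasure n m := by
        refine lintegral_mono fun p => ?_
        rw [← ENNReal.ofReal_sum_of_nonneg fun a _ => sq_nonneg _,
          ← ENNReal.ofReal_mul (Nat.cast_nonneg _)]
        refine ENNReal.ofReal_le_ofReal ?_
        refine sq_sum_le_card_mul_sum_sq.trans (le_of_eq ?_)
        simp only [sq_abs]
        rfl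
    _ = ENNReal.ofReal ((I j).card : ℝ) * ∑ a ∈ I j, ∫⁻ p, ENNReal.ofReal
          ((pieceDensity m μ δ (j + 1) a.1 a.2 p - pieceDensity m μ δ j a.1 a.2 p) ^ 2)
            ∂bundleMeasure n m := by
        rw [lintegral_const_mul' _ _ ENNReal.ofReal_ne_top,
          lintegral_finsetSum _ fun a _ => hms a]
    _ ≤ ENNReal.ofReal ((I j).card : ℝ) * ∑ a ∈ I j, ENNReal.ofReal (κ j) := by
        gcongr with a ha
        exact hr j a _ _ (hδ0 _) ((hδ j).2.trans_le (hρ j a ha)) (hδ0 _)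
          ((hδ j).1.trans_le (hρ j a ha))
    _ ≤ ENNReal.ofReal (η j) := by
        rw [Finset.sum_const, nsmul_eq_mul, ← ENNReal.ofReal_natCast,
          ← ENNReal.ofReal_mul (by positivity), ← ENNReal.ofReal_mul (by positivity)]
        refine ENNReal.ofReal_le_ofReal ?_
        simp only [hκ]
        rw [mul_div_assoc', mul_div_assoc', div_le_iff₀ (by positivity)]
        have h1 : (0 : ℝ) ≤ (I j).card := Nat.cast_nonneg _
        have h2 := hη j
        nlinarith [mul_nonneg h1 h2.le]

/-- The scales make the increments small enough to absorb the weight, and the squared weight exactly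
cancels the decay of the level norms; the extra factor `(j + 1) ^ (-4)` supplies the rate. -/
theorem lintegral_sliceControl_sq_le [IsFiniteMeasure μ] {D : ℝ} (hD : 0 ≤ D) (hδ : ∀ j, 0 < δ j)
    (hlev : ∀ (k : ℕ) (𝒯 : Finset (Fin n → ℤ)) (ε : ℝ), 0 < ε →
      ∑ q ∈ 𝒯, ∫⁻ p, ENNReal.ofReal (smoothed m ε (μ.restrict (dyadicCube k q)) p ^ 2)
        ∂bundleMeasure n m ≤ ENNReal.ofReal (D * ((1 / 2 : ℝ) ^ k) ^ (s - m)))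
    (j : ℕ) (hinc : ∫⁻ p, ENNReal.ofReal (increment m μ 𝒬 δ j p ^ 2) ∂bundleMeasure n m ≤
      ENNReal.ofReal (1 / (levelWeight m s j ^ 2 * ((j : ℝ) + 1) ^ 8))) :
    ∫⁻ p, ENNReal.ofReal (sliceControl m s μ 𝒬 δ j p ^ 2) ∂bundleMeasure n m ≤
      ENNReal.ofReal ((2 + 2 * D) / ((j : ℝ) + 1) ^ 8) := by
  have hW := levelWeight_pos (m := m) (s := s) j
  set W := levelWeight m s j with hWdef
  have hlevel : ∫⁻ p, ENNReal.ofReal (levelNorm m μ 𝒬 δ j p ^ 2) ∂bundleMeasure n m ≤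
      ENNReal.ofReal (D / W ^ 2) := by
    have h1 : ∀ p : O n × LastSpace n m, ENNReal.ofReal (levelNorm m μ 𝒬 δ j p ^ 2) =
        ∑ q ∈ 𝒬 j, ENNReal.ofReal (pieceDensity m μ δ j j q p ^ 2) := by
      intro p
      rw [levelNorm, Real.sq_sqrt (Finset.sum_nonneg fun q _ => sq_nonneg _),
        ENNReal.ofReal_sum_of_nonneg fun q _ => sq_nonneg _]
    simp only [h1]
    rw [lintegral_finsetSum _ fun q _ =>
      ((measurable_pieceDensity j j q).pow_const 2).ennreal_ofReal]
    refine (hlev j (𝒬 j) (δ j) (hδ j)).trans (ENNReal.ofReal_le_ofReal (le_of_eq ?_))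
    rw [hWdef, levelWeight_sq, one_div, inv_pow, Real.inv_rpow (by positivity), div_eq_mul_inv]
  calc ∫⁻ p, ENNReal.ofReal (sliceControl m s μ 𝒬 δ j p ^ 2) ∂bundleMeasure n m
      ≤ ∫⁻ p, (ENNReal.ofReal (2 * W ^ 2) * ENNReal.ofReal (increment m μ 𝒬 δ j p ^ 2) +
          ENNReal.ofReal (2 * (W / ((j : ℝ) + 1) ^ 4) ^ 2) *
            ENNReal.ofReal (levelNorm m μ 𝒬 δ j p ^ 2)) ∂bundleMeasure n m := by
        refine lintegral_mono fun p => ?_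
        rw [← ENNReal.ofReal_mul (by positivity), ← ENNReal.ofReal_mul (by positivity),
          ← ENNReal.ofReal_add (by positivity) (by positivity)]
        refine ENNReal.ofReal_le_ofReal ?_
        rw [sliceControl, ← hWdef]
        nlinarith [sq_nonneg (W * increment m μ 𝒬 δ j p -
          W / ((j : ℝ) + 1) ^ 4 * levelNorm m μ 𝒬 δ j p)]
    _ = ENNReal.ofReal (2 * W ^ 2) *
          ∫⁻ p, ENNReal.ofReal (increment m μ 𝒬 δ j p ^ 2) ∂bundleMeasure n m +
        ENNReal.ofReal (2 * (W / ((j : ℝ) + 1) ^ 4) ^ 2) *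
          ∫⁻ p, ENNReal.ofReal (levelNorm m μ 𝒬 δ j p ^ 2) ∂bundleMeasure n m := by
        rw [lintegral_add_left (((measurable_increment j).pow_const 2).ennreal_ofReal.const_mul _),
          lintegral_const_mul' _ _ ENNReal.ofReal_ne_top,
          lintegral_const_mul' _ _ ENNReal.ofReal_ne_top]
    _ ≤ ENNReal.ofReal (2 * W ^ 2) * ENNReal.ofReal (1 / (W ^ 2 * ((j : ℝ) + 1) ^ 8)) +
        ENNReal.ofReal (2 * (W / ((j : ℝ) + 1) ^ 4) ^ 2) * ENNReal.ofReal (D / W ^ 2) := by gcongr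
    _ = _ := by
        rw [← ENNReal.ofReal_mul (by positivity), ← ENNReal.ofReal_mul (by positivity),
          ← ENNReal.ofReal_add (by positivity) (by positivity)]
        congr 1
        field_simp

end ControlLemmas

/-! ### Lower bound for the dimension of a single section -/

section Slices

variable {n m : ℕ} {s : ℝ} {μ : Measure (E n)} {𝒬 : ℕ → Finset (Fin n → ℤ)} {δ : ℕ → ℝ}
  {K : Set (E n)}

/-- The measure `μ` weighted by the Gaussian kernel centred at the fibre `p`. -/
def sliceMeasure (m : ℕ) (ε : ℝ) (μ : Measure (E n)) (p : O n × LastSpace n m) :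
    Measure (E n) :=
  μ.withDensity fun y => ENNReal.ofReal (gaussK m ε (transv m p.1 y - p.2))

theorem sliceMeasure_apply [IsFiniteMeasure μ] {ε : ℝ} (hε : 0 < ε) (p : O n × LastSpace n m)
    {A : Set (E n)} (hA : MeasurableSet A) :
    sliceMeasure m ε μ p A = ENNReal.ofReal (smoothed m ε (μ.restrict A) p) := by
  rw [sliceMeasure, withDensity_apply _ hA, ofReal_smoothed hε]

theorem sliceMeasure_real_apply [IsFiniteMeasure μ] {ε : ℝ} (hε : 0 < ε)
    (p : O n × LastSpace n m) {A : Set (E n)} (hA : MeasurableSet A) :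
    (sliceMeasure m ε μ p).real A = smoothed m ε (μ.restrict A) p := by
  rw [Measure.real, sliceMeasure_apply hε p hA, ENNReal.toReal_ofReal (smoothed_nonneg hε p)]

theorem isFiniteMeasure_sliceMeasure [IsFiniteMeasure μ] {ε : ℝ} (hε : 0 < ε)
    (p : O n × LastSpace n m) : IsFiniteMeasure (sliceMeasure m ε μ p) :=
  ⟨by rw [sliceMeasure_apply hε p MeasurableSet.univ]; exact ENNReal.ofReal_lt_top⟩

theorem sliceMeasure_null {ε : ℝ} (p : O n × LastSpace n m) {A : Set (E n)} (hA : μ A = 0) :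
    sliceMeasure m ε μ p A = 0 := withDensity_absolutelyContinuous _ _ hA

/-- Since `exp x ≥ x ^ (m + 1) / (m + 1)!`, the expression is at most a constant times `δ j ^ (m +
2)`. -/
theorem tendsto_gaussK_bound (hδ : ∀ j, 0 < δ j) (hδt : Tendsto δ atTop (𝓝 0)) {η : ℝ}
    (hη : 0 < η) :
    Tendsto (fun j => (δ j ^ m)⁻¹ * Real.exp (-(η ^ 2 / δ j ^ 2))) atTop (𝓝 0) := by
  have h1 : Tendsto (fun j => ((m + 1).factorial : ℝ) / η ^ (2 * m + 2) * δ j ^ (m + 2)) atTop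
      (𝓝 0) := by
    have := (hδt.pow (m + 2)).const_mul (((m + 1).factorial : ℝ) / η ^ (2 * m + 2))
    simpa using this
  refine squeeze_zero (fun j => by have := hδ j; positivity) (fun j => ?_) h1
  have hd := hδ j
  have h2 := Real.pow_div_factorial_le_exp (η ^ 2 / δ j ^ 2) (by positivity) (m + 1)
  rw [Real.exp_neg]
  have h3 : (Real.exp (η ^ 2 / δ j ^ 2))⁻¹ ≤
      ((η ^ 2 / δ j ^ 2) ^ (m + 1) / (m + 1).factorial)⁻¹ :=
    inv_anti₀ (by positivity) h2
  refine (mul_le_mul_of_nonneg_left h3 (by positivity)).trans (le_of_eq ?_)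
  have h4 : δ j ^ (m + 2) * δ j ^ m = (δ j ^ 2) ^ (m + 1) := by ring
  have h5 : η ^ (2 * m + 2) = (η ^ 2) ^ (m + 1) := by ring
  rw [inv_div, div_pow, h5]
  field_simp
  rw [← h4]
  ring

theorem continuous_transv_right (g : O n) (x : E n) :
    Continuous fun y : E n => transv m g (y - x) := by
  have h : Continuous (transv m g) :=
    (lastProj n m).continuous.comp ((star g : O n) : E n →L[ℝ] E n).continuous
  exact h.comp (continuous_id.sub continuous_const)

/-- The weighted measures concentrate on the fibre. -/
theorem tendsto_sliceMeasure_diff [IsFiniteMeasure μ] (hK : IsCompact K) (hδ : ∀ j, 0 < δ j)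
    (hδt : Tendsto δ atTop (𝓝 0)) (g : O n) (x : E n) {U : Set (E n)} (hU : IsOpen U)
    (hKU : K ∩ {y | transv m g (y - x) = 0} ⊆ U) :
    Tendsto (fun j => (sliceMeasure m (δ j) μ (g, transv m g x)).real (K \ U)) atTop (𝓝 0) := by
  have hc := (continuous_transv_right (m := m) g x).norm
  have hKd : IsCompact (K \ U) := hK.diff hU
  rcases (K \ U).eq_empty_or_nonempty with he | hne
  · simp [he]
  obtain ⟨y₀, hy₀, hmin⟩ := hKd.exists_isMinOn hne hc.continuousOn
  set η := ‖transv m g (y₀ - x)‖ with hη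
  have hη0 : 0 < η := norm_pos_iff.2 fun h0 => hy₀.2 (hKU ⟨hy₀.1, h0⟩)
  have h1 := (tendsto_gaussK_bound (m := m) hδ hδt hη0).mul_const (μ.real (K \ U))
  rw [zero_mul] at h1
  refine squeeze_zero (fun j => measureReal_nonneg) (fun j => ?_) h1
  rw [sliceMeasure_real_apply (hδ j) _ hKd.measurableSet, smoothed]
  have hb : ∀ y ∈ K \ U, gaussK m (δ j) (transv m g y - transv m g x) ≤
      (δ j ^ m)⁻¹ * Real.exp (-(η ^ 2 / δ j ^ 2)) := by
    intro y hy
    rw [← transv_sub, gaussK]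
    have hd := hδ j
    have hle : η ≤ ‖transv m g (y - x)‖ := hmin hy
    gcongr
  calc _ ≤ ∫ _ in K \ U, (δ j ^ m)⁻¹ * Real.exp (-(η ^ 2 / δ j ^ 2)) ∂μ := by
        refine setIntegral_mono_on (integrable_gaussK_transv (hδ j) (g, transv m g x)).integrableOn
          (integrable_const _).integrableOn hKd.measurableSet hb
    _ = _ := by simp [mul_comm]

theorem sum_abs_sub_le_increment {k j : ℕ} (hkj : k ≤ j) (p : O n × LastSpace n m) :
    ∑ q ∈ 𝒬 k, |pieceDensity m μ δ (j + 1) k q p - pieceDensity m μ δ j k q p| ≤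
      increment m μ 𝒬 δ j p := by
  rw [increment, Finset.sum_sigma]
  exact Finset.single_le_sum (f := fun k => ∑ q ∈ 𝒬 k,
    |pieceDensity m μ δ (j + 1) k q p - pieceDensity m μ δ j k q p|)
    (fun i _ => Finset.sum_nonneg fun _ _ => abs_nonneg _) (Finset.mem_range.2 (by omega))

/-- At scale `δ k` the level-`k` pieces are bounded by one term of the control. Passing to `δ j`
costs the increments from `k` to `j - 1`, all of weight at least that of level `k`; so the bound is
uniform in `j`. -/
theorem sum_sq_pieceDensity_le (hms : (m : ℝ) < s) (p : O n × LastSpace n m)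
    (hsum : Summable fun j => sliceControl m s μ 𝒬 δ j p) {k j : ℕ} (hkj : k ≤ j) :
    ∑ q ∈ 𝒬 k, pieceDensity m μ δ j k q p ^ 2 ≤
      4 * (∑' i, sliceControl m s μ 𝒬 δ i p) ^ 2 * ((k : ℝ) + 1) ^ 8 /
        levelWeight m s k ^ 2 := by
  set M := ∑' i, sliceControl m s μ 𝒬 δ i p with hM
  set W := levelWeight m s k with hW
  have hW0 : 0 < W := levelWeight_pos k
  have hM0 : 0 ≤ M := tsum_nonneg fun i => sliceControl_nonneg i p
  have hlev : ∑ q ∈ 𝒬 k, pieceDensity m μ δ k k q p ^ 2 ≤ (M * ((k : ℝ) + 1) ^ 4 / W) ^ 2 := by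
    have h1 : levelNorm m μ 𝒬 δ k p ≤ M * ((k : ℝ) + 1) ^ 4 / W := by
      have h2 := (weight_mul_levelNorm_le_sliceControl (s := s) (μ := μ) (𝒬 := 𝒬) (δ := δ)
        k p).trans (hsum.le_tsum k fun i _ => sliceControl_nonneg i p)
      rw [le_div_iff₀ hW0]
      rw [div_mul_eq_mul_div, div_le_iff₀ (by positivity)] at h2
      linarith
    have h3 := pow_le_pow_left₀ (Real.sqrt_nonneg _) h1 2
    rwa [Real.sq_sqrt (Finset.sum_nonneg fun q _ => sq_nonneg _)] at h3
  have habs : ∑ q ∈ 𝒬 k, |pieceDensity m μ δ j k q p - pieceDensity m μ δ k k q p| ≤ M / W := by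
    calc ∑ q ∈ 𝒬 k, |pieceDensity m μ δ j k q p - pieceDensity m μ δ k k q p|
        ≤ ∑ q ∈ 𝒬 k, ∑ i ∈ Finset.Ico k j,
          |pieceDensity m μ δ (i + 1) k q p - pieceDensity m μ δ i k q p| := by
          refine Finset.sum_le_sum fun q _ => ?_
          rw [← Finset.sum_Ico_sub (fun i => pieceDensity m μ δ i k q p) hkj]
          exact Finset.abs_sum_le_sum_abs _ _
      _ ≤ ∑ i ∈ Finset.Ico k j, increment m μ 𝒬 δ i p := by
          rw [Finset.sum_comm]
          exact Finset.sum_le_sum fun i hi =>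
            sum_abs_sub_le_increment (Finset.mem_Ico.1 hi).1 p
      _ ≤ ∑ i ∈ Finset.Ico k j, sliceControl m s μ 𝒬 δ i p / W := by
          refine Finset.sum_le_sum fun i hi => ?_
          rw [le_div_iff₀ hW0, mul_comm]
          refine le_trans ?_ (weight_mul_increment_le_sliceControl i p)
          exact mul_le_mul_of_nonneg_right (levelWeight_mono hms (Finset.mem_Ico.1 hi).1)
            (increment_nonneg i p)
      _ ≤ M / W := by
          rw [← Finset.sum_div]
          gcongr
          exact hsum.sum_le_tsum _ fun i _ => sliceControl_nonneg i p
  have hsq : ∑ q ∈ 𝒬 k, (pieceDensity m μ δ j k q p - pieceDensity m μ δ k k q p) ^ 2 ≤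
      (M / W) ^ 2 := by
    refine le_trans ?_ (pow_le_pow_left₀ (Finset.sum_nonneg fun _ _ => abs_nonneg _) habs 2)
    simp only [← sq_abs (pieceDensity m μ δ j k _ p - pieceDensity m μ δ k k _ p)]
    exact Finset.sum_sq_le_sq_sum_of_nonneg fun _ _ => abs_nonneg _
  have h1 : (1 : ℝ) ≤ ((k : ℝ) + 1) ^ 8 :=
    one_le_pow₀ (by linarith [(Nat.cast_nonneg k : (0 : ℝ) ≤ k)])
  calc ∑ q ∈ 𝒬 k, pieceDensity m μ δ j k q p ^ 2
      ≤ ∑ q ∈ 𝒬 k, (2 * pieceDensity m μ δ k k q p ^ 2 +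
          2 * (pieceDensity m μ δ j k q p - pieceDensity m μ δ k k q p) ^ 2) :=
        Finset.sum_le_sum fun q _ => by
          nlinarith [sq_nonneg (2 * pieceDensity m μ δ k k q p - pieceDensity m μ δ j k q p)]
    _ ≤ 2 * (M * ((k : ℝ) + 1) ^ 4 / W) ^ 2 + 2 * (M / W) ^ 2 := by
        rw [Finset.sum_add_distrib, ← Finset.mul_sum, ← Finset.mul_sum]
        gcongr
    _ ≤ 2 * (M * ((k : ℝ) + 1) ^ 4 / W) ^ 2 + 2 * ((M / W) ^ 2 * ((k : ℝ) + 1) ^ 8) := by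
        gcongr
        exact le_mul_of_one_le_right (by positivity) h1
    _ = _ := by ring

theorem dyadicCube_subset_compl {k : ℕ} {𝒯 : Finset (Fin n → ℤ)}
    (h𝒯 : ∀ y ∈ K, ∃ q ∈ 𝒯, y ∈ dyadicCube k q) {q : Fin n → ℤ} (hq : q ∉ 𝒯) :
    dyadicCube k q ⊆ Kᶜ := by
  intro y hy hyK
  obtain ⟨q', hq', hy'⟩ := h𝒯 y hyK
  have hne : q ≠ q' := fun h => hq (h ▸ hq')
  exact (disjoint_dyadicCube k hne).le_bot ⟨hy, hy'⟩

theorem smoothed_eq_sum_pieceDensity [IsFiniteMeasure μ] (hμK : μ Kᶜ = 0) (hδ : ∀ j, 0 < δ j)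
    (h𝒬 : ∀ y ∈ K, ∃ q ∈ 𝒬 0, y ∈ dyadicCube 0 q) (j : ℕ) (p : O n × LastSpace n m) :
    smoothed m (δ j) μ p = ∑ q ∈ 𝒬 0, pieceDensity m μ δ j 0 q p := by
  have : IsFiniteMeasure (sliceMeasure m (δ j) μ p) := isFiniteMeasure_sliceMeasure (hδ j) p
  have h1 : (sliceMeasure m (δ j) μ p).real univ =
      (sliceMeasure m (δ j) μ p).real (⋃ q ∈ 𝒬 0, dyadicCube 0 q) := by
    refine measureReal_congr (ae_eq_univ.2 ?_).symm
    have hsub : (⋃ q ∈ 𝒬 0, dyadicCube 0 q)ᶜ ⊆ Kᶜ := by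
      intro y hy hyK
      obtain ⟨q, hq, hyq⟩ := h𝒬 y hyK
      exact hy (mem_iUnion₂.2 ⟨q, hq, hyq⟩)
    exact sliceMeasure_null p (measure_mono_null hsub hμK)
  rw [sliceMeasure_real_apply (hδ j) p MeasurableSet.univ, Measure.restrict_univ,
    measureReal_biUnion_finset (fun q _ q' _ hne => disjoint_dyadicCube 0 hne)
      fun q _ => measurableSet_dyadicCube 0 q] at h1
  rw [h1]
  exact Finset.sum_congr rfl fun q _ =>
    sliceMeasure_real_apply (hδ j) p (measurableSet_dyadicCube 0 q)

/-- For `t < s - m` the terms are a polynomial times a geometric sequence of ratio `2 ^ (t - (s -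
m)) < 1`. -/
theorem summable_levelWeight_bound {t : ℝ} (ht : t < s - m) (M : ℝ) :
    Summable fun k : ℕ => ((2 : ℝ) ^ k) ^ t *
      (4 * M ^ 2 * ((k : ℝ) + 1) ^ 8 / levelWeight m s k ^ 2) := by
  set r : ℝ := (2 : ℝ) ^ (t - (s - m)) with hr
  have hr0 : 0 < r := by positivity
  have hr1 : r < 1 := Real.rpow_lt_one_of_one_lt_of_neg one_lt_two (by linarith)
  have h1 : Summable fun k : ℕ => (k : ℝ) ^ 8 * r ^ k :=
    summable_pow_mul_geometric_of_norm_lt_one 8 (by rwa [Real.norm_of_nonneg hr0.le])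
  have h2 := ((summable_nat_add_iff 1).2 h1).mul_left (4 * M ^ 2 * r⁻¹)
  refine h2.congr fun k => ?_
  have hpow : ∀ a : ℝ, ((2 : ℝ) ^ k) ^ a = ((2 : ℝ) ^ a) ^ k := fun a => by
    rw [← Real.rpow_natCast, ← Real.rpow_mul zero_le_two, mul_comm,
      Real.rpow_mul zero_le_two, Real.rpow_natCast]
  have h3 : r = (2 : ℝ) ^ t / (2 : ℝ) ^ (s - m) := Real.rpow_sub two_pos _ _
  rw [levelWeight_sq, hpow, hpow, pow_succ, Nat.cast_add, Nat.cast_one]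
  have h4 : r⁻¹ * r = 1 := inv_mul_cancel₀ hr0.ne'
  calc _ = (r⁻¹ * r) * (4 * M ^ 2 * ((k : ℝ) + 1) ^ 8 * r ^ k) := by ring
    _ = 4 * M ^ 2 * ((k : ℝ) + 1) ^ 8 * (((2 : ℝ) ^ t) ^ k / ((2 : ℝ) ^ (s - m)) ^ k) := by
        rw [h4, one_mul, h3, div_pow]
    _ = _ := by ring

theorem sum_sq_sliceMeasure_le [IsFiniteMeasure μ] (hms : (m : ℝ) < s) (hμK : μ Kᶜ = 0)
    (h𝒬 : ∀ k, ∀ y ∈ K, ∃ q ∈ 𝒬 k, y ∈ dyadicCube k q) (hδ : ∀ j, 0 < δ j)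
    (p : O n × LastSpace n m) (hsum : Summable fun j => sliceControl m s μ 𝒬 δ j p) {k j : ℕ}
    (hkj : k ≤ j) (𝒯 : Finset (Fin n → ℤ)) :
    ∑ q ∈ 𝒯, (sliceMeasure m (δ j) μ p).real (dyadicCube k q) ^ 2 ≤
      4 * (∑' i, sliceControl m s μ 𝒬 δ i p) ^ 2 * ((k : ℝ) + 1) ^ 8 /
        levelWeight m s k ^ 2 := by
  classical
  refine le_trans ?_ (sum_sq_pieceDensity_le hms p hsum hkj)
  calc ∑ q ∈ 𝒯, (sliceMeasure m (δ j) μ p).real (dyadicCube k q) ^ 2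
      = ∑ q ∈ 𝒯 ∩ 𝒬 k, (sliceMeasure m (δ j) μ p).real (dyadicCube k q) ^ 2 := by
        refine (Finset.sum_subset Finset.inter_subset_left fun q hq hq' => ?_).symm
        have hq2 : q ∉ 𝒬 k := fun h => hq' (Finset.mem_inter.2 ⟨hq, h⟩)
        have h0 := sliceMeasure_null (m := m) (ε := δ j) p
          (measure_mono_null (dyadicCube_subset_compl (h𝒬 k) hq2) hμK)
        rw [Measure.real, h0]
        simp
    _ ≤ ∑ q ∈ 𝒬 k, (sliceMeasure m (δ j) μ p).real (dyadicCube k q) ^ 2 :=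
        Finset.sum_le_sum_of_subset_of_nonneg Finset.inter_subset_right
          fun _ _ _ => sq_nonneg _
    _ = ∑ q ∈ 𝒬 k, pieceDensity m μ δ j k q p ^ 2 := by
        refine Finset.sum_congr rfl fun q _ => ?_
        rw [sliceMeasure_real_apply (hδ j) p (measurableSet_dyadicCube k q)]
        rfl

/-- A fibre along which the control is summable and the densities do not vanish in the limit meets
`K` in a set of dimension at least `s - m`. -/
theorem le_dimH_slice [IsFiniteMeasure μ] (hms : (m : ℝ) < s) (hK : IsCompact K)
    (hμK : μ Kᶜ = 0) (h𝒬 : ∀ k, ∀ y ∈ K, ∃ q ∈ 𝒬 k, y ∈ dyadicCube k q) (hδ : ∀ j, 0 < δ j)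
    (hδt : Tendsto δ atTop (𝓝 0)) (g : O n) (x : E n)
    (hsum : Summable fun j => sliceControl m s μ 𝒬 δ j (g, transv m g x)) {c : ℝ} (hc : 0 < c)
    (hlim : Tendsto (fun j => smoothed m (δ j) μ (g, transv m g x)) atTop (𝓝 c)) :
    ENNReal.ofReal (s - m) ≤ dimH (K ∩ {y | transv m g (y - x) = 0}) := by
  have hct := continuous_transv_right (m := m) g x
  have hcl : IsClosed {y : E n | transv m g (y - x) = 0} := isClosed_eq hct continuous_const
  have hmass : ∀ᶠ j in atTop,
      c / 2 ≤ (sliceMeasure m (δ j) μ (g, transv m g x)).real univ := by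
    filter_upwards [hlim.eventually (eventually_ge_nhds (half_lt_self hc))] with j hj
    rwa [sliceMeasure_real_apply (hδ j) _ MeasurableSet.univ, Measure.restrict_univ]
  -- Exponents strictly below `s - m` suffice, and only for those does the dyadic series converge.
  refine ENNReal.le_of_forall_nnreal_lt fun d hd => ?_
  rw [ENNReal.lt_ofReal_iff_toReal_lt ENNReal.coe_ne_top, ENNReal.coe_toReal] at hd
  rcases eq_or_lt_of_le (zero_le (a := d)) with h0 | h0
  · simp [← h0]
  have hcpt := hK.inter_right hcl
  have hf := fun j => isFiniteMeasure_sliceMeasure (μ := μ) (hδ j) (g, transv m g x)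
  have hnull := fun j => sliceMeasure_null (ε := δ j) (g, transv m g x) hμK
  have hconc := fun U (hU : IsOpen U) (hSU : K ∩ {y | transv m g (y - x) = 0} ⊆ U) =>
    tendsto_sliceMeasure_diff (μ := μ) hK hδ hδt g x hU hSU
  have hbs := summable_levelWeight_bound hd (∑' i, sliceControl m s μ 𝒬 δ i (g, transv m g x))
  have hsq := fun (k j : ℕ) (hkj : k ≤ j) => sum_sq_sliceMeasure_le hms hμK h𝒬 hδ _ hsum hkj
  exact le_dimH_of_hausdorffMeasure_ne_zero
    (hausdorffMeasure_ne_zero_of_dyadic_sq_sum_le (NNReal.coe_pos.2 h0) hcpt hf hnull hconc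
      (half_pos hc) hmass (fun k => by positivity) hbs hsq)

end Slices

/-! ### Positively many large sections -/

section PositiveSlices

variable {n m : ℕ} {s : ℝ} {μ : Measure (E n)} {𝒬 : ℕ → Finset (Fin n → ℤ)} {δ : ℕ → ℝ}
  {K : Set (E n)}

theorem lintegral_smoothed_transv [IsFiniteMeasure μ] {ε : ℝ} (hε : 0 < ε) (x : E n) :
    ∫⁻ g, ENNReal.ofReal (smoothed m ε μ (g, transv m g x)) ∂haarO n =
      ∫⁻ y, avgKernel n m ε (y - x) ∂μ := by
  have hct : Continuous fun q : O n × E n => transv m q.1 (q.2 - x) := by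
    have h : Continuous fun q : O n × E n => (q.1, q.2 - x) := by fun_prop
    have h2 := (continuous_transv (n := n) (m := m)).comp h
    exact h2
  have hm : Measurable fun q : O n × E n =>
      ENNReal.ofReal (gaussK m ε (transv m q.1 (q.2 - x))) :=
    ((continuous_gaussK ε).comp hct).measurable.ennreal_ofReal
  simp only [ofReal_smoothed hε, ← transv_sub, avgKernel]
  exact lintegral_lintegral_swap hm.aemeasurable

/-- The averages of the densities over the fibres through a point do not tend to zero. -/
theorem not_tendsto_lintegral_smoothed [IsFiniteMeasure μ] [NullSingletonClass μ] (h : m < n)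
    (hμ : μ ≠ 0) (hδ : ∀ j, 0 < δ j) (hδt : Tendsto δ atTop (𝓝 0)) (x : E n) :
    ¬ Tendsto (fun j => ∫⁻ g, ENNReal.ofReal (smoothed m (δ j) μ (g, transv m g x)) ∂haarO n)
      atTop (𝓝 0) := by
  intro ht
  obtain ⟨C, hC, c, hc0, hct, hle, hlim⟩ := exists_avgKernel_asymptotics h
  simp only [lintegral_smoothed_transv (hδ _)] at ht
  have hδ' : Tendsto δ atTop (𝓝[>] 0) :=
    tendsto_nhdsWithin_iff.2 ⟨hδt, Eventually.of_forall hδ⟩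
  have hm : ∀ j, Measurable fun y : E n => avgKernel n m (δ j) (y - x) := fun j =>
    (measurable_avgKernel _).comp (measurable_id.sub_const x)
  -- If the averages tended to zero, Fatou would make the positive limiting kernel at `y - x` vanish
  -- for almost every `y ≠ x`, against `μ ≠ 0`.
  have hfatou := lintegral_liminf_le (μ := μ) (u := atTop) hm
  rw [ht.liminf_eq, nonpos_iff_eq_zero] at hfatou
  have hz := (lintegral_eq_zero_iff (.liminf hm)).1 hfatou
  have hne : ∀ᵐ y ∂μ, y ≠ x := compl_mem_ae_iff.2 (measure_singleton x)
  have hF : ∀ᵐ y ∂μ, False := by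
    filter_upwards [hz, hne] with y hy hyx
    have hyx' : y - x ≠ 0 := sub_ne_zero.2 hyx
    have h1 := ((hlim (y - x) hyx').comp hδ').liminf_eq
    have h2 : c * ENNReal.ofReal (‖y - x‖ ^ m)⁻¹ = 0 := h1.symm.trans hy
    have h3 : 0 < ‖y - x‖ := norm_pos_iff.2 hyx'
    have h4 : (0 : ℝ) < (‖y - x‖ ^ m)⁻¹ := by positivity
    exact mul_ne_zero hc0.ne' (ENNReal.ofReal_pos.2 h4).ne' h2
  rw [eventually_false_iff_eq_bot, ae_eq_bot] at hF
  exact hμ hF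

theorem abs_smoothed_sub_le_sliceControl [IsFiniteMeasure μ] (hms : (m : ℝ) < s)
    (hμK : μ Kᶜ = 0) (h𝒬 : ∀ y ∈ K, ∃ q ∈ 𝒬 0, y ∈ dyadicCube 0 q) (hδ : ∀ j, 0 < δ j) (j : ℕ)
    (p : O n × LastSpace n m) :
    |smoothed m (δ (j + 1)) μ p - smoothed m (δ j) μ p| ≤ sliceControl m s μ 𝒬 δ j p := by
  rw [smoothed_eq_sum_pieceDensity hμK hδ h𝒬, smoothed_eq_sum_pieceDensity hμK hδ h𝒬,
    ← Finset.sum_sub_distrib]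
  refine (Finset.abs_sum_le_sum_abs _ _).trans
    ((sum_abs_sub_le_increment (Nat.zero_le j) p).trans ?_)
  refine le_trans ?_ (weight_mul_increment_le_sliceControl j p)
  exact le_mul_of_one_le_left (increment_nonneg j p) (one_le_levelWeight hms j)

/-- If the averages of the control over the fibres through `x` are summable, then a set of fibres
of positive measure meets `K` in dimension at least `s - m`. -/
theorem not_ae_dimH_slice_lt [IsFiniteMeasure μ] [NullSingletonClass μ] (h : m < n)
    (hms : (m : ℝ) < s) (hK : IsCompact K) (hμ : μ ≠ 0) (hμK : μ Kᶜ = 0)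
    (h𝒬 : ∀ k, ∀ y ∈ K, ∃ q ∈ 𝒬 k, y ∈ dyadicCube k q) (hδ : ∀ j, 0 < δ j)
    (hδt : Tendsto δ atTop (𝓝 0)) (x : E n) (N : ℕ)
    (hfin : ∑' j, ∫⁻ g, ENNReal.ofReal (sliceControl m s μ 𝒬 δ (j + N) (g, transv m g x)) ∂haarO n
      ≠ ∞) :
    ¬ ∀ᵐ g ∂haarO n, ¬ ENNReal.ofReal (s - m) ≤ dimH (K ∩ {y | transv m g (y - x) = 0}) := by
  intro hbad
  set f : ℕ → O n → ℝ := fun j g => sliceControl m s μ 𝒬 δ j (g, transv m g x) with hf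
  have hf0 : ∀ j g, 0 ≤ f j g := fun j g => sliceControl_nonneg j _
  have hfm : ∀ j, Measurable fun g => ENNReal.ofReal (f j g) := fun j =>
    ((measurable_sliceControl j).comp
      (measurable_id.prodMk (measurable_transv_left x))).ennreal_ofReal
  have hae : ∀ᵐ g ∂haarO n, ∑' j, ENNReal.ofReal (f (j + N) g) < ∞ := by
    refine ae_lt_top (Measurable.tsum fun j => hfm _) ?_
    rwa [lintegral_tsum fun j => (hfm _).aemeasurable]
  have hbound : ∀ᵐ g ∂haarO n, ∀ j,
      ENNReal.ofReal (smoothed m (δ (j + N)) μ (g, transv m g x)) ≤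
        ∑' i, ENNReal.ofReal (f (i + j + N) g) := by
    filter_upwards [hae, hbad] with g hg hgbad j
    have hsumN : Summable fun j => f (j + N) g := by
      have h1 := ENNReal.summable_toReal hg.ne
      exact h1.congr fun j => ENNReal.toReal_ofReal (hf0 _ g)
    have hsum : Summable fun j => f j g := (summable_nat_add_iff N).1 hsumN
    have hd : ∀ j, dist (smoothed m (δ j) μ (g, transv m g x))
        (smoothed m (δ j.succ) μ (g, transv m g x)) ≤ f j g := fun j => by
      rw [dist_comm, Real.dist_eq]
      exact abs_smoothed_sub_le_sliceControl hms hμK (h𝒬 0) hδ j _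
    obtain ⟨L, hL⟩ := cauchySeq_tendsto_of_complete (cauchySeq_of_dist_le_of_summable _ hd hsum)
    have hL0 : 0 ≤ L := ge_of_tendsto' hL fun j => smoothed_nonneg (hδ j) _
    -- A positive limit would give a section of dimension at least `s - m`, which `hgbad` excludes.
    -- With limit zero, each density is bounded by the tail of the control.
    have hLz : L = 0 := by
      by_contra hne
      exact hgbad (le_dimH_slice hms hK hμK h𝒬 hδ hδt g x hsum
        (lt_of_le_of_ne hL0 (Ne.symm hne)) hL)
    have hdist := dist_le_tsum_of_dist_le_of_tendsto _ hd hsum hL (j + N)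
    rw [hLz, dist_zero_right, Real.norm_of_nonneg (smoothed_nonneg (hδ _) _)] at hdist
    refine (ENNReal.ofReal_le_ofReal hdist).trans (le_of_eq ?_)
    have hs' : Summable fun i => f (j + N + i) g :=
      ((summable_nat_add_iff (j + N)).2 hsum).congr fun i => by rw [add_comm]
    rw [ENNReal.ofReal_tsum_of_nonneg (fun i => hf0 _ g) hs']
    exact tsum_congr fun i => by rw [show j + N + i = i + j + N by ring]
  have ht : Tendsto (fun j => ∑' i, ∫⁻ g, ENNReal.ofReal (f (i + j + N) g) ∂haarO n) atTop
      (𝓝 0) :=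
    ENNReal.tendsto_sum_nat_add (fun j => ∫⁻ g, ENNReal.ofReal (f (j + N) g) ∂haarO n) hfin
  refine not_tendsto_lintegral_smoothed h hμ hδ hδt x ((tendsto_add_atTop_iff_nat N).1 ?_)
  refine tendsto_of_tendsto_of_tendsto_of_le_of_le tendsto_const_nhds ht (fun j => zero_le)
    fun j => ?_
  refine (lintegral_mono_ae (hbound.mono fun g hg => hg j)).trans (le_of_eq ?_)
  exact lintegral_tsum fun i => (hfm _).aemeasurable

/-- For a nonzero measure of growth exponent `s` on a compact set `K`, positively many fibres
through any point outside a Borel set of dimension at most `m` meet `K` in dimension at least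
`s - m`. -/
theorem exists_exceptional_set_slices [IsFiniteMeasure μ] [NullSingletonClass μ] (h : m < n)
    (hms : (m : ℝ) < s) (hK : IsCompact K) (hμ : μ ≠ 0) (hμK : μ Kᶜ = 0) {C : ℝ} (hC : 0 ≤ C)
    (hgrowth : ∀ᵐ y ∂μ, ∀ r > 0, μ (Metric.closedBall y r) ≤ ENNReal.ofReal (C * r ^ s)) :
    ∃ B : Set (E n), MeasurableSet B ∧ dimH B ≤ (m : ℝ≥0∞) ∧ ∀ x ∉ B, ¬ ∀ᵐ g ∂haarO n,
      ¬ ENNReal.ofReal (s - m) ≤ dimH (K ∩ {y | transv m g (y - x) = 0}) := by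
  obtain ⟨R, hR⟩ := hK.isBounded.subset_closedBall 0
  choose 𝒬 h𝒬 using fun k => exists_finset_dyadicCube hR k
  obtain ⟨hE, D, hD, hlev⟩ := exists_sum_lintegral_smoothed_dyadic_sq_le h hms hC hgrowth
  obtain ⟨δ, hδ, hδt, hinc⟩ := exists_scales_increment_le h hE 𝒬
    (η := fun j => 1 / (levelWeight m s j ^ 2 * ((j : ℝ) + 1) ^ 8)) fun j => by
      have := levelWeight_pos (m := m) (s := s) j
      positivity
  obtain ⟨B, hBm, hBd, hB⟩ := exists_exceptional_set h
    (F := sliceControl m s μ 𝒬 δ) measurable_sliceControl sliceControl_nonneg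
    (equiUniformContinuous_sliceControl hδ) (C := 2 + 2 * D) (by positivity)
    fun j => lintegral_sliceControl_sq_le hD hδ hlev j (hinc j)
  refine ⟨B, hBm, hBd, fun x hx => ?_⟩
  -- The averages are bounded only from some index on; the finitely many earlier ones are dropped by
  -- the shift `N`.
  obtain ⟨N, hN⟩ := eventually_atTop.1 (hB x hx)
  refine not_ae_dimH_slice_lt h hms hK hμ hμK h𝒬 hδ hδt x N ?_
  have hs : Summable fun j : ℕ => 1 / (((j + N : ℕ) : ℝ) + 1) ^ 2 :=
    (summable_nat_add_iff N).2 (summable_one_div_add_one_pow one_lt_two)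
  refine ne_top_of_le_ne_top ?_ (ENNReal.tsum_le_tsum fun j => hN (j + N) (by omega))
  rw [← ENNReal.ofReal_tsum_of_nonneg (fun j => by positivity) hs]
  exact ENNReal.ofReal_ne_top

end PositiveSlices

end

/-! ### The theorem -/

/-- Measurability of `A` is Carathéodory measurability for the Hausdorff outer measure; measures
of arbitrary sets are the outer measures. -/
theorem theorem1p2 (n m : ℕ) (s : ℝ) (hms : (m : ℝ) < s) (hsn : s ≤ (n : ℝ))
    (A : Set (E n))
    (hA : (Measure.hausdorffMeasure s : Measure (E n)).toOuterMeasure.IsCaratheodory A)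
    (hpos : 0 < (Measure.hausdorffMeasure s : Measure (E n)) A)
    (hfin : (Measure.hausdorffMeasure s : Measure (E n)) A < ∞) :
    dimH {x : E n | gammaG n (n - m) (sectionPlanes m s A x) = 0} ≤ (m : ℝ≥0∞) ∧
    ∃ B : Set (E n), MeasurableSet B ∧ dimH B ≤ (m : ℝ≥0∞) ∧
      ∀ x : E n, x ∉ B → 0 < gammaG n (n - m) (sectionPlanes m s A x) := by
  have h : m < n := by exact_mod_cast hms.trans_le hsn
  have hs : 0 < s := (Nat.cast_nonneg m).trans_lt hms
  obtain ⟨K, hKA, hK, hKpos, C, hC, hgrowth⟩ := exists_isCompact_growth hs hA hpos hfin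
  obtain ⟨B, hBm, hBd, hB⟩ :
      ∃ B : Set (E n), MeasurableSet B ∧ dimH B ≤ (m : ℝ≥0∞) ∧ ∀ x ∉ B, ¬ ∀ᵐ g ∂haarO n,
        ¬ ENNReal.ofReal (s - m) ≤ dimH (K ∩ {y | transv m g (y - x) = 0}) := by
    have : IsFiniteMeasure ((Measure.hausdorffMeasure s : Measure (E n)).restrict K) :=
      ⟨by rw [Measure.restrict_apply_univ]; exact (measure_mono hKA).trans_lt hfin⟩
    have : NullSingletonClass (Measure.hausdorffMeasure s : Measure (E n)) :=
      Measure.nullSingletonClass_hausdorff (E n) hs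
    refine exists_exceptional_set_slices
      (μ := (Measure.hausdorffMeasure s : Measure (E n)).restrict K) h hms hK ?_ ?_ hC ?_
    · rw [Ne, Measure.restrict_eq_zero]
      exact hKpos.ne'
    · rw [Measure.restrict_apply hK.measurableSet.compl, compl_inter_self, measure_empty]
    · filter_upwards [ae_restrict_mem hK.measurableSet] with y hy r hr
      rw [Measure.restrict_apply Metric.isClosed_closedBall.measurableSet, inter_comm]
      exact hgrowth y hy r hr
  have key : ∀ x ∉ B, 0 < gammaG n (n - m) (sectionPlanes m s A x) := by
    intro x hx
    -- Null outer measure on the Grassmannian pulls back to a Haar null set of rotations, so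
    -- measurability of the set of planes is never needed. Almost every rotation would then fail the
    -- lower bound, as the upper bound holds almost surely.
    refine pos_iff_ne_zero.2 fun h0 => hB x hx ?_
    rw [gammaG, dif_pos (Nat.sub_le n m)] at h0
    have hpre := Measure.preimage_null_of_map_null
      (G.continuous_rotate (G.coordPlane n (n - m) (Nat.sub_le n m))).measurable.aemeasurable h0
    filter_upwards [ae_dimH_section_le h hms hfin x, compl_mem_ae_iff.2 hpre] with g hle hg hge
    refine hg ?_
    have hset : (G.rotate g (G.coordPlane n (n - m) (Nat.sub_le n m))).translate x =
        {y | transv m g (y - x) = 0} := Set.ext fun y => mem_translate_rotate_iff g x y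
    rw [mem_preimage, sectionPlanes, mem_ofPred_eq, hset]
    exact le_antisymm hle (hge.trans (dimH_mono (inter_subset_inter_left _ hKA)))
  refine ⟨(dimH_mono fun x hx => ?_).trans hBd, B, hBm, hBd, key⟩
  by_contra hxB
  exact (key x hxB).ne' hx
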